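/- Let $\Omega\subset\mathbb{R}^d$ ($d\ge 1$) be a bounded Lipschitz domain, $T>0$, $I=(0,T)$, $U=L^2(I\times\Omega)$, $s\in(0,1)$, and let $W$ be one of the following fractional Sobolev spaces: * $H^s(\Omega)$, with inner product $\int_\Omega vw\,dx+\frac{c_{d,s}}2\int_\Omega\int_\Omega\frac{(v(x)-v(y))(w(x)-w(y))}{|x-y|^{d+2s}}\,dy\,dx$, where $c_{d,s}=\frac{s2^{2s}\Gamma(s+d/2)}{\pi^{d/2}\Gamma(1-s)}$; * $H^s_0(\Omega)$, the closure of $C_c^\infty(\Omega)$ in $H^s(\Omega)$; * $\tilde H^s(\Omega)$, the functions in $H^s(\mathbb{R}^d)$ that vanish outside $\Omega$, with the $H^s(\mathbb{R}^d)$ inner product; * the spectral space $\mathbb{H}^s(\Omega)=\{w=\sum_n w_n\phi_n\in L^2(\Omega):\sum_n\lambda_n^sw_n^2<\infty\}$ with inner product $\sum_n\lambda_n^sv_nw_n$, where $(\phi_n)$ are the orthonormal eigenfunctions, with eigenvalues $\lambda_n$, of the Laplacian with zero Dirichlet boundary conditions. A function $w$ on $\Omega$ is identified with its extension $(t,x)\mapsto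 w(x)$ to $I\times\Omega$. Let $\alpha,\beta,\gamma>0$, $p\in(0,1)$, and let $f:U\to\mathbb{R}$ be weakly lower semicontinuous, bounded from below by an affine function, and continuously Fréchet differentiable. Assume that $f'$ is completely continuous ($u_k\rightharpoonup u$ implies $f'(u_k)\to f'(u)$) and Lipschitz continuous on bounded sets. Put $K=\{(u,w)\in U\times W: |u(t,x)|\le w(x)\text{ for a.a. }(t,x)\}$, and, for $\epsilon>0$, let $$\psi_\epsilon(t)=\begin{cases}\frac p2\frac{t}{\epsilon^{2-p}}+(1-\frac p2)\epsilon^p,&0\le t<\epsilon^2,\\ t^{p/2},&t\ge\epsilon^2.\end{cases}$$ Consider the following algorithm. Choose $b>1$, $L>0$, a decreasing sequence $\epsilon_k>0$ with $\epsilon_k\to0$, and a starting point $(u_0,w_0)\in U\times W$. For $k=0,1,2,\dots$, let $L_k$ be the smallest number in $\{Lb^l:l=0,1,2,\dots\}$ such that the solution $(u_{k+1},w_{k+1})$ of $$\min_{(u,w)\in K}\ f'(u_k)(u-u_k)+\frac\alpha2\|u\|_U^2+\frac\beta2\|w\|_W^2+\gamma\int_\Omega\psi_{\epsilon_k}'(w_k^2)(w^2-w_k^2)\,dx+\frac{L_k}2\|u-u_k\|_U^2$$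 satisfies $$f(u_{k+1})\le f(u_k)+f'(u_k)(u_{k+1}-u_k)+L_k\|u_{k+1}-u_k\|_U^2 .$$ Let $(u_k,w_k,L_k)$ be a sequence generated by this algorithm, and let $\bar u\in U$, $\bar w\in W$ be such that, along a common subsequence, $u_{k_n}\rightharpoonup\bar u$ in $U$ and $w_{k_n}\rightharpoonup\bar w$ in $W$. Then there are $\bar\lambda\in W^*$ and $\bar\mu^1,\bar\mu^2\in U$ such that $$f'(\bar u)v+\alpha(\bar u,v)_U+\beta(\bar w,z)_W+\gamma\langle\bar\lambda,z\rangle_W+(\bar\mu^1,z-v)_U+(\bar\mu^2,z+v)_U=0\qquad\text{for all }(v,z)\in U\times W,$$ $$\langle\bar\lambda,\bar w\rangle_W\ge p\int_\Omega|\bar w|^p\,dx,\qquad \bar\mu^1\in\partial I_C(\bar w-\bar u),\qquad\bar\mu^2\in\partial I_C(\bar w+\bar u),$$ where $C=\{v\in U:v\ge0\}$, $I_C$ is $0$ on $C$ and $+\infty$ elsewhere, and $\partial$ is the convex subdifferential. -/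

import Mathlib

open MeasureTheory Set Filter Topology TopologicalSpace
open scoped ContDiff NNReal

noncomputable section

namespace FracSparse

/-! ### The domain and the basic function spaces -/

/-- The Euclidean space `ℝ^d`. -/
abbrev Sp (d : ℕ) : Type := EuclideanSpace ℝ (Fin d)

/-- `Ω` is a bounded Lipschitz domain: a nonempty, connected, bounded open set which near each of
its boundary points is, in suitable orthonormal coordinates, the region below the graph of a
Lipschitz function.  Here `n` is the vertical direction, and the graph function `γ` is only
evaluated on the hyperplane orthogonal to `n`. -/
structure IsBoundedLipschitzDomain {d : ℕ} (Ω : Opens (Sp d)) : Prop where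
  connected : IsConnected (Ω : Set (Sp d))
  bounded : Bornology.IsBounded (Ω : Set (Sp d))
  lipschitz : ∀ x ∈ frontier (Ω : Set (Sp d)), ∃ (n : Sp d) (γ : Sp d → ℝ) (M : ℝ≥0),
    ‖n‖ = 1 ∧ LipschitzWith M γ ∧
      ∀ᶠ y in 𝓝 x, (y ∈ Ω ↔ inner ℝ y n < γ (y - inner ℝ y n • n))

/-- Lebesgue measure on `Ω`. -/
abbrev volOn {d : ℕ} (Ω : Opens (Sp d)) : Measure (Sp d) :=
  (volume : Measure (Sp d)).restrict (Ω : Set (Sp d))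

/-- Lebesgue measure on the cylinder `I × Ω`, `I = (0,T)`. -/
abbrev volCyl (T : ℝ) {d : ℕ} (Ω : Opens (Sp d)) : Measure (ℝ × Sp d) :=
  ((volume : Measure ℝ).restrict (Ioo 0 T)).prod (volOn Ω)

/-- The space `L²(Ω)`. -/
abbrev LTwo {d : ℕ} (Ω : Opens (Sp d)) : Type := Lp ℝ 2 (volOn Ω)

/-- The space `U = L²(I × Ω)`. -/
abbrev USpace (T : ℝ) {d : ℕ} (Ω : Opens (Sp d)) : Type := Lp ℝ 2 (volCyl T Ω)

/-- The constant extension `(t, x) ↦ w x` of `w ∈ L²(Ω)`, as an element of `U`. -/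
def cylExt (T : ℝ) {d : ℕ} {Ω : Opens (Sp d)} (w : LTwo Ω) : USpace T Ω :=
  ((Lp.memLp w).comp_snd ((volume : Measure ℝ).restrict (Ioo 0 T))).toLp (fun q => w q.2)

/-- `C_c^∞(Ω)`. -/
structure IsTest {d : ℕ} (Ω : Opens (Sp d)) (φ : Sp d → ℝ) : Prop where
  smooth : ContDiff ℝ ∞ φ
  compact : HasCompactSupport φ
  support : tsupport φ ⊆ (Ω : Set (Sp d))

lemma IsTest.zero {d : ℕ} (Ω : Opens (Sp d)) : IsTest Ω (0 : Sp d → ℝ) where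
  smooth := contDiff_const
  compact := HasCompactSupport.zero
  support := by simp [tsupport]

lemma IsTest.add {d : ℕ} {Ω : Opens (Sp d)} {φ ψ : Sp d → ℝ} (hφ : IsTest Ω φ)
    (hψ : IsTest Ω ψ) : IsTest Ω (φ + ψ) where
  smooth := hφ.smooth.add hψ.smooth
  compact := hφ.compact.add hψ.compact
  support := (tsupport_add φ ψ).trans (union_subset hφ.support hψ.support)

lemma IsTest.smul {d : ℕ} {Ω : Opens (Sp d)} {φ : Sp d → ℝ} (c : ℝ) (hφ : IsTest Ω φ) :
    IsTest Ω (c • φ) where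
  smooth := hφ.smooth.const_smul c
  compact := hφ.compact.smul_left (f := fun _ => c)
  support := (tsupport_smul_subset_right (fun _ => c) φ).trans hφ.support

/-! ### The Sobolev–Slobodeckij inner product -/

/-- The normalization constant `c_{d,s}` of the fractional Laplacian. -/
def cConst (d : ℕ) (s : ℝ) : ℝ :=
  s * 2 ^ (2 * s) * Real.Gamma (s + d / 2) / (Real.pi ^ ((d : ℝ) / 2) * Real.Gamma (1 - s))

lemma cConst_nonneg (d : ℕ) (s : Ioo (0 : ℝ) 1) : 0 ≤ cConst d s := by
  have h0 := s.2.1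
  have h1 := s.2.2
  have hG1 : 0 < Real.Gamma ((s : ℝ) + d / 2) := Real.Gamma_pos_of_pos (by positivity)
  have hG2 : 0 < Real.Gamma (1 - (s : ℝ)) := Real.Gamma_pos_of_pos (by linarith)
  unfold cConst
  positivity

/-- The difference quotient `(g x - g y) / |x - y|^(d/2+s)`. -/
def diffQuot {d : ℕ} (s : ℝ) (g : Sp d → ℝ) (q : Sp d × Sp d) : ℝ :=
  (g q.1 - g q.2) / ‖q.1 - q.2‖ ^ ((d : ℝ) / 2 + s)

/-- Membership in `H^s` with respect to a measure `ν` (Lebesgue measure on `Ω` for `H^s(Ω)`,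
Lebesgue measure on the whole space for `H^s(ℝ^d)`). -/
def MemHs {d : ℕ} (ν : Measure (Sp d)) (s : ℝ) (g : Sp d → ℝ) : Prop :=
  MemLp g 2 ν ∧ MemLp (diffQuot s g) 2 (ν.prod ν)

/-- The `H^s` inner product with respect to a measure `ν`. -/
def hsInner {d : ℕ} (ν : Measure (Sp d)) (s : ℝ) (g h : Sp d → ℝ) : ℝ :=
  (∫ x, g x * h x ∂ν) + cConst d s / 2 *
    ∫ q : Sp d × Sp d, (g q.1 - g q.2) * (h q.1 - h q.2) / ‖q.1 - q.2‖ ^ ((d : ℝ) + 2 * s)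
      ∂(ν.prod ν)

lemma diffQuot_add {d : ℕ} (s : ℝ) (g h : Sp d → ℝ) :
    diffQuot s (g + h) = diffQuot s g + diffQuot s h := by
  funext q
  simp only [diffQuot, Pi.add_apply]
  ring

lemma diffQuot_smul {d : ℕ} (s c : ℝ) (g : Sp d → ℝ) :
    diffQuot s (c • g) = c • diffQuot s g := by
  funext q
  simp only [diffQuot, Pi.smul_apply, smul_eq_mul]
  ring

lemma diffQuot_congr {d : ℕ} {ν : Measure (Sp d)} [SFinite ν] (s : ℝ) {g h : Sp d → ℝ}
    (hgh : g =ᵐ[ν] h) : diffQuot s g =ᵐ[ν.prod ν] diffQuot s h := by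
  have h1 := Measure.quasiMeasurePreserving_fst (μ := ν) (ν := ν) |>.ae_eq_comp hgh
  have h2 := Measure.quasiMeasurePreserving_snd (μ := ν) (ν := ν) |>.ae_eq_comp hgh
  filter_upwards [h1, h2] with q hq1 hq2
  simp only [Function.comp_apply] at hq1 hq2
  simp only [diffQuot, hq1, hq2]

lemma MemHs.congr {d : ℕ} {ν : Measure (Sp d)} [SFinite ν] {s : ℝ} {g h : Sp d → ℝ}
    (hg : MemHs ν s g) (hgh : g =ᵐ[ν] h) : MemHs ν s h :=
  ⟨hg.1.ae_eq hgh, hg.2.ae_eq (diffQuot_congr s hgh)⟩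

lemma MemHs.zero {d : ℕ} (ν : Measure (Sp d)) (s : ℝ) : MemHs ν s (0 : Sp d → ℝ) := by
  refine ⟨MemLp.zero, ?_⟩
  have : diffQuot s (0 : Sp d → ℝ) = 0 := by
    funext q
    simp [diffQuot]
  rw [this]
  exact MemLp.zero

lemma MemHs.add {d : ℕ} {ν : Measure (Sp d)} {s : ℝ} {g h : Sp d → ℝ}
    (hg : MemHs ν s g) (hh : MemHs ν s h) : MemHs ν s (g + h) := by
  refine ⟨hg.1.add hh.1, ?_⟩
  rw [diffQuot_add]
  exact hg.2.add hh.2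

lemma MemHs.smul {d : ℕ} {ν : Measure (Sp d)} {s : ℝ} {g : Sp d → ℝ} (c : ℝ)
    (hg : MemHs ν s g) : MemHs ν s (c • g) := by
  refine ⟨hg.1.const_smul c, ?_⟩
  rw [diffQuot_smul]
  exact hg.2.const_smul c

lemma hsInner_eq {d : ℕ} (ν : Measure (Sp d)) (s : ℝ) (g h : Sp d → ℝ) :
    hsInner ν s g h = (∫ x, g x * h x ∂ν) + cConst d s / 2 *
      ∫ q, diffQuot s g q * diffQuot s h q ∂(ν.prod ν) := by
  unfold hsInner diffQuot
  congr 3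
  funext q
  have : ‖q.1 - q.2‖ ^ ((d : ℝ) + 2 * s)
      = ‖q.1 - q.2‖ ^ ((d : ℝ) / 2 + s) * ‖q.1 - q.2‖ ^ ((d : ℝ) / 2 + s) := by
    rw [← pow_two, ← Real.rpow_mul_natCast (norm_nonneg _)]
    congr 1
    push_cast
    ring
  rw [this, div_mul_div_comm]

lemma hsInner_comm {d : ℕ} (ν : Measure (Sp d)) (s : ℝ) (g h : Sp d → ℝ) :
    hsInner ν s g h = hsInner ν s h g := by
  simp only [hsInner_eq, mul_comm]

lemma hsInner_congr {d : ℕ} {ν : Measure (Sp d)} [SFinite ν] (s : ℝ) {g g' h h' : Sp d → ℝ}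
    (hg : g =ᵐ[ν] g') (hh : h =ᵐ[ν] h') : hsInner ν s g h = hsInner ν s g' h' := by
  simp only [hsInner_eq]
  congr 1
  · exact integral_congr_ae (hg.mul hh)
  · congr 1
    exact integral_congr_ae ((diffQuot_congr s hg).mul (diffQuot_congr s hh))

lemma hsInner_add_left {d : ℕ} {ν : Measure (Sp d)} {s : ℝ} {g g' h : Sp d → ℝ}
    (hg : MemHs ν s g) (hg' : MemHs ν s g') (hh : MemHs ν s h) :
    hsInner ν s (g + g') h = hsInner ν s g h + hsInner ν s g' h := by
  simp only [hsInner_eq, diffQuot_add, Pi.add_apply, add_mul]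
  have e1 : ∫ x, (g x * h x + g' x * h x) ∂ν = (∫ x, g x * h x ∂ν) + ∫ x, g' x * h x ∂ν :=
    integral_add (hg.1.integrable_mul hh.1) (hg'.1.integrable_mul hh.1)
  have e2 : ∫ q, (diffQuot s g q * diffQuot s h q + diffQuot s g' q * diffQuot s h q) ∂(ν.prod ν)
      = (∫ q, diffQuot s g q * diffQuot s h q ∂(ν.prod ν))
        + ∫ q, diffQuot s g' q * diffQuot s h q ∂(ν.prod ν) :=
    integral_add (hg.2.integrable_mul hh.2) (hg'.2.integrable_mul hh.2)
  rw [e1, e2]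
  ring

lemma hsInner_smul_left {d : ℕ} (ν : Measure (Sp d)) (s c : ℝ) (g h : Sp d → ℝ) :
    hsInner ν s (c • g) h = c * hsInner ν s g h := by
  simp only [hsInner_eq, diffQuot_smul, Pi.smul_apply, smul_eq_mul, mul_assoc,
    integral_const_mul]
  ring

lemma hsInner_self_ge {d : ℕ} (ν : Measure (Sp d)) (s : Ioo (0 : ℝ) 1) (g : Sp d → ℝ) :
    (∫ x, g x * g x ∂ν) ≤ hsInner ν s g g := by
  rw [hsInner_eq]
  have := cConst_nonneg d s
  have h2 : 0 ≤ ∫ q, diffQuot (s : ℝ) g q * diffQuot (s : ℝ) g q ∂(ν.prod ν) :=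
    integral_nonneg fun q => mul_self_nonneg _
  nlinarith [mul_nonneg this h2]

/-! ### Eigenspaces of the Dirichlet Laplacian -/

lemma gradient_add' {d : ℕ} {φ ψ : Sp d → ℝ} (hφ : ContDiff ℝ ∞ φ) (hψ : ContDiff ℝ ∞ ψ)
    (x : Sp d) : gradient (φ + ψ) x = gradient φ x + gradient ψ x := by
  unfold gradient
  rw [fderiv_add (hφ.differentiable (by simp) x) (hψ.differentiable (by simp) x), map_add]

lemma gradient_smul' {d : ℕ} {φ : Sp d → ℝ} (hφ : ContDiff ℝ ∞ φ) (c : ℝ)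
    (x : Sp d) : gradient (c • φ) x = c • gradient φ x := by
  unfold gradient
  rw [fderiv_const_smul (hφ.differentiable (by simp) x), map_smulₛₗ]
  simp

/-- The pairs `(φ, ∇φ)` with `φ ∈ C_c^∞(Ω)`, in `L²(Ω) × L²(Ω; ℝ^d)`. -/
def testGraph {d : ℕ} (Ω : Opens (Sp d)) :
    Submodule ℝ (LTwo Ω × Lp (Sp d) 2 (volOn Ω)) where
  carrier := {q | ∃ φ, IsTest Ω φ ∧ q.1 =ᵐ[volOn Ω] φ ∧ q.2 =ᵐ[volOn Ω] gradient φ}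
  zero_mem' := by
    refine ⟨0, IsTest.zero Ω, Lp.coeFn_zero _ _ _, (Lp.coeFn_zero _ _ _).trans ?_⟩
    refine Eventually.of_forall fun x => ?_
    simp [gradient]
  add_mem' := by
    rintro q r ⟨φ, hφ, h1, h2⟩ ⟨ψ, hψ, h3, h4⟩
    refine ⟨φ + ψ, hφ.add hψ, (Lp.coeFn_add _ _).trans (h1.add h3),
      (Lp.coeFn_add _ _).trans ((h2.add h4).trans ?_)⟩
    exact Eventually.of_forall fun x => (gradient_add' hφ.smooth hψ.smooth x).symm
  smul_mem' := by
    rintro c q ⟨φ, hφ, h1, h2⟩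
    refine ⟨c • φ, hφ.smul c, (Lp.coeFn_smul _ _).trans (h1.const_smul c),
      (Lp.coeFn_smul _ _).trans ((h2.const_smul c).trans ?_)⟩
    exact Eventually.of_forall fun x => (gradient_smul' hφ.smooth c x).symm

/-- The pairs `(w, ∇w)` with `w ∈ H_0^1(Ω)`, the closure of `C_c^∞(Ω)` in `H^1(Ω)`. -/
def hOneZeroGraph {d : ℕ} (Ω : Opens (Sp d)) :
    Submodule ℝ (LTwo Ω × Lp (Sp d) 2 (volOn Ω)) :=
  (testGraph Ω).topologicalClosure

/-- The eigenspace of the Laplacian with zero Dirichlet boundary conditions for the eigenvalue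
`l`: all `w ∈ H_0^1(Ω)` such that `∫ ∇w · ∇φ = l ∫ w φ` for all `φ ∈ C_c^∞(Ω)`. It is `{0}` if `l`
is no eigenvalue. -/
def dirichletEigenspace {d : ℕ} (Ω : Opens (Sp d)) (l : ℝ) : Submodule ℝ (LTwo Ω) where
  carrier := {w | ∃ g, (w, g) ∈ hOneZeroGraph Ω ∧
    ∀ q ∈ testGraph Ω, inner ℝ g q.2 = l * inner ℝ w q.1}
  zero_mem' := ⟨0, (hOneZeroGraph Ω).zero_mem, fun q _ => by simp⟩
  add_mem' := by
    rintro v w ⟨g, hg, h1⟩ ⟨h, hh, h2⟩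
    refine ⟨g + h, (hOneZeroGraph Ω).add_mem hg hh, fun q hq => ?_⟩
    rw [inner_add_left, inner_add_left, h1 q hq, h2 q hq]
    ring
  smul_mem' := by
    rintro c w ⟨g, hg, h1⟩
    refine ⟨c • g, (hOneZeroGraph Ω).smul_mem c hg, fun q hq => ?_⟩
    rw [real_inner_smul_left, real_inner_smul_left, h1 q hq]
    ring

/-- The component of `w` in the eigenspace for `l`, i.e. `∑ w_n φ_n` over the orthonormal
eigenfunctions `φ_n` with eigenvalue `l`, where `w_n = ∫ w φ_n`. (The eigenspaces are closed, so
that taking the closure changes nothing; it makes the orthogonal projection available.) -/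
def eigenComp {d : ℕ} {Ω : Opens (Sp d)} (l : ℝ) (w : LTwo Ω) : LTwo Ω :=
  (dirichletEigenspace Ω l).topologicalClosure.starProjection w

/-- `ℍ^s(Ω)` in spectral form: the functions `w = ∑ w_n φ_n ∈ L²(Ω)` with `∑ l_n^s w_n² < ∞`. The
sum is grouped by the distinct eigenvalues `l` (all of which are positive), since
`∑_{l_n = l} w_n² = ‖eigenComp l w‖²`. -/
def spectralSpace {d : ℕ} (Ω : Opens (Sp d)) (s : ℝ) : Submodule ℝ (LTwo Ω) where
  carrier := {w | w ∈ (⨆ l : Ioi (0 : ℝ), dirichletEigenspace Ω l).topologicalClosure ∧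
    Summable fun l : Ioi (0 : ℝ) => (l : ℝ) ^ s * ‖eigenComp (l : ℝ) w‖ ^ 2}
  zero_mem' := ⟨Submodule.zero_mem _, by simp [eigenComp, summable_zero]⟩
  add_mem' := by
    rintro v w ⟨hv, h1⟩ ⟨hw, h2⟩
    refine ⟨Submodule.add_mem _ hv hw, ?_⟩
    refine Summable.of_nonneg_of_le (fun l => ?_) (fun l => ?_) ((h1.add h2).mul_left 2)
    · have := Real.rpow_nonneg (le_of_lt l.2) s
      positivity
    · have hl := Real.rpow_nonneg (le_of_lt l.2) s
      have e : eigenComp (l : ℝ) (v + w) = eigenComp (l : ℝ) v + eigenComp (l : ℝ) w := by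
        simp [eigenComp]
      have hn := norm_add_le (eigenComp (l : ℝ) v) (eigenComp (l : ℝ) w)
      have : ‖eigenComp (l : ℝ) (v + w)‖ ^ 2
          ≤ 2 * (‖eigenComp (l : ℝ) v‖ ^ 2 + ‖eigenComp (l : ℝ) w‖ ^ 2) := by
        rw [e]
        nlinarith [norm_nonneg (eigenComp (l : ℝ) v + eigenComp (l : ℝ) w),
          sq_nonneg (‖eigenComp (l : ℝ) v‖ - ‖eigenComp (l : ℝ) w‖)]
      nlinarith [mul_le_mul_of_nonneg_left this hl]
  smul_mem' := by
    rintro c w ⟨hw, h1⟩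
    refine ⟨Submodule.smul_mem _ c hw, ?_⟩
    refine (h1.mul_left (c ^ 2)).congr fun l => ?_
    have e : eigenComp (l : ℝ) (c • w) = c • eigenComp (l : ℝ) w := by
      simp [eigenComp]
    rw [e, norm_smul, mul_pow, Real.norm_eq_abs, sq_abs]
    ring

/-- The inner product `∑ l_n^s v_n w_n` of the spectral space. -/
def spectralInner {d : ℕ} {Ω : Opens (Sp d)} (s : ℝ) (v w : LTwo Ω) : ℝ :=
  ∑' l : Ioi (0 : ℝ), (l : ℝ) ^ s * inner ℝ (eigenComp (l : ℝ) v) (eigenComp (l : ℝ) w)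

lemma spectral_summable {d : ℕ} {Ω : Opens (Sp d)} {s : ℝ} {v w : LTwo Ω}
    (hv : v ∈ spectralSpace Ω s) (hw : w ∈ spectralSpace Ω s) :
    Summable fun l : Ioi (0 : ℝ) =>
      (l : ℝ) ^ s * inner ℝ (eigenComp (l : ℝ) v) (eigenComp (l : ℝ) w) := by
  refine Summable.of_norm_bounded (hv.2.add hw.2) fun l => ?_
  have hl := Real.rpow_nonneg (le_of_lt l.2) s
  have h1 := abs_real_inner_le_norm (eigenComp (l : ℝ) v) (eigenComp (l : ℝ) w)
  rw [Real.norm_eq_abs, abs_mul, abs_of_nonneg hl, ← mul_add]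
  refine mul_le_mul_of_nonneg_left (h1.trans ?_) hl
  nlinarith [sq_nonneg (‖eigenComp (l : ℝ) v‖ - ‖eigenComp (l : ℝ) w‖),
    sq_nonneg ‖eigenComp (l : ℝ) v‖, sq_nonneg ‖eigenComp (l : ℝ) w‖]

/-! ### The four fractional Sobolev spaces -/

/-- The zero extension of `w ∈ L²(Ω)` to the whole space. -/
def zeroExt {d : ℕ} {Ω : Opens (Sp d)} (w : LTwo Ω) : Sp d → ℝ :=
  (Ω : Set (Sp d)).indicator w

lemma zeroExt_ae {d : ℕ} {Ω : Opens (Sp d)} {w : LTwo Ω} {g : Sp d → ℝ}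
    (h : w =ᵐ[volOn Ω] g) : zeroExt w =ᵐ[volume] (Ω : Set (Sp d)).indicator g :=
  (ae_eq_restrict_iff_indicator_ae_eq Ω.isOpen.measurableSet).1 h

lemma zeroExt_zero {d : ℕ} (Ω : Opens (Sp d)) : zeroExt (0 : LTwo Ω) =ᵐ[volume] 0 :=
  (zeroExt_ae (Lp.coeFn_zero _ _ _)).trans (by simp [indicator_zero'])

lemma zeroExt_add {d : ℕ} {Ω : Opens (Sp d)} (v w : LTwo Ω) :
    zeroExt (v + w) =ᵐ[volume] zeroExt v + zeroExt w :=
  (zeroExt_ae (Lp.coeFn_add v w)).trans (by rw [indicator_add']; rfl)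

lemma zeroExt_smul {d : ℕ} {Ω : Opens (Sp d)} (c : ℝ) (w : LTwo Ω) :
    zeroExt (c • w) =ᵐ[volume] c • zeroExt w :=
  (zeroExt_ae (Lp.coeFn_smul c w)).trans (Eventually.of_forall fun x => by
    by_cases hx : x ∈ (Ω : Set (Sp d)) <;> simp [zeroExt, hx])

/-- The space `H^s(Ω)`. -/
def hsSpace {d : ℕ} (Ω : Opens (Sp d)) (s : ℝ) : Submodule ℝ (LTwo Ω) where
  carrier := {w | MemHs (volOn Ω) s w}
  zero_mem' := (MemHs.zero _ s).congr (Lp.coeFn_zero _ _ _).symm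
  add_mem' := fun hv hw => (MemHs.add hv hw).congr (Lp.coeFn_add _ _).symm
  smul_mem' := fun c _ hw => (MemHs.smul c hw).congr (Lp.coeFn_smul _ _).symm

/-- The functions `φ_n` converge to `w` in `H^s(Ω)`. -/
def TendstoHs {d : ℕ} (ν : Measure (Sp d)) (s : ℝ) (φ : ℕ → Sp d → ℝ) (w : Sp d → ℝ) : Prop :=
  Tendsto (fun n => eLpNorm (φ n - w) 2 ν) atTop (𝓝 0) ∧
    Tendsto (fun n => eLpNorm (diffQuot s (φ n - w)) 2 (ν.prod ν)) atTop (𝓝 0)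

lemma TendstoHs.congr {d : ℕ} {ν : Measure (Sp d)} [SFinite ν] {s : ℝ} {φ : ℕ → Sp d → ℝ}
    {v w : Sp d → ℝ} (h : TendstoHs ν s φ v) (hvw : v =ᵐ[ν] w) : TendstoHs ν s φ w := by
  have e : ∀ n, φ n - v =ᵐ[ν] φ n - w := fun n => (EventuallyEq.refl _ (φ n)).sub hvw
  refine ⟨h.1.congr fun n => eLpNorm_congr_ae (e n), h.2.congr fun n => ?_⟩
  exact eLpNorm_congr_ae (diffQuot_congr s (e n))

lemma MemHs.sub {d : ℕ} {ν : Measure (Sp d)} {s : ℝ} {g h : Sp d → ℝ}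
    (hg : MemHs ν s g) (hh : MemHs ν s h) : MemHs ν s (g - h) := by
  have := hg.add (hh.smul (-1))
  rwa [neg_one_smul, ← sub_eq_add_neg] at this

lemma TendstoHs.add {d : ℕ} {ν : Measure (Sp d)} {s : ℝ} {φ ψ : ℕ → Sp d → ℝ} {v w : Sp d → ℝ}
    (h1 : TendstoHs ν s φ v) (h2 : TendstoHs ν s ψ w) (hφ : ∀ n, MemHs ν s (φ n))
    (hψ : ∀ n, MemHs ν s (ψ n)) (hv : MemHs ν s v) (hw : MemHs ν s w) :
    TendstoHs ν s (fun n => φ n + ψ n) (v + w) := by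
  have e : ∀ n, φ n + ψ n - (v + w) = (φ n - v) + (ψ n - w) := fun n => by abel
  constructor
  · have := h1.1.add h2.1
    rw [add_zero] at this
    refine tendsto_of_tendsto_of_tendsto_of_le_of_le tendsto_const_nhds this
      (fun _ => zero_le) fun n => ?_
    simp only [e]
    exact eLpNorm_add_le ((hφ n).sub hv).1.1 ((hψ n).sub hw).1.1 (by norm_num)
  · have := h1.2.add h2.2
    rw [add_zero] at this
    refine tendsto_of_tendsto_of_tendsto_of_le_of_le tendsto_const_nhds this
      (fun _ => zero_le) fun n => ?_
    simp only [e, diffQuot_add]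
    exact eLpNorm_add_le ((hφ n).sub hv).2.1 ((hψ n).sub hw).2.1 (by norm_num)

lemma TendstoHs.smul {d : ℕ} {ν : Measure (Sp d)} {s : ℝ} {φ : ℕ → Sp d → ℝ} {w : Sp d → ℝ}
    (c : ℝ) (h : TendstoHs ν s φ w) : TendstoHs ν s (fun n => c • φ n) (c • w) := by
  constructor
  · simp only [← smul_sub, eLpNorm_const_smul]
    simpa using ENNReal.Tendsto.const_mul h.1 (Or.inr enorm_ne_top)
  · simp only [← smul_sub, diffQuot_smul, eLpNorm_const_smul]
    simpa using ENNReal.Tendsto.const_mul h.2 (Or.inr enorm_ne_top)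

/-- The space `H_0^s(Ω)`: the closure of `C_c^∞(Ω)` in `H^s(Ω)`. (Test functions are in `H^s(Ω)`
anyway.) -/
def hsZeroSpace {d : ℕ} (Ω : Opens (Sp d)) (s : ℝ) : Submodule ℝ (LTwo Ω) where
  carrier := {w | MemHs (volOn Ω) s w ∧
    ∃ φ : ℕ → Sp d → ℝ, (∀ n, IsTest Ω (φ n) ∧ MemHs (volOn Ω) s (φ n)) ∧
      TendstoHs (volOn Ω) s φ w}
  zero_mem' := by
    refine ⟨(hsSpace Ω s).zero_mem, fun _ => 0, fun _ => ⟨IsTest.zero Ω, MemHs.zero _ s⟩, ?_⟩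
    refine TendstoHs.congr (v := 0) ?_ (Lp.coeFn_zero _ _ _).symm
    have e : diffQuot s (0 : Sp d → ℝ) = 0 := by
      funext q
      simp [diffQuot]
    constructor <;> simp [e]
  add_mem' := by
    rintro v w ⟨hv, φ, hφ, h1⟩ ⟨hw, ψ, hψ, h2⟩
    refine ⟨(hsSpace Ω s).add_mem hv hw, fun n => φ n + ψ n,
      fun n => ⟨(hφ n).1.add (hψ n).1, (hφ n).2.add (hψ n).2⟩, ?_⟩
    exact (h1.add h2 (fun n => (hφ n).2) (fun n => (hψ n).2) hv hw).congr (Lp.coeFn_add _ _).symm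
  smul_mem' := by
    rintro c w ⟨hw, φ, hφ, h1⟩
    refine ⟨(hsSpace Ω s).smul_mem c hw, fun n => c • φ n,
      fun n => ⟨(hφ n).1.smul c, (hφ n).2.smul c⟩, ?_⟩
    exact (h1.smul c).congr (Lp.coeFn_smul _ _).symm

/-- The space `H̃^s(Ω)` of the functions in `H^s(ℝ^d)` that vanish outside `Ω`, each of them given
by its restriction to `Ω`. -/
def hsTildeSpace {d : ℕ} (Ω : Opens (Sp d)) (s : ℝ) : Submodule ℝ (LTwo Ω) where
  carrier := {w | MemHs volume s (zeroExt w)}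
  zero_mem' := (MemHs.zero _ s).congr (zeroExt_zero Ω).symm
  add_mem' := fun hv hw => (MemHs.add hv hw).congr (zeroExt_add _ _).symm
  smul_mem' := fun c _ hw => (MemHs.smul c hw).congr (zeroExt_smul _ _).symm

/-- The four choices of the fractional Sobolev space. -/
inductive Kind
  /-- `H^s(Ω)` -/
  | full
  /-- `H_0^s(Ω)` -/
  | zero
  /-- `H̃^s(Ω)` -/
  | tilde
  /-- the spectral space -/
  | spectral

/-- The fractional Sobolev space of the given kind, as a set of functions. -/
def fracSpace {d : ℕ} (Ω : Opens (Sp d)) (s : ℝ) : Kind → Submodule ℝ (LTwo Ω)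
  | .full => hsSpace Ω s
  | .zero => hsZeroSpace Ω s
  | .tilde => hsTildeSpace Ω s
  | .spectral => spectralSpace Ω s

/-- The inner product of the fractional Sobolev space of the given kind. -/
def fracInner {d : ℕ} {Ω : Opens (Sp d)} (s : ℝ) : Kind → LTwo Ω → LTwo Ω → ℝ
  | .full, v, w => hsInner (volOn Ω) s v w
  | .zero, v, w => hsInner (volOn Ω) s v w
  | .tilde, v, w => hsInner volume s (zeroExt v) (zeroExt w)
  | .spectral, v, w => spectralInner s v w

lemma hsInner_add_left' {d : ℕ} {ν : Measure (Sp d)} [SFinite ν] {s : ℝ}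
    {a g g' h : Sp d → ℝ} (ha : a =ᵐ[ν] g + g')
    (hg : MemHs ν s g) (hg' : MemHs ν s g') (hh : MemHs ν s h) :
    hsInner ν s a h = hsInner ν s g h + hsInner ν s g' h := by
  rw [hsInner_congr s ha (EventuallyEq.refl _ h), hsInner_add_left hg hg' hh]

lemma hsInner_smul_left' {d : ℕ} {ν : Measure (Sp d)} [SFinite ν] {s c : ℝ}
    {a g h : Sp d → ℝ} (ha : a =ᵐ[ν] c • g) :
    hsInner ν s a h = c * hsInner ν s g h := by
  rw [hsInner_congr s ha (EventuallyEq.refl _ h), hsInner_smul_left]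

lemma fracInner_comm {d : ℕ} {Ω : Opens (Sp d)} (s : ℝ) (k : Kind) (v w : LTwo Ω) :
    fracInner s k v w = fracInner s k w v := by
  cases k
  · exact hsInner_comm _ _ _ _
  · exact hsInner_comm _ _ _ _
  · exact hsInner_comm _ _ _ _
  · simp only [fracInner, spectralInner, real_inner_comm]

lemma fracInner_add_left {d : ℕ} {Ω : Opens (Sp d)} (s : ℝ) (k : Kind) {v v' w : LTwo Ω}
    (hv : v ∈ fracSpace Ω s k) (hv' : v' ∈ fracSpace Ω s k) (hw : w ∈ fracSpace Ω s k) :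
    fracInner s k (v + v') w = fracInner s k v w + fracInner s k v' w := by
  cases k
  · exact hsInner_add_left' (Lp.coeFn_add _ _) hv hv' hw
  · exact hsInner_add_left' (Lp.coeFn_add _ _) hv.1 hv'.1 hw.1
  · exact hsInner_add_left' (zeroExt_add _ _) hv hv' hw
  · simp only [fracInner, spectralInner]
    rw [← (spectral_summable hv hw).tsum_add (spectral_summable hv' hw)]
    refine tsum_congr fun l => ?_
    have e : eigenComp (l : ℝ) (v + v') = eigenComp (l : ℝ) v + eigenComp (l : ℝ) v' := by
      simp [eigenComp]
    rw [e, inner_add_left]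
    ring

lemma fracInner_smul_left {d : ℕ} {Ω : Opens (Sp d)} (s : ℝ) (k : Kind) (c : ℝ) (v w : LTwo Ω) :
    fracInner s k (c • v) w = c * fracInner s k v w := by
  cases k
  · exact hsInner_smul_left' (Lp.coeFn_smul _ _)
  · exact hsInner_smul_left' (Lp.coeFn_smul _ _)
  · exact hsInner_smul_left' (zeroExt_smul _ _)
  · simp only [fracInner, spectralInner]
    rw [← tsum_mul_left]
    refine tsum_congr fun l => ?_
    have e : eigenComp (l : ℝ) (c • v) = c • eigenComp (l : ℝ) v := by
      simp [eigenComp]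
    rw [e, real_inner_smul_left]
    ring

lemma lTwo_norm_sq {d : ℕ} {Ω : Opens (Sp d)} (w : LTwo Ω) :
    ‖w‖ ^ 2 = ∫ x, w x * w x ∂(volOn Ω) := by
  rw [← real_inner_self_eq_norm_sq, L2.inner_def]
  rfl

lemma zeroExt_integral {d : ℕ} {Ω : Opens (Sp d)} (w : LTwo Ω) :
    ∫ x, zeroExt w x * zeroExt w x = ∫ x, w x * w x ∂(volOn Ω) := by
  rw [← integral_indicator Ω.isOpen.measurableSet]
  congr 1
  funext x
  by_cases hx : x ∈ (Ω : Set (Sp d)) <;> simp [zeroExt, hx]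

lemma fracInner_nonneg {d : ℕ} {Ω : Opens (Sp d)} (s : Ioo (0 : ℝ) 1) (k : Kind) (w : LTwo Ω) :
    0 ≤ fracInner (s : ℝ) k w w := by
  cases k
  · exact (integral_nonneg fun x => mul_self_nonneg _).trans (hsInner_self_ge _ s _)
  · exact (integral_nonneg fun x => mul_self_nonneg _).trans (hsInner_self_ge _ s _)
  · exact (integral_nonneg fun x => mul_self_nonneg _).trans (hsInner_self_ge _ s _)
  · refine tsum_nonneg fun l => mul_nonneg (Real.rpow_nonneg (le_of_lt l.2) _) ?_
    exact real_inner_self_nonneg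

lemma fracInner_definite {d : ℕ} {Ω : Opens (Sp d)} (s : Ioo (0 : ℝ) 1) (k : Kind) {w : LTwo Ω}
    (hw : w ∈ fracSpace Ω (s : ℝ) k) (h : fracInner (s : ℝ) k w w = 0) : w = 0 := by
  have key : ‖w‖ ^ 2 ≤ 0 → w = 0 := fun h0 => by
    have h1 : ‖w‖ ^ 2 = 0 := le_antisymm h0 (sq_nonneg _)
    exact norm_eq_zero.1 (pow_eq_zero_iff (two_ne_zero) |>.1 h1)
  cases k
  · apply key
    rw [lTwo_norm_sq, ← h]
    exact hsInner_self_ge _ s _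
  · apply key
    rw [lTwo_norm_sq, ← h]
    exact hsInner_self_ge _ s _
  · apply key
    rw [lTwo_norm_sq, ← zeroExt_integral, ← h]
    exact hsInner_self_ge _ s _
  · have h0 : ∀ l : Ioi (0 : ℝ), w ∈ (dirichletEigenspace Ω (l : ℝ))ᗮ := by
      intro l
      have hs := (spectral_summable hw hw).hasSum
      change HasSum _ (fracInner (s : ℝ) Kind.spectral w w) at hs
      rw [h] at hs
      have hz := (hasSum_zero_iff_of_nonneg (fun l : Ioi (0 : ℝ) =>
        mul_nonneg (Real.rpow_nonneg (le_of_lt l.2) (s : ℝ)) real_inner_self_nonneg)).1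
          hs
      have hl := congrFun hz l
      simp only [Pi.zero_apply, mul_eq_zero] at hl
      have hp : eigenComp (l : ℝ) w = 0 := by
        rcases hl with hl | hl
        · exact absurd hl (Real.rpow_pos_of_pos l.2 _).ne'
        · exact inner_self_eq_zero.1 hl
      have := (Submodule.starProjection_apply_eq_zero_iff _).1 hp
      exact Submodule.orthogonal_le (Submodule.le_topologicalClosure _) this
    have h1 : w ∈ ((⨆ l : Ioi (0 : ℝ), dirichletEigenspace Ω l).topologicalClosure)ᗮ := by
      rw [Submodule.orthogonal_closure, ← Submodule.iInf_orthogonal]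
      exact (Submodule.mem_iInf _).2 h0
    exact inner_self_eq_zero.1 (h1 w hw.1 : inner ℝ w w = 0)

/-- The Hilbert space `W`. -/
def WSpace {d : ℕ} (Ω : Opens (Sp d)) (s : Ioo (0 : ℝ) 1) (k : Kind) : Type :=
  fracSpace Ω (s : ℝ) k

instance {d : ℕ} (Ω : Opens (Sp d)) (s : Ioo (0 : ℝ) 1) (k : Kind) :
    AddCommGroup (WSpace Ω s k) :=
  inferInstanceAs (AddCommGroup (fracSpace Ω (s : ℝ) k))

instance {d : ℕ} (Ω : Opens (Sp d)) (s : Ioo (0 : ℝ) 1) (k : Kind) :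
    Module ℝ (WSpace Ω s k) :=
  inferInstanceAs (Module ℝ (fracSpace Ω (s : ℝ) k))

/-- The embedding `W → L²(Ω)`. -/
def toLTwo {d : ℕ} {Ω : Opens (Sp d)} {s : Ioo (0 : ℝ) 1} {k : Kind} :
    WSpace Ω s k →ₗ[ℝ] LTwo Ω :=
  (fracSpace Ω (s : ℝ) k).subtype

/-- `W` is an inner product space with the inner product of the chosen kind. -/
@[reducible]
def wCore {d : ℕ} (Ω : Opens (Sp d)) (s : Ioo (0 : ℝ) 1) (k : Kind) :
    InnerProductSpace.Core ℝ (WSpace Ω s k) where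
  inner v w := fracInner (s : ℝ) k (toLTwo v) (toLTwo w)
  conj_inner_symm _ _ := fracInner_comm _ _ _ _
  re_inner_nonneg _ := fracInner_nonneg s k _
  add_left v v' w := fracInner_add_left _ _ v.2 v'.2 w.2
  smul_left _ _ _ := fracInner_smul_left _ _ _ _ _
  definite w h := Subtype.ext (fracInner_definite s k w.2 h)

instance {d : ℕ} (Ω : Opens (Sp d)) (s : Ioo (0 : ℝ) 1) (k : Kind) :
    NormedAddCommGroup (WSpace Ω s k) :=
  (wCore Ω s k).toNormedAddCommGroup

instance {d : ℕ} (Ω : Opens (Sp d)) (s : Ioo (0 : ℝ) 1) (k : Kind) :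
    InnerProductSpace ℝ (WSpace Ω s k) :=
  InnerProductSpace.ofCore (wCore Ω s k).toCore

lemma inner_eq_fracInner {d : ℕ} {Ω : Opens (Sp d)} {s : Ioo (0 : ℝ) 1} {k : Kind}
    (v w : WSpace Ω s k) : inner ℝ v w = fracInner (s : ℝ) k (toLTwo v) (toLTwo w) :=
  rfl

/-! ### Weak convergence and the assumptions on `f` -/

/-- Weak convergence of a sequence. -/
def WeakTendsto {H : Type*} [NormedAddCommGroup H] [InnerProductSpace ℝ H] (x : ℕ → H) (a : H) :
    Prop :=
  ∀ l : H →L[ℝ] ℝ, Tendsto (fun n => l (x n)) atTop (𝓝 (l a))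

/-- (Sequential) weak lower semicontinuity: `f a ≤ liminf f (x n)` whenever `x n ⇀ a`. -/
def WeaklyLSC {H : Type*} [NormedAddCommGroup H] [InnerProductSpace ℝ H] (f : H → ℝ) : Prop :=
  ∀ (x : ℕ → H) (a : H), WeakTendsto x a → ∀ c < f a, ∀ᶠ n in atTop, c < f (x n)

/-- The standing assumptions on `f`: weakly lower semicontinuous, bounded from below by an affine
function, continuously Fréchet differentiable. -/
structure StandingAssumption {H : Type*} [NormedAddCommGroup H] [InnerProductSpace ℝ H]
    (f : H → ℝ) : Prop where
  weaklyLSC : WeaklyLSC f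
  affineBound : ∃ (g : H →L[ℝ] ℝ) (c : ℝ), ∀ u, g u + c ≤ f u
  contDiff : ContDiff ℝ 1 f

/-- The assumptions on `f'`: completely continuous, and Lipschitz continuous on bounded sets. -/
structure DerivAssumption {H : Type*} [NormedAddCommGroup H] [InnerProductSpace ℝ H]
    (f : H → ℝ) : Prop where
  completelyContinuous : ∀ (x : ℕ → H) (a : H), WeakTendsto x a →
    Tendsto (fun n => fderiv ℝ f (x n)) atTop (𝓝 (fderiv ℝ f a))
  lipschitz : ∀ B : Set H, Bornology.IsBounded B → ∃ M : ℝ≥0, LipschitzOnWith M (fderiv ℝ f) B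

/-! ### The smoothing and the algorithm -/

/-- The smooth approximation `ψ_ε` of `t ↦ t^(p/2)`. -/
def psi (p ε t : ℝ) : ℝ :=
  if t < ε ^ 2 then p / 2 * (t / ε ^ (2 - p)) + (1 - p / 2) * ε ^ p else t ^ (p / 2)

/-- The derivative `ψ_ε'(t) = p/2 * min (ε^(p-2)) (t^((p-2)/2))` of `ψ_ε`, with the value
`p/2 * ε^(p-2)` at `t = 0`. -/
def psiDeriv (p ε t : ℝ) : ℝ :=
  if t < ε ^ 2 then p / 2 * ε ^ (p - 2) else p / 2 * t ^ ((p - 2) / 2)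

lemma hasDerivAt_psi {p ε : ℝ} (hε : 0 < ε) (t : ℝ) :
    HasDerivAt (psi p ε) (psiDeriv p ε t) t := by
  have e0 : (ε ^ (2 - p))⁻¹ = ε ^ (p - 2) := by
    rw [← Real.rpow_neg hε.le]
    congr 1
    ring
  have h1 : ∀ t, HasDerivAt (fun t => p / 2 * (t / ε ^ (2 - p)) + (1 - p / 2) * ε ^ p)
      (p / 2 * ε ^ (p - 2)) t := fun t => by
    have := (((hasDerivAt_id t).div_const (ε ^ (2 - p))).const_mul (p / 2)).add_const
      ((1 - p / 2) * ε ^ p)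
    rwa [one_div, e0] at this
  have h2 : ∀ t, 0 < t → HasDerivAt (fun t : ℝ => t ^ (p / 2)) (p / 2 * t ^ ((p - 2) / 2)) t :=
    fun t ht => by
      have := Real.hasDerivAt_rpow_const (x := t) (p := p / 2) (Or.inl ht.ne')
      rwa [show p / 2 - 1 = (p - 2) / 2 by ring] at this
  have hsq : 0 < ε ^ 2 := by positivity
  rcases lt_trichotomy t (ε ^ 2) with ht | ht | ht
  · rw [psiDeriv, if_pos ht]
    refine (h1 t).congr_of_eventuallyEq ?_
    filter_upwards [Iio_mem_nhds ht] with x hx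
    rw [psi, if_pos (mem_Iio.1 hx)]
  · have hv1 : (ε ^ 2) ^ (p / 2) = ε ^ p := by
      rw [← Real.rpow_natCast ε 2, ← Real.rpow_mul hε.le]
      congr 1
      push_cast
      ring
    have hv2 : (ε ^ 2) ^ ((p - 2) / 2) = ε ^ (p - 2) := by
      rw [← Real.rpow_natCast ε 2, ← Real.rpow_mul hε.le]
      congr 1
      push_cast
      ring
    have hv3 : p / 2 * (ε ^ 2 / ε ^ (2 - p)) + (1 - p / 2) * ε ^ p = ε ^ p := by
      have : ε ^ 2 / ε ^ (2 - p) = ε ^ p := by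
        rw [← Real.rpow_natCast ε 2, ← Real.rpow_sub hε]
        congr 1
        push_cast
        ring
      rw [this]
      ring
    subst ht
    rw [psiDeriv, if_neg (lt_irrefl _)]
    have hL : HasDerivWithinAt (psi p ε) (p / 2 * (ε ^ 2) ^ ((p - 2) / 2)) (Iic (ε ^ 2)) (ε ^ 2) := by
      rw [hv2]
      refine (h1 (ε ^ 2)).hasDerivWithinAt.congr (fun x hx => ?_) ?_
      · rcases lt_or_eq_of_le (mem_Iic.1 hx) with hx | hx
        · rw [psi, if_pos hx]
        · rw [psi, if_neg (by rw [hx]; exact lt_irrefl _), hx, hv1, hv3]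
      · rw [psi, if_neg (lt_irrefl _), hv1, hv3]
    have hR : HasDerivWithinAt (psi p ε) (p / 2 * (ε ^ 2) ^ ((p - 2) / 2)) (Ici (ε ^ 2)) (ε ^ 2) := by
      refine (h2 (ε ^ 2) hsq).hasDerivWithinAt.congr (fun x hx => ?_) ?_
      · rw [psi, if_neg (not_lt.2 (mem_Ici.1 hx))]
      · rw [psi, if_neg (lt_irrefl _)]
    have := hL.union hR
    rwa [Iic_union_Ici, hasDerivWithinAt_univ] at this
  · rw [psiDeriv, if_neg ht.not_gt]
    refine (h2 t (hsq.trans ht)).congr_of_eventuallyEq ?_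
    filter_upwards [Ioi_mem_nhds ht] with x hx
    rw [psi, if_neg (not_lt.2 (le_of_lt (mem_Ioi.1 hx)))]

/-- The admissible set `K`: `|u(t,x)| ≤ w(x)` for almost all `(t,x)`. -/
def admissible (T : ℝ) {d : ℕ} (Ω : Opens (Sp d)) (s : Ioo (0 : ℝ) 1) (k : Kind) :
    Set (USpace T Ω × WSpace Ω s k) :=
  {q | ∀ᵐ y ∂(volCyl T Ω), |q.1 y| ≤ toLTwo q.2 y.2}

/-- The objective function of the subproblem with current iterate `(u₀, w₀)`, smoothing parameter
`ε` and step parameter `Λ`. -/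
def subObjective {T : ℝ} {d : ℕ} {Ω : Opens (Sp d)} {s : Ioo (0 : ℝ) 1} {k : Kind}
    (f : USpace T Ω → ℝ) (α β γ p ε : ℝ) (u₀ : USpace T Ω) (w₀ : WSpace Ω s k) (Λ : ℝ)
    (q : USpace T Ω × WSpace Ω s k) : ℝ :=
  fderiv ℝ f u₀ (q.1 - u₀) + α / 2 * ‖q.1‖ ^ 2 + β / 2 * ‖q.2‖ ^ 2
    + γ * ∫ x, psiDeriv p ε (toLTwo w₀ x ^ 2) * (toLTwo q.2 x ^ 2 - toLTwo w₀ x ^ 2) ∂(volOn Ω)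
    + Λ / 2 * ‖q.1 - u₀‖ ^ 2

/-- `q` solves the subproblem: it minimizes the objective function over `K`. -/
def SolvesSub {T : ℝ} {d : ℕ} {Ω : Opens (Sp d)} {s : Ioo (0 : ℝ) 1} {k : Kind}
    (f : USpace T Ω → ℝ) (α β γ p ε : ℝ) (u₀ : USpace T Ω) (w₀ : WSpace Ω s k) (Λ : ℝ)
    (q : USpace T Ω × WSpace Ω s k) : Prop :=
  q ∈ admissible T Ω s k ∧
    ∀ r ∈ admissible T Ω s k,
      subObjective f α β γ p ε u₀ w₀ Λ q ≤ subObjective f α β γ p ε u₀ w₀ Λ r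

/-- The descent condition for the step from `u₀` to `v`. -/
def Descent {H : Type*} [NormedAddCommGroup H] [InnerProductSpace ℝ H] (f : H → ℝ) (u₀ : H)
    (Λ : ℝ) (v : H) : Prop :=
  f v ≤ f u₀ + fderiv ℝ f u₀ (v - u₀) + Λ * ‖v - u₀‖ ^ 2

/-- `(u_k, w_k, L_k)` is a sequence generated by the algorithm with parameters `b`, `L` and
`(ε_k)`, and an arbitrary starting point `(u_0, w_0)`: `L_k` is the smallest number of the form
`L * b^l` for which the solution of the subproblem satisfies the descent condition, and
`(u_{k+1}, w_{k+1})` is the solution of the subproblem for this `L_k`. -/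
structure IsGenerated {T : ℝ} {d : ℕ} {Ω : Opens (Sp d)} {s : Ioo (0 : ℝ) 1} {k : Kind}
    (f : USpace T Ω → ℝ) (α β γ p b L : ℝ) (ε : ℕ → ℝ)
    (u : ℕ → USpace T Ω) (w : ℕ → WSpace Ω s k) (Ls : ℕ → ℝ) : Prop where
  one_lt_b : 1 < b
  L_pos : 0 < L
  ε_pos : ∀ j, 0 < ε j
  ε_antitone : Antitone ε
  ε_tendsto : Tendsto ε atTop (𝓝 0)
  step_size : ∀ j, IsLeast {Λ : ℝ | (∃ l : ℕ, Λ = L * b ^ l) ∧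
    ∃ q, SolvesSub f α β γ p (ε j) (u j) (w j) Λ q ∧ Descent f (u j) Λ q.1} (Ls j)
  next_iterate : ∀ j, SolvesSub f α β γ p (ε j) (u j) (w j) (Ls j) (u (j + 1), w (j + 1))

/-! ### Subdifferentials -/

/-- The convex subdifferential at `a` of an extended real-valued function. -/
def subdifferential {H : Type*} [NormedAddCommGroup H] [InnerProductSpace ℝ H] (F : H → EReal)
    (a : H) : Set H :=
  {μ | F a ≠ ⊤ ∧ ∀ v, F a + ((inner ℝ μ (v - a) : ℝ) : EReal) ≤ F v}

/-- The cone `C` of the nonnegative functions in `U`. -/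
def nonnegCone (T : ℝ) {d : ℕ} (Ω : Opens (Sp d)) : Set (USpace T Ω) :=
  {v | ∀ᵐ y ∂(volCyl T Ω), 0 ≤ v y}

open Classical in
/-- The indicator function `I_C` in the sense of convex analysis. -/
def indicatorFun {H : Type*} (C : Set H) (v : H) : EReal :=
  if v ∈ C then 0 else ⊤

end FracSparse

end

open FracSparse

noncomputable section

namespace FracSparse

open scoped ENNReal

/-! ### Local compactness in measure -/

/-! Two estimates survive the passage to the limit, and the multipliers are then written down
explicitly, not obtained as limits of multipliers of the subproblems.

Along the iterates the energy `f(u) + α/2 ‖u‖² + β/2 ‖w‖² + γ ∫ ψ_ε(w²)` decreases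
(`IsGenerated.energy_step`): the subproblem is strongly convex, the descent condition controls `f`,
the function `ψ_ε` lies below its tangents, and it increases with `ε`. Hence the iterates are
bounded and successive differences tend to zero, so that `(u_{k+1}, w_{k+1})` has the same weak
limit as `(u_k, w_k)` along the subsequence. The numbers `L_k` are bounded because `f'` is Lipschitz
on bounded sets, so the proximal terms vanish in the limit.

The remaining ingredient is compactness of `W`, needed only in measure
(`tendstoInMeasure_of_weakTendsto`). A weakly convergent sequence has convergent averages over
balls, and a function differs little from its averages if its `L¹` oscillation at small scales is
small. For the Slobodeckij norms this smallness follows from the difference quotient. For the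
spectral space it follows by cutting off high frequencies and approximating the rest by test
functions with bounded gradient.

Almost everywhere convergence of a further subsequence gives `limit_properties`. Truncating `v` with
`|v| ≤ w̄` at level `w_{k+1}` yields a competitor with unchanged second component, so that `g =
∇f(ū) + α ū` satisfies `(g, v - ū) ≥ 0` for all such `v`. Testing the subproblem with zero and
applying Fatou's lemma bounds `γ p ∫ |w̄|^p` by `-(g, ū) - β ‖w̄‖²`.

Now put `μ¹ = -g⁻`, `μ² = -g⁺` and let the stationarity equation define `λ`. The inequality for `g`
gives `(g⁻, w̄ - ū) = 0 = (g⁺, w̄ + ū)`, which is the subdifferential condition. It also gives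
`(|g|, w̄) = -(g, ū)`, so `γ ⟨λ, w̄⟩ = -β ‖w̄‖² - (g, ū)`, which is exactly the upper bound supplied
by Fatou's lemma. -/

/-- Pairs of points at distance less than `r`. -/
def nearDiag (d : ℕ) (r : ℝ) : Set (Sp d × Sp d) := {q | dist q.2 q.1 < r}

lemma measurableSet_nearDiag (d : ℕ) (r : ℝ) : MeasurableSet (nearDiag d r) :=
  (isOpen_lt (continuous_snd.dist continuous_fst) continuous_const).measurableSet

/-- The `L¹` oscillation of `g` on `Ω` at scale `r`. -/
def oscAt {d : ℕ} (Ω : Opens (Sp d)) (r : ℝ) (g : Sp d → ℝ) : ℝ≥0∞ :=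
  ∫⁻ q in nearDiag d r, ‖g q.1 - g q.2‖ₑ ∂((volOn Ω).prod (volOn Ω))

lemma lintegral_nearDiag {d : ℕ} {μ ν : Measure (Sp d)} [SFinite μ] [SFinite ν] {r : ℝ}
    {F : Sp d × Sp d → ℝ≥0∞} (hF : Measurable F) :
    ∫⁻ q in nearDiag d r, F q ∂(μ.prod ν)
      = ∫⁻ x, ∫⁻ y in Metric.ball x r, F (x, y) ∂ν ∂μ := by
  rw [← lintegral_indicator (measurableSet_nearDiag d r),
    lintegral_prod _ ((hF.indicator (measurableSet_nearDiag d r)).aemeasurable)]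
  refine lintegral_congr fun x => ?_
  rw [← lintegral_indicator Metric.isOpen_ball.measurableSet]
  rfl

lemma lintegral_nearDiag_symm {d : ℕ} {μ ν : Measure (Sp d)} [SFinite μ] [SFinite ν] {r : ℝ}
    {F : Sp d × Sp d → ℝ≥0∞} (hF : Measurable F) :
    ∫⁻ q in nearDiag d r, F q ∂(μ.prod ν)
      = ∫⁻ y, ∫⁻ x in Metric.ball y r, F (x, y) ∂μ ∂ν := by
  rw [← lintegral_indicator (measurableSet_nearDiag d r),
    lintegral_prod_symm _ ((hF.indicator (measurableSet_nearDiag d r)).aemeasurable)]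
  refine lintegral_congr fun x => ?_
  rw [← lintegral_indicator Metric.isOpen_ball.measurableSet]
  refine lintegral_congr fun y => ?_
  simp only [indicator, nearDiag, mem_ofPred_eq, Metric.mem_ball, dist_comm]

lemma volOn_ball_le {d : ℕ} (Ω : Opens (Sp d)) (x : Sp d) (r : ℝ) :
    volOn Ω (Metric.ball x r) ≤ volume (Metric.ball (0 : Sp d) r) := by
  rw [← Measure.addHaar_ball_center volume x r]
  exact Measure.restrict_apply_le _ _

lemma measure_nearDiag_le {d : ℕ} (Ω : Opens (Sp d)) (r : ℝ) :
    ((volOn Ω).prod (volOn Ω)) (nearDiag d r)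
      ≤ volume (Metric.ball (0 : Sp d) r) * volume (Ω : Set (Sp d)) := by
  have h := lintegral_nearDiag (μ := volOn Ω) (ν := volOn Ω) (r := r)
    (F := fun _ => 1) measurable_const
  simp only [lintegral_const, Measure.restrict_apply MeasurableSet.univ, univ_inter, one_mul] at h
  rw [h]
  calc ∫⁻ x, volOn Ω (Metric.ball x r) ∂(volOn Ω)
      ≤ ∫⁻ _, volume (Metric.ball (0 : Sp d) r) ∂(volOn Ω) :=
        lintegral_mono fun x => volOn_ball_le Ω x r
    _ = _ := by simp

lemma oscAt_add_le {d : ℕ} (Ω : Opens (Sp d)) (r : ℝ) {g h : Sp d → ℝ} (hg : Measurable g)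
    : oscAt Ω r (g + h) ≤ oscAt Ω r g + oscAt Ω r h := by
  unfold oscAt
  rw [← lintegral_add_left (by fun_prop)]
  refine lintegral_mono fun q => ?_
  simp only [Pi.add_apply]
  rw [add_sub_add_comm]
  exact enorm_add_le _ _

/-- This crude bound handles remainders that are small in `L¹` but have no smoothness. The factor
`|B_r|` is the one divided out in `tendstoInMeasure_of_oscAt`. -/
lemma oscAt_le_norm {d : ℕ} (Ω : Opens (Sp d)) (r : ℝ) {g : Sp d → ℝ} (hg : Measurable g) :
    oscAt Ω r g ≤ volume (Metric.ball (0 : Sp d) r) * (2 * ∫⁻ x, ‖g x‖ₑ ∂(volOn Ω)) := by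
  have key : ∫⁻ x, ‖g x‖ₑ * volOn Ω (Metric.ball x r) ∂(volOn Ω)
      ≤ volume (Metric.ball (0 : Sp d) r) * ∫⁻ x, ‖g x‖ₑ ∂(volOn Ω) := by
    rw [← lintegral_const_mul _ (by fun_prop)]
    refine lintegral_mono fun x => ?_
    rw [mul_comm]
    exact mul_le_mul_left (volOn_ball_le Ω x r) _
  calc oscAt Ω r g
      ≤ ∫⁻ q in nearDiag d r, (‖g q.1‖ₑ + ‖g q.2‖ₑ) ∂((volOn Ω).prod (volOn Ω)) :=
        lintegral_mono fun q => enorm_sub_le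
    _ = (∫⁻ q in nearDiag d r, ‖g q.1‖ₑ ∂((volOn Ω).prod (volOn Ω)))
        + ∫⁻ q in nearDiag d r, ‖g q.2‖ₑ ∂((volOn Ω).prod (volOn Ω)) :=
        lintegral_add_left (by fun_prop) _
    _ = (∫⁻ x, ‖g x‖ₑ * volOn Ω (Metric.ball x r) ∂(volOn Ω))
        + ∫⁻ x, ‖g x‖ₑ * volOn Ω (Metric.ball x r) ∂(volOn Ω) := by
        rw [lintegral_nearDiag (by fun_prop), lintegral_nearDiag_symm (by fun_prop)]
        simp only [lintegral_const, Measure.restrict_apply MeasurableSet.univ, univ_inter]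
    _ ≤ _ := by
        rw [two_mul, mul_add]
        exact add_le_add key key

/-- Near the diagonal `|g(x) - g(y)|` is at most `r^(d/2+s)` times the difference quotient;
Cauchy–Schwarz then costs the square root of the measure of the strip. As `|B_r|` is of order `r^d`,
the bound is of order `r^s |B_r|`. -/
lemma oscAt_le_diffQuot {d : ℕ} (Ω : Opens (Sp d)) {s : ℝ} (hs : 0 < s) (r : ℝ) {g : Sp d → ℝ}
    (hg : Measurable g) :
    oscAt Ω r g ≤ ENNReal.ofReal (r ^ ((d : ℝ) / 2 + s)) *
      (eLpNorm (diffQuot s g) 2 ((volOn Ω).prod (volOn Ω)) *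
        (volume (Metric.ball (0 : Sp d) r) * volume (Ω : Set (Sp d))) ^ (1 / 2 : ℝ)) := by
  have hm : Measurable (diffQuot s g) := by
    unfold diffQuot
    fun_prop
  set P := (volOn Ω).prod (volOn Ω)
  have hpos : 0 < (d : ℝ) / 2 + s := by positivity
  have h1 : oscAt Ω r g ≤ ∫⁻ q in nearDiag d r,
      ENNReal.ofReal (r ^ ((d : ℝ) / 2 + s)) * ‖diffQuot s g q‖ₑ ∂P := by
    refine setLIntegral_mono (by fun_prop) fun q hq => ?_
    rw [← Real.enorm_of_nonneg (Real.rpow_nonneg (dist_nonneg.trans hq.le) _), ← enorm_mul]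
    refine enorm_le_iff_norm_le.2 ?_
    by_cases h0 : q.1 = q.2
    · simp [diffQuot, h0]
    · have hn : 0 < ‖q.1 - q.2‖ := norm_pos_iff.2 (sub_ne_zero.2 h0)
      have hlt : ‖q.1 - q.2‖ < r := by
        have : dist q.2 q.1 < r := hq
        rwa [dist_comm, dist_eq_norm] at this
      have hle := Real.rpow_le_rpow hn.le hlt.le hpos.le
      have hp := Real.rpow_pos_of_pos hn ((d : ℝ) / 2 + s)
      rw [norm_mul, diffQuot, norm_div, Real.norm_of_nonneg hp.le,
        Real.norm_of_nonneg (hp.le.trans hle), ← mul_div_assoc, le_div_iff₀ hp, mul_comm]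
      gcongr
  refine h1.trans ?_
  rw [lintegral_const_mul _ (by fun_prop)]
  gcongr
  rw [← eLpNorm_one_eq_lintegral_enorm]
  refine (eLpNorm_le_eLpNorm_mul_rpow_measure_univ (q := 2) (by norm_num)
    hm.aestronglyMeasurable).trans ?_
  norm_num
  gcongr
  · exact Measure.restrict_le_self
  · exact measure_nearDiag_le Ω r

/-- A sequence with vanishing averages and uniformly small oscillation tends to zero in measure. -/
lemma tendstoInMeasure_of_oscAt {d : ℕ} {Ω : Opens (Sp d)} (hb : Bornology.IsBounded (Ω : Set (Sp d)))
    {v : ℕ → Sp d → ℝ} (hv : ∀ n, StronglyMeasurable (v n)) (hi : ∀ n, Integrable (v n) (volOn Ω))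
    (havg : ∀ x r, Tendsto (fun n => ∫ y in Metric.ball x r, v n y ∂(volOn Ω)) atTop (𝓝 0))
    (hosc : ∀ η : ℝ≥0∞, 0 < η → ∃ r₀ : ℝ, 0 < r₀ ∧ ∀ r, 0 < r → r ≤ r₀ → ∀ n,
      oscAt Ω r (v n) ≤ η * volume (Metric.ball (0 : Sp d) r)) :
    TendstoInMeasure (volOn Ω) v atTop 0 := by
  have : IsFiniteMeasure (volOn Ω) := ⟨by
    simpa using hb.measure_lt_top⟩
  rw [tendstoInMeasure_iff_enorm]
  intro ε hε hεt
  rw [ENNReal.tendsto_nhds_zero]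
  intro δ hδ
  have hδ3 : 0 < δ / 3 := ENNReal.div_pos hδ.ne' (by norm_num)
  -- a compact part of `Ω` of almost full measure
  obtain ⟨F, hFc, hFs, hFu, hFm⟩ := Ω.isOpen.exists_iUnion_isClosed
  have hF0 : Tendsto (fun n => volOn Ω (F n)ᶜ) atTop (𝓝 0) := by
    have h := tendsto_measure_iInter_atTop (μ := volOn Ω) (s := fun n => (F n)ᶜ)
      (fun n => (hFc n).measurableSet.compl.nullMeasurableSet)
      (fun a b hab => compl_subset_compl.2 (hFm hab)) ⟨0, measure_ne_top _ _⟩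
    rw [← compl_iUnion, hFu, Measure.restrict_apply Ω.isOpen.measurableSet.compl,
      compl_inter_self, measure_empty] at h
    exact h
  obtain ⟨N, hN⟩ := ((ENNReal.tendsto_nhds_zero.1 hF0) _ hδ3).exists
  have hcomp : IsCompact (F N) := Metric.isCompact_of_isClosed_isBounded (hFc N) (hb.subset (hFs N))
  obtain ⟨ρ, hρ, hρs⟩ := hcomp.exists_thickening_subset_open Ω.isOpen (hFs N)
  -- This `η` makes Markov's inequality at level `V * ε / 2` return exactly `δ / 3`.
  have hη : 0 < ε / 2 * (δ / 3) := ENNReal.mul_pos (ENNReal.div_pos hε.ne' (by norm_num)).ne' hδ3.ne'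
  obtain ⟨r₀, hr₀, hr⟩ := hosc _ hη
  -- The bound by `ρ` keeps balls centred in the compact part `F N` inside `Ω`, so that they have
  -- full measure `V`.
  set r := min r₀ ρ with hrdef
  have hrpos : 0 < r := lt_min hr₀ hρ
  set V := volume (Metric.ball (0 : Sp d) r) with hV
  have hV0 : V ≠ 0 := (Metric.measure_ball_pos volume _ hrpos).ne'
  have hVt : V ≠ ⊤ := Metric.isBounded_ball.measure_lt_top.ne
  set c := V * (ε / 2) with hc
  have hc0 : c ≠ 0 := mul_ne_zero hV0 (ENNReal.div_pos hε.ne' (by norm_num)).ne'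
  have hct : c ≠ ⊤ := ENNReal.mul_ne_top hVt (ENNReal.div_ne_top hεt (by norm_num))
  let a : ℕ → Sp d → ℝ := fun n x => ∫ y in Metric.ball x r, v n y ∂(volOn Ω)
  have ham : ∀ n, StronglyMeasurable (a n) := by
    intro n
    have e : a n = fun x => ∫ y, (nearDiag d r).indicator (fun q => v n q.2) (x, y) ∂(volOn Ω) := by
      funext x
      simp only [a]
      rw [← integral_indicator Metric.isOpen_ball.measurableSet]
      rfl
    rw [e]
    refine StronglyMeasurable.integral_prod_right (f := fun x y =>
      (nearDiag d r).indicator (fun q => v n q.2) (x, y)) ?_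
    exact ((hv n).comp_measurable measurable_snd).indicator (measurableSet_nearDiag d r)
  have ha0 : Tendsto (fun n => volOn Ω {x | c ≤ ‖a n x‖ₑ}) atTop (𝓝 0) := by
    have := tendstoInMeasure_of_tendsto_ae (μ := volOn Ω) (f := a) (g := 0)
      (fun n => (ham n).aestronglyMeasurable) (Eventually.of_forall fun x => havg x r)
    have h2 := tendstoInMeasure_iff_enorm.1 this c (pos_iff_ne_zero.2 hc0) hct
    simpa using h2
  filter_upwards [(ENNReal.tendsto_nhds_zero.1 ha0) _ hδ3] with n hn
  let o : Sp d → ℝ≥0∞ := fun x => ∫⁻ y in Metric.ball x r, ‖v n x - v n y‖ₑ ∂(volOn Ω)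
  have hvm := (hv n).measurable
  have hom : Measurable o := by
    have e : o = fun x => ∫⁻ y, (nearDiag d r).indicator (fun q => ‖v n q.1 - v n q.2‖ₑ) (x, y)
        ∂(volOn Ω) := by
      funext x
      simp only [o]
      rw [← lintegral_indicator Metric.isOpen_ball.measurableSet]
      rfl
    rw [e]
    refine Measurable.lintegral_prod_right' (f := (nearDiag d r).indicator
      (fun q => ‖v n q.1 - v n q.2‖ₑ)) ?_
    exact Measurable.indicator (by fun_prop) (measurableSet_nearDiag d r)
  have ho : volOn Ω {x | c ≤ o x} ≤ δ / 3 := by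
    refine (meas_ge_le_lintegral_div hom.aemeasurable hc0 hct).trans ?_
    refine ENNReal.div_le_of_le_mul ?_
    have h1 : ∫⁻ x, o x ∂(volOn Ω) = oscAt Ω r (v n) :=
      (lintegral_nearDiag (F := fun q => ‖v n q.1 - v n q.2‖ₑ) (by fun_prop)).symm
    rw [h1]
    refine (hr r hrpos (min_le_left _ _) n).trans (le_of_eq ?_)
    rw [hc]
    ring
  -- At a point of `F N`, averaging `v(x) = (v(x) - v(y)) + v(y)` over the ball gives `V |v(x)| ≤
  -- o(x) + |a(x)|`. If `|v(x)| ≥ ε`, one of the two terms must reach `V * ε / 2`.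
  have hsub : {x | ε ≤ ‖v n x - (0 : Sp d → ℝ) x‖ₑ}
      ⊆ (F N)ᶜ ∪ ({x | c ≤ ‖a n x‖ₑ} ∪ {x | c ≤ o x}) := by
    intro x hx
    by_cases hxF : x ∈ F N
    swap
    · exact Or.inl hxF
    right
    by_contra hcon
    simp only [mem_union, mem_ofPred_eq, not_or, not_le] at hcon
    simp only [mem_ofPred_eq, Pi.zero_apply, sub_zero] at hx
    have hball : Metric.ball x r ⊆ (Ω : Set (Sp d)) := by
      refine Subset.trans ?_ hρs
      refine Subset.trans (Metric.ball_subset_ball (min_le_right _ _)) ?_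
      exact Metric.ball_subset_thickening hxF ρ
    have hVx : volOn Ω (Metric.ball x r) = V := by
      rw [Measure.restrict_apply Metric.isOpen_ball.measurableSet, inter_eq_left.2 hball,
        Measure.addHaar_ball_center]
    have hle : V * ‖v n x‖ₑ ≤ ‖a n x‖ₑ + o x := by
      have e1 : ∫ _ in Metric.ball x r, v n x ∂(volOn Ω)
          = (∫ y in Metric.ball x r, (v n x - v n y) ∂(volOn Ω)) + a n x := by
        simp only [a]
        rw [← integral_add]
        · simp
        · exact (integrable_const _).sub (hi n).restrict
        · exact (hi n).restrict
      have e2 : ‖∫ _ in Metric.ball x r, v n x ∂(volOn Ω)‖ₑ = V * ‖v n x‖ₑ := by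
        rw [setIntegral_const, enorm_smul, measureReal_def, hVx, Real.enorm_of_nonneg
          ENNReal.toReal_nonneg, ENNReal.ofReal_toReal hVt]
      rw [← e2, e1, add_comm ‖a n x‖ₑ]
      refine (enorm_add_le _ _).trans ?_
      gcongr
      exact enorm_integral_le_lintegral_enorm _
    have h2 : V * ε ≤ V * ‖v n x‖ₑ := by gcongr
    have h3 : ‖a n x‖ₑ + o x < c + c := ENNReal.add_lt_add hcon.1 hcon.2
    have h4 : c + c = V * ε := by
      rw [hc, ← mul_add, ENNReal.add_halves]
    rw [h4] at h3
    exact absurd (h2.trans hle) (not_le.2 h3)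
  calc volOn Ω {x | ε ≤ ‖v n x - (0 : Sp d → ℝ) x‖ₑ}
      ≤ volOn Ω ((F N)ᶜ ∪ ({x | c ≤ ‖a n x‖ₑ} ∪ {x | c ≤ o x})) := measure_mono hsub
    _ ≤ volOn Ω (F N)ᶜ + (volOn Ω {x | c ≤ ‖a n x‖ₑ} + volOn Ω {x | c ≤ o x}) :=
        (measure_union_le _ _).trans (add_le_add le_rfl (measure_union_le _ _))
    _ ≤ δ / 3 + (δ / 3 + δ / 3) := add_le_add hN (add_le_add hn ho)
    _ = δ := by rw [← add_assoc, ENNReal.add_thirds]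

/-! ### Translations of test functions and the Poincaré inequality -/

lemma norm_gradient {d : ℕ} (φ : Sp d → ℝ) (x : Sp d) : ‖gradient φ x‖ = ‖fderiv ℝ φ x‖ := by
  unfold gradient
  exact LinearIsometryEquiv.norm_map _ _

lemma enorm_gradient {d : ℕ} (φ : Sp d → ℝ) (x : Sp d) : ‖gradient φ x‖ₑ = ‖fderiv ℝ φ x‖ₑ := by
  rw [← ofReal_norm, ← ofReal_norm, norm_gradient]

lemma enorm_translate_sub_le {d : ℕ} {φ : Sp d → ℝ} (hφ : ContDiff ℝ 1 φ) (x h : Sp d) :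
    ‖φ (x + h) - φ x‖ₑ ≤ ‖h‖ₑ * ∫⁻ t in Ioc (0 : ℝ) 1, ‖fderiv ℝ φ (x + t • h)‖ₑ := by
  have hcont : Continuous (fderiv ℝ φ) := hφ.continuous_fderiv (by norm_num)
  have hc : Continuous fun t : ℝ => fderiv ℝ φ (x + t • h) h := by fun_prop
  have hd : ∀ t : ℝ, HasDerivAt (fun t : ℝ => φ (x + t • h)) (fderiv ℝ φ (x + t • h) h) t := by
    intro t
    have h1 : HasDerivAt (fun t : ℝ => x + t • h) h t := by
      simpa using ((hasDerivAt_id t).smul_const h).const_add x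
    exact ((hφ.differentiable (by norm_num)) (x + t • h)).hasFDerivAt.comp_hasDerivAt t h1
  have hint := intervalIntegral.integral_eq_sub_of_hasDerivAt (a := 0) (b := 1)
    (fun t _ => hd t) (hc.intervalIntegrable _ _)
  simp only [one_smul, zero_smul, add_zero] at hint
  rw [← hint, intervalIntegral.integral_of_le zero_le_one,
    ← lintegral_const_mul _ (by fun_prop)]
  refine (enorm_integral_le_lintegral_enorm _).trans (lintegral_mono fun t => ?_)
  rw [mul_comm]
  exact ContinuousLinearMap.le_opENorm _ _

/-- Integrate the derivative along the segment from `x` to `x + h`, exchange the integrals and use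
translation invariance. -/
lemma lintegral_translate_sub_le {d : ℕ} {φ : Sp d → ℝ} (hφ : ContDiff ℝ 1 φ) (h : Sp d) :
    ∫⁻ x, ‖φ (x + h) - φ x‖ₑ ≤ ‖h‖ₑ * ∫⁻ x, ‖fderiv ℝ φ x‖ₑ := by
  have hcont : Continuous (fderiv ℝ φ) := hφ.continuous_fderiv (by norm_num)
  have hm : Measurable fun q : Sp d × ℝ => ‖fderiv ℝ φ (q.1 + q.2 • h)‖ₑ :=
    Continuous.measurable (by fun_prop)
  calc ∫⁻ x, ‖φ (x + h) - φ x‖ₑ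
      ≤ ∫⁻ x, ‖h‖ₑ * ∫⁻ t in Ioc (0 : ℝ) 1, ‖fderiv ℝ φ (x + t • h)‖ₑ :=
        lintegral_mono fun x => enorm_translate_sub_le hφ x h
    _ = ‖h‖ₑ * ∫⁻ x, ∫⁻ t in Ioc (0 : ℝ) 1, ‖fderiv ℝ φ (x + t • h)‖ₑ :=
        lintegral_const_mul _ hm.lintegral_prod_right'
    _ = ‖h‖ₑ * ∫⁻ t in Ioc (0 : ℝ) 1, ∫⁻ x, ‖fderiv ℝ φ (x + t • h)‖ₑ := by
        rw [lintegral_lintegral_swap]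
        exact hm.aemeasurable
    _ = ‖h‖ₑ * ∫⁻ _ in Ioc (0 : ℝ) 1, ∫⁻ x, ‖fderiv ℝ φ x‖ₑ := by
        congr 1
        refine lintegral_congr fun t => ?_
        exact lintegral_add_right_eq_self (fun x => ‖fderiv ℝ φ x‖ₑ) (t • h)
    _ = _ := by simp

lemma IsTest.lintegral_fderiv {d : ℕ} {Ω : Opens (Sp d)} {φ : Sp d → ℝ} (hφ : IsTest Ω φ) :
    ∫⁻ x, ‖fderiv ℝ φ x‖ₑ = ∫⁻ x, ‖gradient φ x‖ₑ ∂(volOn Ω) := by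
  simp only [enorm_gradient]
  rw [setLIntegral_eq_of_support_subset]
  intro x hx
  refine hφ.support (support_fderiv_subset ℝ (f := φ) ?_)
  intro h0
  apply hx
  change ‖fderiv ℝ φ x‖ₑ = 0
  rw [h0, ← ofReal_norm, norm_zero, ENNReal.ofReal_zero]

lemma IsTest.contDiff_one {d : ℕ} {Ω : Opens (Sp d)} {φ : Sp d → ℝ} (hφ : IsTest Ω φ) :
    ContDiff ℝ 1 φ := hφ.smooth.of_le (by exact_mod_cast le_top)

/-- A test function lives on the whole space, so both integrals may be extended beyond `Ω`;
substituting `y = x + h` reduces the oscillation to translates with `|h| < r`. -/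
lemma oscAt_le_gradient {d : ℕ} {Ω : Opens (Sp d)} {φ : Sp d → ℝ} (hφ : IsTest Ω φ) (r : ℝ) :
    oscAt Ω r φ ≤ volume (Metric.ball (0 : Sp d) r) *
      (ENNReal.ofReal r * ∫⁻ x, ‖gradient φ x‖ₑ ∂(volOn Ω)) := by
  have hc : Continuous φ := hφ.smooth.continuous
  have hm : Measurable fun q : Sp d × Sp d => ‖φ q.1 - φ q.2‖ₑ :=
    Continuous.measurable (by fun_prop)
  have hm2 : Measurable fun q : Sp d × Sp d => ‖φ (q.1 + q.2) - φ q.1‖ₑ :=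
    Continuous.measurable (by fun_prop)
  unfold oscAt
  rw [lintegral_nearDiag hm]
  calc ∫⁻ x, ∫⁻ y in Metric.ball x r, ‖φ x - φ y‖ₑ ∂(volOn Ω) ∂(volOn Ω)
      ≤ ∫⁻ x, ∫⁻ y in Metric.ball x r, ‖φ x - φ y‖ₑ := by
        refine lintegral_mono' Measure.restrict_le_self fun x => ?_
        exact lintegral_mono' (Measure.restrict_mono_measure Measure.restrict_le_self _) le_rfl
    _ = ∫⁻ x, ∫⁻ h in Metric.ball (0 : Sp d) r, ‖φ (x + h) - φ x‖ₑ := by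
        refine lintegral_congr fun x => ?_
        rw [← lintegral_indicator Metric.isOpen_ball.measurableSet,
          ← lintegral_indicator Metric.isOpen_ball.measurableSet,
          ← lintegral_add_left_eq_self _ x]
        refine lintegral_congr fun h => ?_
        simp only [indicator, Metric.mem_ball, dist_self_add_left, dist_zero_right, enorm_sub_rev]
    _ = ∫⁻ h in Metric.ball (0 : Sp d) r, ∫⁻ x, ‖φ (x + h) - φ x‖ₑ := by
        rw [lintegral_lintegral_swap]
        exact hm2.aemeasurable
    _ ≤ ∫⁻ _ in Metric.ball (0 : Sp d) r,
          (ENNReal.ofReal r * ∫⁻ x, ‖gradient φ x‖ₑ ∂(volOn Ω)) := by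
        refine setLIntegral_mono measurable_const fun h hh => ?_
        refine (lintegral_translate_sub_le hφ.contDiff_one h).trans ?_
        rw [hφ.lintegral_fderiv, ← ofReal_norm]
        gcongr
        exact (mem_ball_zero_iff.1 hh).le
    _ = _ := by simp [mul_comm]

lemma lintegral_enorm_le_eLpNorm_two {X E : Type*} [MeasurableSpace X] [NormedAddCommGroup E]
    {μ : Measure X} {g : X → E} (hg : AEStronglyMeasurable g μ) :
    ∫⁻ x, ‖g x‖ₑ ∂μ ≤ eLpNorm g 2 μ * μ univ ^ (1 / 2 : ℝ) := by
  rw [← eLpNorm_one_eq_lintegral_enorm]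
  refine (eLpNorm_le_eLpNorm_mul_rpow_measure_univ (q := 2) (by norm_num) hg).trans ?_
  norm_num

lemma lintegral_enorm_sq {X E : Type*} [MeasurableSpace X] [NormedAddCommGroup E]
    {μ : Measure X} (g : X → E) : ∫⁻ x, ‖g x‖ₑ * ‖g x‖ₑ ∂μ = eLpNorm g 2 μ ^ 2 := by
  have := eLpNorm_nnreal_pow_eq_lintegral (f := g) (μ := μ) (p := 2) (by norm_num)
  simp only [NNReal.coe_ofNat, ENNReal.coe_ofNat] at this
  rw [← ENNReal.rpow_two, this]
  simp [pow_two]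

/-- If translation by `h` moves `Ω` off itself, then `φ²(x)` is the difference of `φ²` between `x`
and `x + h`. The translation estimate for `φ²` gives `‖φ‖² ≤ 2 |h| ‖φ‖ ‖∇φ‖`, and one factor `‖φ‖`
cancels. -/
lemma IsTest.poincare {d : ℕ} {Ω : Opens (Sp d)} {φ : Sp d → ℝ} (hφ : IsTest Ω φ) {h : Sp d}
    (hh : ∀ x ∈ Ω, x + h ∉ Ω) :
    eLpNorm φ 2 (volOn Ω) ≤ 2 * ‖h‖ₑ * eLpNorm (gradient φ) 2 (volOn Ω) := by
  have hzero : ∀ x, x ∉ Ω → φ x = 0 := fun x hx => by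
    by_contra h0
    exact hx (hφ.support (subset_tsupport _ h0))
  have hψ : IsTest Ω (φ * φ) := ⟨hφ.smooth.mul hφ.smooth, hφ.compact.mul_left,
    (tsupport_mul_subset_left).trans hφ.support⟩
  have hgc : Continuous (gradient φ) := by
    unfold gradient
    exact (LinearIsometryEquiv.continuous _).comp (hφ.contDiff_one.continuous_fderiv (by norm_num))
  have hgrad : ∀ x, ‖gradient (φ * φ) x‖ₑ = 2 * ‖(φ • gradient φ) x‖ₑ := by
    intro x
    have hd : DifferentiableAt ℝ φ x := (hφ.contDiff_one.differentiable (by norm_num)) x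
    rw [enorm_gradient, fderiv_mul hd hd, ← two_smul ℝ, enorm_smul, enorm_smul, Pi.smul_apply',
      enorm_smul, enorm_gradient, ← ofReal_norm (2 : ℝ), Real.norm_ofNat,
      ENNReal.ofReal_ofNat]
  have h1 : eLpNorm φ 2 (volOn Ω) ^ 2
      ≤ ‖h‖ₑ * (2 * (eLpNorm φ 2 (volOn Ω) * eLpNorm (gradient φ) 2 (volOn Ω))) := by
    calc eLpNorm φ 2 (volOn Ω) ^ 2 = ∫⁻ x, ‖φ x‖ₑ * ‖φ x‖ₑ ∂(volOn Ω) :=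
          (lintegral_enorm_sq φ).symm
      _ = ∫⁻ x, ‖(φ * φ) (x + h) - (φ * φ) x‖ₑ ∂(volOn Ω) := by
          refine setLIntegral_congr_fun Ω.isOpen.measurableSet fun x hx => ?_
          simp [hzero _ (hh x hx)]
      _ ≤ ∫⁻ x, ‖(φ * φ) (x + h) - (φ * φ) x‖ₑ :=
          lintegral_mono' Measure.restrict_le_self le_rfl
      _ ≤ ‖h‖ₑ * ∫⁻ x, ‖gradient (φ * φ) x‖ₑ ∂(volOn Ω) := by
          rw [← hψ.lintegral_fderiv]
          exact lintegral_translate_sub_le hψ.contDiff_one h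
      _ ≤ _ := by
          gcongr
          simp only [hgrad]
          rw [lintegral_const_mul' _ _ (by norm_num), ← eLpNorm_one_eq_lintegral_enorm]
          gcongr
          exact eLpNorm_smul_le_mul_eLpNorm hgc.aestronglyMeasurable
            hφ.smooth.continuous.aestronglyMeasurable
  have htop : eLpNorm φ 2 (volOn Ω) ≠ ⊤ :=
    ((hφ.smooth.continuous.memLp_of_hasCompactSupport hφ.compact).restrict _).2.ne
  rcases eq_or_ne (eLpNorm φ 2 (volOn Ω)) 0 with h0 | h0
  · simp [h0]
  · rw [pow_two] at h1
    refine (ENNReal.mul_le_mul_iff_right h0 htop).1 (h1.trans (le_of_eq ?_))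
    ring

lemma exists_translate_disjoint {d : ℕ} (hd : 0 < d) {Ω : Opens (Sp d)}
    (hb : Bornology.IsBounded (Ω : Set (Sp d))) : ∃ h : Sp d, ∀ x ∈ Ω, x + h ∉ Ω := by
  obtain ⟨R, hR⟩ := hb.subset_ball 0
  have : Nonempty (Fin d) := ⟨⟨0, hd⟩⟩
  obtain ⟨e, he⟩ := exists_norm_eq (Sp d) (c := 2 * |R|) (by positivity)
  refine ⟨e, fun x hx hxe => ?_⟩
  have h1 := mem_ball_zero_iff.1 (hR hx)
  have h2 := mem_ball_zero_iff.1 (hR hxe)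
  have h3 : ‖e‖ ≤ ‖x + e‖ + ‖x‖ := by
    have := norm_sub_le (x + e) x
    simpa using this
  have := le_abs_self R
  linarith

/-- The Poincaré inequality on `H_0^1(Ω)`. -/
lemma exists_poincare {d : ℕ} (hd : 0 < d) {Ω : Opens (Sp d)}
    (hb : Bornology.IsBounded (Ω : Set (Sp d))) :
    ∃ C : ℝ, 0 < C ∧ ∀ q ∈ hOneZeroGraph Ω, ‖q.1‖ ≤ C * ‖q.2‖ := by
  obtain ⟨h, hh⟩ := exists_translate_disjoint hd hb
  -- The summand 1 only serves to make the constant positive. The inequality is closed, so it passes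
  -- from test functions to their closure.
  refine ⟨2 * ‖h‖ + 1, by positivity, fun q hq => ?_⟩
  have hcl : IsClosed {q : LTwo Ω × Lp (Sp d) 2 (volOn Ω) | ‖q.1‖ ≤ (2 * ‖h‖ + 1) * ‖q.2‖} :=
    isClosed_le (by fun_prop) (by fun_prop)
  refine closure_minimal ?_ hcl hq
  rintro q ⟨φ, hφ, h1, h2⟩
  have hp := hφ.poincare hh
  have e2 : (2 : ℝ≥0∞) * ‖h‖ₑ = ENNReal.ofReal (2 * ‖h‖) := by
    rw [ENNReal.ofReal_mul (by norm_num), ofReal_norm]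
    simp
  rw [e2, ← eLpNorm_congr_ae h1, ← eLpNorm_congr_ae h2, ← Lp.enorm_def, ← Lp.enorm_def,
    ← ofReal_norm, ← ofReal_norm, ← ENNReal.ofReal_mul (by positivity),
    ENNReal.ofReal_le_ofReal_iff (by positivity)] at hp
  have := norm_nonneg q.2
  change ‖q.1‖ ≤ (2 * ‖h‖ + 1) * ‖q.2‖
  nlinarith

/-! ### Spectral decompositions -/

section Hilbert

variable {H : Type*} [NormedAddCommGroup H] [InnerProductSpace ℝ H] [CompleteSpace H] {ι : Type*}

lemma starProjection_closure_of_ortho {E F : Submodule ℝ H} (h : E ⟂ F) {w : H}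
    (hw : w ∈ F.topologicalClosure) : E.topologicalClosure.starProjection w = 0 := by
  rw [Submodule.starProjection_apply_eq_zero_iff, Submodule.orthogonal_closure]
  refine closure_minimal ?_ (Submodule.isClosed_orthogonal E) hw
  exact h.symm

/-- Parseval's identity for pairwise orthogonal subspaces. -/
lemma hasSum_norm_sq_starProjection {V : ι → Submodule ℝ H}
    (hV : Pairwise fun i j => V i ⟂ V j) {w : H} (hw : w ∈ (⨆ i, V i).topologicalClosure) :
    HasSum (fun i => ‖(V i).topologicalClosure.starProjection w‖ ^ 2) (‖w‖ ^ 2) := by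
  classical
  set V' : ι → Submodule ℝ H := fun i => (V i).topologicalClosure
  have hortho : Pairwise fun i j => V' i ⟂ V' j := fun i j hij => by
    change V' i ≤ (V' j)ᗮ
    rw [Submodule.orthogonal_closure]
    exact Submodule.topologicalClosure_minimal _ (hV hij) (Submodule.isClosed_orthogonal _)
  have hfam := OrthogonalFamily.of_pairwise (𝕜 := ℝ) (V := V') hortho
  have hcomp : ∀ i, CompleteSpace (V' i) := fun i =>
    (Submodule.isClosed_topologicalClosure (V i)).completeSpace_coe
  -- The range of the Hilbert sum isometry is the closure of the span, so `w` comes from a square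
  -- summable family, whose members turn out to be the projections.
  have hwr : w ∈ hfam.linearIsometry.range := by
    rw [hfam.range_linearIsometry]
    refine Submodule.topologicalClosure_mono ?_ hw
    refine iSup_mono fun i => ?_
    rw [Submodule.subtypeₗᵢ_toLinearMap, Submodule.range_subtype]
    exact Submodule.le_topologicalClosure _
  obtain ⟨f, hf⟩ := hwr
  have hf' : hfam.linearIsometry f = w := hf
  have hsum := hfam.hasSum_linearIsometry f
  rw [hf'] at hsum
  have hproj : ∀ i, (V' i).starProjection w = f i := by
    intro i
    have h1 := hsum.mapL (V' i).starProjection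
    have h2 : HasSum (fun j => (V' i).starProjection ((V' j).subtypeₗᵢ (f j))) (f i : H) := by
      convert hasSum_single i fun j hj => ?_ using 1
      · exact (Submodule.starProjection_eq_self_iff.2 (f i).2).symm
      · rw [Submodule.starProjection_apply_eq_zero_iff]
        exact hortho hj (f j).2
    exact h1.unique h2
  have hn := lp.hasSum_norm (p := 2) (by norm_num) f
  have hw2 : ‖f‖ = ‖w‖ := by
    rw [← hf']
    exact (hfam.linearIsometry.norm_map f).symm
  simp only [ENNReal.toReal_ofNat, Real.rpow_two] at hn
  rw [hw2] at hn
  refine hn.congr_fun ?_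
  intro i
  rw [hproj i]
  rfl

end Hilbert

/-! ### Dirichlet eigenspaces and frequency cut-off. -/

section Dirichlet

variable {d : ℕ} {Ω : Opens (Sp d)}

lemma exists_gradient_of_mem_eigenspace {l : ℝ} {w : LTwo Ω} (hw : w ∈ dirichletEigenspace Ω l) :
    ∃ g, (w, g) ∈ hOneZeroGraph Ω ∧
      ∀ q ∈ hOneZeroGraph Ω, inner ℝ g q.2 = l * inner ℝ w q.1 := by
  obtain ⟨g, hg, h⟩ := hw
  refine ⟨g, hg, fun q hq => ?_⟩
  have hcl : IsClosed {q : LTwo Ω × Lp (Sp d) 2 (volOn Ω) | inner ℝ g q.2 = l * inner ℝ w q.1} :=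
    isClosed_eq (by fun_prop) (by fun_prop)
  exact closure_minimal h hcl hq

/-- The pairing of the two gradients equals both `l (v, w)` and `m (v, w)`, since each weak equation
may be tested with the other eigenfunction. -/
lemma dirichletEigenspace_ortho {l m : ℝ} (hlm : l ≠ m) :
    dirichletEigenspace Ω l ⟂ dirichletEigenspace Ω m := by
  rw [Submodule.isOrtho_iff_inner_eq]
  intro v hv w hw
  obtain ⟨g, hg, h1⟩ := exists_gradient_of_mem_eigenspace hv
  obtain ⟨k, hk, h2⟩ := exists_gradient_of_mem_eigenspace hw
  have e1 := h1 _ hk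
  have e2 := h2 _ hg
  simp only at e1 e2
  rw [real_inner_comm, real_inner_comm v w] at e2
  rw [e2] at e1
  have : (m - l) * inner ℝ v w = 0 := by linarith
  rcases mul_eq_zero.1 this with h | h
  · exact absurd (by linarith : l = m) hlm
  · exact h

lemma norm_sq_gradient_eigenspace {l : ℝ} {w : LTwo Ω} (hw : w ∈ dirichletEigenspace Ω l) :
    ∃ g, (w, g) ∈ hOneZeroGraph Ω ∧ ‖g‖ ^ 2 = l * ‖w‖ ^ 2 := by
  obtain ⟨g, hg, h1⟩ := exists_gradient_of_mem_eigenspace hw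
  refine ⟨g, hg, ?_⟩
  rw [← real_inner_self_eq_norm_sq, ← real_inner_self_eq_norm_sq]
  exact h1 _ hg

/-- The Rayleigh quotient of an eigenfunction is its eigenvalue, so the Poincaré inequality bounds
the spectrum away from zero. -/
lemma one_le_of_mem_eigenspace {C : ℝ} (hC : ∀ q ∈ hOneZeroGraph Ω, ‖q.1‖ ≤ C * ‖q.2‖)
    {l : ℝ} {w : LTwo Ω} (hw : w ∈ dirichletEigenspace Ω l) (h0 : w ≠ 0) : 1 ≤ C ^ 2 * l := by
  obtain ⟨g, hg, h1⟩ := norm_sq_gradient_eigenspace hw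
  have h2 := hC _ hg
  have h3 : ‖w‖ ^ 2 ≤ C ^ 2 * l * ‖w‖ ^ 2 := by
    calc ‖w‖ ^ 2 ≤ (C * ‖g‖) ^ 2 := pow_le_pow_left₀ (norm_nonneg _) h2 2
      _ = C ^ 2 * l * ‖w‖ ^ 2 := by rw [mul_pow, h1]; ring
  have h4 : 0 < ‖w‖ ^ 2 := by positivity
  exact (le_mul_iff_one_le_left h4).1 h3

lemma eigenComp_eq_zero_of_small {C : ℝ} (hC : ∀ q ∈ hOneZeroGraph Ω, ‖q.1‖ ≤ C * ‖q.2‖)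
    {l : ℝ} (hl : C ^ 2 * l < 1) (w : LTwo Ω) : eigenComp l w = 0 := by
  have : dirichletEigenspace Ω l = ⊥ := by
    rw [Submodule.eq_bot_iff]
    intro v hv
    by_contra h0
    exact absurd (one_le_of_mem_eigenspace hC hv h0) (not_le.2 hl)
  unfold eigenComp
  rw [Submodule.starProjection_apply_eq_zero_iff, Submodule.orthogonal_closure, this]
  simp

lemma hasSum_norm_sq_eigenComp {w : LTwo Ω}
    (hw : w ∈ (⨆ l : Ioi (0 : ℝ), dirichletEigenspace Ω l).topologicalClosure) :
    HasSum (fun l : Ioi (0 : ℝ) => ‖eigenComp (l : ℝ) w‖ ^ 2) (‖w‖ ^ 2) :=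
  hasSum_norm_sq_starProjection (V := fun l : Ioi (0 : ℝ) => dirichletEigenspace Ω (l : ℝ))
    (fun _ _ hlm => dirichletEigenspace_ortho fun h => hlm (Subtype.ext h)) hw

/-- The spectral space embeds continuously into `L²(Ω)`. -/
lemma norm_sq_le_spectral {C : ℝ} (hC0 : 0 < C)
    (hC : ∀ q ∈ hOneZeroGraph Ω, ‖q.1‖ ≤ C * ‖q.2‖) {s : ℝ} (hs : 0 < s) {w : LTwo Ω}
    (hw : w ∈ spectralSpace Ω s) :
    ‖w‖ ^ 2 ≤ (C ^ 2) ^ s * ∑' l : Ioi (0 : ℝ), (l : ℝ) ^ s * ‖eigenComp (l : ℝ) w‖ ^ 2 := by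
  rw [← (hasSum_norm_sq_eigenComp hw.1).tsum_eq, ← tsum_mul_left]
  refine (hasSum_norm_sq_eigenComp hw.1).summable.tsum_le_tsum (fun l => ?_) (hw.2.mul_left _)
  -- Below `1 / C²` there is no spectrum and the term vanishes; above it the weight `(C² l)^s` is at
  -- least 1.
  rcases lt_or_ge (C ^ 2 * (l : ℝ)) 1 with h | h
  · simp [eigenComp_eq_zero_of_small hC h]
  · rw [← mul_assoc, ← Real.mul_rpow (by positivity) (le_of_lt l.2)]
    exact le_mul_of_one_le_left (by positivity) (Real.one_le_rpow h hs.le)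

/-- The span of the eigenfunctions with eigenvalue at most `Λ`. -/
def lowEnergy (Ω : Opens (Sp d)) (Λ : ℝ) : Submodule ℝ (LTwo Ω) :=
  ⨆ l : Ioc (0 : ℝ) Λ, dirichletEigenspace Ω l

/-- Such a `w` is a finite sum of eigenfunctions whose gradients are mutually orthogonal, so `‖∇w‖²`
is the sum of the `l ‖w_l‖²` with `l ≤ Λ`. -/
lemma exists_gradient_of_mem_lowEnergy {Λ : ℝ} {w : LTwo Ω} (hw : w ∈ lowEnergy Ω Λ) :
    ∃ g, (w, g) ∈ hOneZeroGraph Ω ∧ ‖g‖ ^ 2 ≤ Λ * ‖w‖ ^ 2 := by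
  obtain ⟨f, hf, rfl⟩ := (Submodule.mem_iSup_iff_exists_finsupp _ _).1 hw
  choose g hg h1 using fun i => exists_gradient_of_mem_eigenspace (hf i)
  refine ⟨∑ i ∈ f.support, g i, ?_, ?_⟩
  · have := (hOneZeroGraph Ω).sum_mem (t := f.support) (f := fun i => (f i, g i)) fun i _ => hg i
    convert this using 1
    exact Prod.ext (by simp [Prod.fst_sum, Finsupp.sum]) (by simp [Prod.snd_sum])
  · have hz : ∀ i j, i ≠ j → inner ℝ (f i) (f j) = (0 : ℝ) := fun i j hij =>
      Submodule.isOrtho_iff_inner_eq.1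
        (dirichletEigenspace_ortho (fun h => hij (Subtype.ext h))) _ (hf i) _ (hf j)
    rw [← real_inner_self_eq_norm_sq, ← real_inner_self_eq_norm_sq, Finsupp.sum]
    simp only [sum_inner, inner_sum]
    rw [Finset.mul_sum]
    refine Finset.sum_le_sum fun i hi => ?_
    have e1 : ∑ j ∈ f.support, inner ℝ (g j) (g i) = (i : ℝ) * inner ℝ (f i) (f i) := by
      rw [Finset.sum_eq_single_of_mem i hi]
      · exact h1 i _ (hg i)
      · intro j _ hj
        rw [h1 j _ (hg i), hz j i hj, mul_zero]
    have e2 : ∑ j ∈ f.support, inner ℝ (f j) (f i) = (inner ℝ (f i) (f i) : ℝ) := by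
      rw [Finset.sum_eq_single_of_mem i hi]
      intro j _ hj
      exact hz j i hj
    rw [e1, e2]
    exact mul_le_mul_of_nonneg_right i.2.2 real_inner_self_nonneg

/-- The projection removes the components with `l ≤ Λ` and leaves the others unchanged; on the
latter `Λ^s ≤ l^s`. -/
lemma norm_sq_sub_lowEnergy_le {Λ s M : ℝ} (hΛ : 0 < Λ) (hs : 0 < s) {v : LTwo Ω}
    (hv : v ∈ spectralSpace Ω s)
    (hM : ∑' l : Ioi (0 : ℝ), (l : ℝ) ^ s * ‖eigenComp (l : ℝ) v‖ ^ 2 ≤ M) :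
    Λ ^ s * ‖v - (lowEnergy Ω Λ).topologicalClosure.starProjection v‖ ^ 2 ≤ M := by
  set p := (lowEnergy Ω Λ).topologicalClosure.starProjection v
  have hp : p ∈ (lowEnergy Ω Λ).topologicalClosure := Submodule.starProjection_apply_mem _ _
  have hle : lowEnergy Ω Λ ≤ ⨆ l : Ioi (0 : ℝ), dirichletEigenspace Ω l :=
    iSup_le fun l => le_iSup (fun l : Ioi (0 : ℝ) => dirichletEigenspace Ω (l : ℝ)) ⟨l, l.2.1⟩
  have hmem : v - p ∈ (⨆ l : Ioi (0 : ℝ), dirichletEigenspace Ω l).topologicalClosure :=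
    Submodule.sub_mem _ hv.1 (Submodule.topologicalClosure_mono hle hp)
  have hps := hasSum_norm_sq_eigenComp hmem
  rw [← hps.tsum_eq, ← tsum_mul_left]
  refine le_trans ((hps.summable.mul_left _).tsum_le_tsum (fun l => ?_) hv.2) hM
  rcases le_or_gt (l : ℝ) Λ with h | h
  · have : eigenComp (l : ℝ) (v - p) = 0 := by
      unfold eigenComp
      rw [Submodule.starProjection_apply_eq_zero_iff, Submodule.orthogonal_closure]
      have h1 : v - p ∈ ((lowEnergy Ω Λ).topologicalClosure)ᗮ :=
        Submodule.sub_starProjection_mem_orthogonal _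
      refine Submodule.orthogonal_le ?_ h1
      refine le_trans ?_ (Submodule.le_topologicalClosure _)
      exact le_iSup (fun l : Ioc (0 : ℝ) Λ => dirichletEigenspace Ω (l : ℝ)) ⟨l, l.2, h⟩
    rw [this]
    have := Real.rpow_nonneg (le_of_lt l.2) s
    rw [norm_zero, zero_pow two_ne_zero, mul_zero]
    exact mul_nonneg this (sq_nonneg _)
  · have h0 : eigenComp (l : ℝ) p = 0 := by
      refine starProjection_closure_of_ortho ?_ hp
      refine Submodule.isOrtho_iSup_right.2 fun m => dirichletEigenspace_ortho ?_
      exact (lt_of_le_of_lt m.2.2 h).ne'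
    have : eigenComp (l : ℝ) (v - p) = eigenComp (l : ℝ) v := by
      have e : eigenComp (l : ℝ) (v - p) = eigenComp (l : ℝ) v - eigenComp (l : ℝ) p := by
        simp [eigenComp]
      rw [e, h0, sub_zero]
    rw [this]
    gcongr

/-- Elements of the spectral space are close to test functions with controlled gradient. -/
lemma exists_test_near_spectral {Λ s M δ : ℝ} (hΛ : 0 < Λ) (hs : 0 < s) (hδ : 0 < δ) {v : LTwo Ω}
    (hv : v ∈ spectralSpace Ω s)
    (hM : ∑' l : Ioi (0 : ℝ), (l : ℝ) ^ s * ‖eigenComp (l : ℝ) v‖ ^ 2 ≤ M) :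
    ∃ q ∈ testGraph Ω, ‖q.2‖ ≤ √Λ * (‖v‖ + δ) + δ ∧ ‖v - q.1‖ ≤ √(M / Λ ^ s) + 2 * δ := by
  have h1 := norm_sq_sub_lowEnergy_le hΛ hs hv hM
  set p := (lowEnergy Ω Λ).topologicalClosure.starProjection v
  have hp : p ∈ (lowEnergy Ω Λ).topologicalClosure := Submodule.starProjection_apply_mem _ _
  have hpn : ‖p‖ ≤ ‖v‖ := Submodule.norm_starProjection_apply_le _ v
  -- Two approximations, each with error `δ`: from the closure to the algebraic span, where a
  -- gradient is available, and from there to a test function in the graph norm.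
  obtain ⟨w, hw, hpw⟩ := Metric.mem_closure_iff.1 hp δ hδ
  obtain ⟨g, hg, hgn⟩ := exists_gradient_of_mem_lowEnergy hw
  obtain ⟨q, hq, hwq⟩ := Metric.mem_closure_iff.1 hg δ hδ
  rw [Prod.dist_eq, max_lt_iff, dist_eq_norm, dist_eq_norm] at hwq
  rw [dist_eq_norm] at hpw
  simp only at hwq
  have hΛs : 0 < Λ ^ s := Real.rpow_pos_of_pos hΛ s
  have h2 : ‖v - p‖ ≤ √(M / Λ ^ s) := by
    refine Real.le_sqrt_of_sq_le ?_
    rw [le_div_iff₀ hΛs, mul_comm]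
    exact h1
  have hwn : ‖w‖ ≤ ‖v‖ + δ := by
    have := norm_sub_norm_le w p
    rw [norm_sub_rev] at this
    linarith
  have hg2 : ‖g‖ ≤ √Λ * (‖v‖ + δ) := by
    calc ‖g‖ ≤ √(Λ * ‖w‖ ^ 2) := Real.le_sqrt_of_sq_le hgn
      _ = √Λ * ‖w‖ := by rw [Real.sqrt_mul hΛ.le, Real.sqrt_sq (norm_nonneg _)]
      _ ≤ _ := by gcongr
  refine ⟨q, hq, ?_, ?_⟩
  · have := norm_sub_norm_le q.2 g
    rw [norm_sub_rev] at this
    linarith [hwq.2]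
  · have e : v - q.1 = (v - p) + (p - w) + (w - q.1) := by abel
    rw [e]
    refine (norm_add₃_le).trans ?_
    linarith [hwq.1]

end Dirichlet

/-! ### Completeness of the fractional Sobolev spaces -/

lemma cConst_pos (d : ℕ) (s : Ioo (0 : ℝ) 1) : 0 < cConst d s := by
  have h0 := s.2.1
  have h1 := s.2.2
  have hG1 : 0 < Real.Gamma ((s : ℝ) + d / 2) := Real.Gamma_pos_of_pos (by positivity)
  have hG2 : 0 < Real.Gamma (1 - (s : ℝ)) := Real.Gamma_pos_of_pos (by linarith)
  unfold cConst
  positivity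

lemma integral_mul_self_eq {X : Type*} [MeasurableSpace X] {μ : Measure X} {g : X → ℝ}
    (hg : MemLp g 2 μ) : ∫ x, g x * g x ∂μ = (eLpNorm g 2 μ).toReal ^ 2 := by
  rw [← ENNReal.toReal_pow, ← lintegral_enorm_sq,
    integral_eq_lintegral_of_nonneg_ae (Eventually.of_forall fun x => mul_self_nonneg _)
      (hg.1.mul hg.1)]
  congr 1
  refine lintegral_congr fun x => ?_
  rw [← enorm_mul, Real.enorm_of_nonneg (mul_self_nonneg _)]

lemma hsInner_self {d : ℕ} {ν : Measure (Sp d)} {s : ℝ} {g : Sp d → ℝ} (hg : MemHs ν s g) :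
    hsInner ν s g g = (eLpNorm g 2 ν).toReal ^ 2
      + cConst d s / 2 * (eLpNorm (diffQuot s g) 2 (ν.prod ν)).toReal ^ 2 := by
  rw [hsInner_eq, integral_mul_self_eq hg.1, integral_mul_self_eq hg.2]

lemma aestronglyMeasurable_diffQuot {d : ℕ} {ν : Measure (Sp d)} [SFinite ν] (s : ℝ)
    {g : Sp d → ℝ} (hg : AEStronglyMeasurable g ν) :
    AEStronglyMeasurable (diffQuot s g) (ν.prod ν) := by
  unfold diffQuot
  refine AEStronglyMeasurable.div₀ (hg.comp_fst.sub hg.comp_snd) ?_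
  exact Measurable.aestronglyMeasurable (by fun_prop)

lemma diffQuot_sub {d : ℕ} (s : ℝ) (g h : Sp d → ℝ) :
    diffQuot s (g - h) = diffQuot s g - diffQuot s h := by
  funext q
  simp only [diffQuot, Pi.sub_apply]
  ring

/-- Completeness of `H^s` in terms of functions: an `L²` limit of a sequence that is Cauchy in the
seminorm is also a limit in the seminorm. -/
lemma memHs_of_cauchy {d : ℕ} {ν : Measure (Sp d)} [SFinite ν] {s : ℝ} {g : ℕ → Sp d → ℝ}
    {a : Sp d → ℝ} (hg : ∀ n, MemHs ν s (g n)) (ha : MemLp a 2 ν)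
    (hlim : Tendsto (fun n => eLpNorm (g n - a) 2 ν) atTop (𝓝 0))
    (hC : ∀ δ : ℝ≥0∞, 0 < δ → ∃ N, ∀ m ≥ N, ∀ n ≥ N,
      eLpNorm (diffQuot s (g m - g n)) 2 (ν.prod ν) ≤ δ) :
    MemHs ν s a ∧ TendstoHs ν s g a := by
  obtain ⟨φ, hφ, hae⟩ := (tendstoInMeasure_of_tendsto_eLpNorm (by norm_num)
    (fun n => (hg n).1.1) ha.1 hlim).exists_seq_tendsto_ae
  have key : ∀ δ : ℝ≥0∞, 0 < δ → ∃ N, ∀ m ≥ N,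
      eLpNorm (diffQuot s (g m - a)) 2 (ν.prod ν) ≤ δ := by
    intro δ hδ
    obtain ⟨N, hN⟩ := hC δ hδ
    refine ⟨N, fun m hm => ?_⟩
    have h1 : ∀ᵐ q ∂(ν.prod ν), Tendsto (fun j => diffQuot s (g m - g (φ j)) q) atTop
        (𝓝 (diffQuot s (g m - a) q)) := by
      filter_upwards [Measure.quasiMeasurePreserving_fst.ae hae,
        Measure.quasiMeasurePreserving_snd.ae hae] with q h1 h2
      simp only [diffQuot, Pi.sub_apply]
      exact ((tendsto_const_nhds.sub h1).sub (tendsto_const_nhds.sub h2)).div_const _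
    -- Fatou's lemma in the second index, along a subsequence whose difference quotients converge
    -- almost everywhere.
    refine (Lp.eLpNorm_lim_le_liminf_eLpNorm (fun j =>
      aestronglyMeasurable_diffQuot s ((hg m).1.1.sub (hg (φ j)).1.1)) _ h1).trans ?_
    refine liminf_le_of_frequently_le' (Eventually.frequently ?_)
    filter_upwards [eventually_ge_atTop N] with j hj
    exact hN m hm _ (hj.trans (hφ.id_le j))
  have hT : Tendsto (fun n => eLpNorm (diffQuot s (g n - a)) 2 (ν.prod ν)) atTop (𝓝 0) := by
    rw [ENNReal.tendsto_nhds_zero]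
    intro δ hδ
    obtain ⟨N, hN⟩ := key δ hδ
    filter_upwards [eventually_ge_atTop N] with n hn using hN n hn
  refine ⟨⟨ha, ?_⟩, hlim, hT⟩
  obtain ⟨N, hN⟩ := key 1 one_pos
  have h2 : MemLp (diffQuot s (g N - a)) 2 (ν.prod ν) :=
    ⟨aestronglyMeasurable_diffQuot s ((hg N).1.1.sub ha.1),
      (hN N le_rfl).trans_lt ENNReal.one_lt_top⟩
  have h3 := (hg N).2.sub h2
  rwa [diffQuot_sub, sub_sub_cancel] at h3

section WSpace

variable {d : ℕ} {Ω : Opens (Sp d)} {s : Ioo (0 : ℝ) 1} {k : Kind}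

lemma norm_sq_eq_fracInner (w : WSpace Ω s k) :
    ‖w‖ ^ 2 = fracInner (s : ℝ) k (toLTwo w) (toLTwo w) := by
  rw [← real_inner_self_eq_norm_sq]
  rfl

lemma toLTwo_mem (w : WSpace Ω s k) : toLTwo w ∈ fracSpace Ω (s : ℝ) k := w.2

/-- The measure with respect to which the Slobodeckij norm of a kind is taken. -/
def kindMeasure (Ω : Opens (Sp d)) : Kind → Measure (Sp d)
  | .tilde => volume
  | _ => volOn Ω

/-- The function whose Slobodeckij norm is taken. -/
def kindFun : Kind → LTwo Ω → Sp d → ℝ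
  | .tilde, w => zeroExt w
  | _, w => w

instance (k : Kind) : SFinite (kindMeasure Ω k) := by
  cases k <;> (unfold kindMeasure; infer_instance)

lemma eLpNorm_kindFun (k : Kind) (w : LTwo Ω) :
    eLpNorm (kindFun k w) 2 (kindMeasure Ω k) = ‖w‖ₑ := by
  rw [Lp.enorm_def]
  cases k
  · rfl
  · rfl
  · exact eLpNorm_indicator_eq_eLpNorm_restrict Ω.isOpen.measurableSet
  · rfl

lemma kindFun_sub (k : Kind) (v w : LTwo Ω) :
    kindFun k (v - w) =ᵐ[kindMeasure Ω k] kindFun k v - kindFun k w := by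
  cases k
  · exact Lp.coeFn_sub v w
  · exact Lp.coeFn_sub v w
  · refine (zeroExt_ae (Lp.coeFn_sub v w)).trans (Eventually.of_forall fun x => ?_)
    by_cases hx : x ∈ (Ω : Set (Sp d)) <;> simp [zeroExt, kindFun, hx]
  · exact Lp.coeFn_sub v w

lemma memLp_kindFun (k : Kind) (w : LTwo Ω) : MemLp (kindFun k w) 2 (kindMeasure Ω k) := by
  cases k
  · exact Lp.memLp w
  · exact Lp.memLp w
  · exact (memLp_indicator_iff_restrict Ω.isOpen.measurableSet).2 (Lp.memLp w)
  · exact Lp.memLp w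

lemma memHs_kindFun (hk : k ≠ Kind.spectral) {w : LTwo Ω} (hw : w ∈ fracSpace Ω (s : ℝ) k) :
    MemHs (kindMeasure Ω k) s (kindFun k w) := by
  cases k
  · exact hw
  · exact hw.1
  · exact hw
  · exact absurd rfl hk

lemma norm_sq_eq_kindFun (hk : k ≠ Kind.spectral) (w : WSpace Ω s k) :
    ‖w‖ ^ 2 = ‖toLTwo w‖ ^ 2 + cConst d s / 2 * (eLpNorm (diffQuot s (kindFun k (toLTwo w))) 2
      ((kindMeasure Ω k).prod (kindMeasure Ω k))).toReal ^ 2 := by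
  have h := hsInner_self (memHs_kindFun hk (toLTwo_mem w))
  rw [eLpNorm_kindFun, toReal_enorm] at h
  rw [norm_sq_eq_fracInner, ← h]
  cases k
  · rfl
  · rfl
  · rfl
  · exact absurd rfl hk

lemma diffQuot_le_norm (hk : k ≠ Kind.spectral) (w : WSpace Ω s k) :
    eLpNorm (diffQuot s (kindFun k (toLTwo w))) 2 ((kindMeasure Ω k).prod (kindMeasure Ω k))
      ≤ ENNReal.ofReal (√(2 / cConst d s) * ‖w‖) := by
  have h := norm_sq_eq_kindFun hk w
  have hc := cConst_pos d s
  set A := eLpNorm (diffQuot s (kindFun k (toLTwo w))) 2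
    ((kindMeasure Ω k).prod (kindMeasure Ω k)) with hA
  have hAt : A ≠ ⊤ := (memHs_kindFun hk (toLTwo_mem w)).2.2.ne
  rw [← ENNReal.ofReal_toReal hAt]
  refine ENNReal.ofReal_le_ofReal ?_
  rw [← Real.sqrt_sq (norm_nonneg w), ← Real.sqrt_mul (by positivity)]
  refine Real.le_sqrt_of_sq_le ?_
  rw [h]
  have e : 2 / cConst d s * (‖toLTwo w‖ ^ 2 + cConst d s / 2 * A.toReal ^ 2)
      = 2 / cConst d s * ‖toLTwo w‖ ^ 2 + A.toReal ^ 2 := by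
    field_simp
  rw [e]
  have : 0 ≤ 2 / cConst d s * ‖toLTwo w‖ ^ 2 := by positivity
  linarith

lemma norm_toLTwo_le_of_ne_spectral (hk : k ≠ Kind.spectral) (w : WSpace Ω s k) :
    ‖toLTwo w‖ ≤ ‖w‖ := by
  have h := norm_sq_eq_kindFun hk w
  have hc := cConst_pos d s
  refine (sq_le_sq₀ (norm_nonneg _) (norm_nonneg w)).1 ?_
  rw [h]
  exact le_add_of_nonneg_right (by positivity)

lemma norm_sq_eq_spectral (w : WSpace Ω s Kind.spectral) :
    ‖w‖ ^ 2 = ∑' l : Ioi (0 : ℝ), (l : ℝ) ^ (s : ℝ) * ‖eigenComp (l : ℝ) (toLTwo w)‖ ^ 2 := by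
  rw [norm_sq_eq_fracInner]
  simp only [fracInner, spectralInner, real_inner_self_eq_norm_sq]

/-- The embedding `W → L²(Ω)` is continuous. -/
lemma exists_norm_toLTwo_le (hd : 0 < d) (hb : Bornology.IsBounded (Ω : Set (Sp d)))
    (s : Ioo (0 : ℝ) 1) (k : Kind) :
    ∃ C : ℝ, 0 < C ∧ ∀ w : WSpace Ω s k, ‖toLTwo w‖ ≤ C * ‖w‖ := by
  by_cases hk : k = Kind.spectral
  · subst hk
    obtain ⟨C, hC0, hC⟩ := exists_poincare hd hb
    refine ⟨√((C ^ 2) ^ (s : ℝ)), by positivity, fun w => ?_⟩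
    rw [← Real.sqrt_sq (norm_nonneg w), ← Real.sqrt_mul (by positivity)]
    refine Real.le_sqrt_of_sq_le ?_
    rw [norm_sq_eq_spectral]
    exact norm_sq_le_spectral hC0 hC s.2.1 (toLTwo_mem w)
  · exact ⟨1, one_pos, fun w => by simpa using norm_toLTwo_le_of_ne_spectral hk w⟩

/-- Only `H_0^s` needs an argument: replacing each `w n` by a test function within `1/(n+1)` gives
test functions with the same limit. -/
lemma fracSpace_of_tendstoHs (hk : k ≠ Kind.spectral) {y : LTwo Ω} {w : ℕ → WSpace Ω s k}
    (hy : MemHs (kindMeasure Ω k) s (kindFun k y))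
    (hT : TendstoHs (kindMeasure Ω k) s (fun n => kindFun k (toLTwo (w n))) (kindFun k y)) :
    y ∈ fracSpace Ω (s : ℝ) k := by
  cases k
  · exact hy
  · refine ⟨hy, ?_⟩
    have hδ : ∀ n : ℕ, (0 : ℝ≥0∞) < ((n : ℝ≥0∞) + 1)⁻¹ := fun n => by simp
    have hex : ∀ n, ∃ φ : Sp d → ℝ, (IsTest Ω φ ∧ MemHs (volOn Ω) s φ) ∧
        eLpNorm (φ - (toLTwo (w n) : Sp d → ℝ)) 2 (volOn Ω) ≤ ((n : ℝ≥0∞) + 1)⁻¹ ∧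
        eLpNorm (diffQuot s (φ - (toLTwo (w n) : Sp d → ℝ))) 2 ((volOn Ω).prod (volOn Ω))
          ≤ ((n : ℝ≥0∞) + 1)⁻¹ := by
      intro n
      obtain ⟨-, φ, hφ, hφT⟩ := toLTwo_mem (w n)
      obtain ⟨j, h1, h2⟩ := ((ENNReal.tendsto_nhds_zero.1 hφT.1 _ (hδ n)).and
        (ENNReal.tendsto_nhds_zero.1 hφT.2 _ (hδ n))).exists
      exact ⟨φ j, hφ j, h1, h2⟩
    choose φ hφ h1 h2 using hex
    have hlim : Tendsto (fun n : ℕ => ((n : ℝ≥0∞) + 1)⁻¹) atTop (𝓝 0) := by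
      have := (tendsto_add_atTop_iff_nat 1).2 ENNReal.tendsto_inv_nat_nhds_zero
      simpa using this
    have hw : ∀ n, MemHs (volOn Ω) s (toLTwo (w n)) := fun n => (toLTwo_mem (w n)).1
    have hdec : ∀ n, φ n - y = (φ n - (toLTwo (w n) : Sp d → ℝ)) + ((toLTwo (w n) : Sp d → ℝ) - y) :=
      fun n => by abel
    refine ⟨φ, hφ, ?_, ?_⟩
    · have hs := hlim.add hT.1
      rw [add_zero] at hs
      refine tendsto_of_tendsto_of_tendsto_of_le_of_le tendsto_const_nhds hs
        (fun _ => zero_le) fun n => ?_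
      simp only [hdec n]
      refine (eLpNorm_add_le ((hφ n).2.sub (hw n)).1.1 ((hw n).sub hy).1.1 (by norm_num)).trans ?_
      exact add_le_add (h1 n) le_rfl
    · have hs := hlim.add hT.2
      rw [add_zero] at hs
      refine tendsto_of_tendsto_of_tendsto_of_le_of_le tendsto_const_nhds hs
        (fun _ => zero_le) fun n => ?_
      simp only [hdec n, diffQuot_add]
      refine (eLpNorm_add_le ((hφ n).2.sub (hw n)).2.1 ((hw n).sub hy).2.1 (by norm_num)).trans ?_
      exact add_le_add (h2 n) le_rfl
  · exact hy
  · exact absurd rfl hk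

/-- The squared norm is the sum of the squared `L²` norm and a multiple of the squared `L²` norm of
the difference quotient, so a Cauchy sequence is Cauchy in both. -/
lemma completeSpace_of_ne_spectral (hk : k ≠ Kind.spectral) : CompleteSpace (WSpace Ω s k) := by
  refine Metric.complete_of_cauchySeq_tendsto fun w hw => ?_
  have hc := cConst_pos d s
  have hL : CauchySeq fun n => toLTwo (w n) := by
    rw [Metric.cauchySeq_iff] at hw ⊢
    intro δ hδ
    obtain ⟨N, hN⟩ := hw δ hδ
    refine ⟨N, fun m hm n hn => ?_⟩
    refine lt_of_le_of_lt ?_ (hN m hm n hn)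
    rw [dist_eq_norm, dist_eq_norm, ← map_sub]
    exact norm_toLTwo_le_of_ne_spectral hk _
  obtain ⟨y, hy⟩ := cauchySeq_tendsto_of_complete hL
  have hlim : Tendsto (fun n => eLpNorm (kindFun k (toLTwo (w n)) - kindFun k y) 2
      (kindMeasure Ω k)) atTop (𝓝 0) := by
    have h1 := tendsto_iff_edist_tendsto_0.1 hy
    refine h1.congr fun n => ?_
    rw [edist_eq_enorm_sub, ← eLpNorm_kindFun k, eLpNorm_congr_ae (kindFun_sub k _ _)]
  have hC : ∀ δ : ℝ≥0∞, 0 < δ → ∃ N, ∀ m ≥ N, ∀ n ≥ N,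
      eLpNorm (diffQuot s (kindFun k (toLTwo (w m)) - kindFun k (toLTwo (w n)))) 2
        ((kindMeasure Ω k).prod (kindMeasure Ω k)) ≤ δ := by
    intro δ hδ
    rcases eq_or_ne δ ⊤ with rfl | hδt
    · exact ⟨0, fun _ _ _ _ => le_top⟩
    have hδ' : 0 < δ.toReal := ENNReal.toReal_pos hδ.ne' hδt
    have hq : 0 < √(2 / cConst d s) := Real.sqrt_pos.2 (by positivity)
    obtain ⟨N, hN⟩ := Metric.cauchySeq_iff.1 hw (δ.toReal / √(2 / cConst d s)) (by positivity)
    refine ⟨N, fun m hm n hn => ?_⟩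
    rw [← eLpNorm_congr_ae (diffQuot_congr s (kindFun_sub k _ _)), ← map_sub]
    refine (diffQuot_le_norm hk _).trans ?_
    rw [← ENNReal.ofReal_toReal hδt]
    refine ENNReal.ofReal_le_ofReal ?_
    have := hN m hm n hn
    rw [dist_eq_norm, lt_div_iff₀ hq, mul_comm] at this
    exact this.le
  obtain ⟨hyH, hyT⟩ := memHs_of_cauchy (fun n => memHs_kindFun hk (toLTwo_mem (w n)))
    (memLp_kindFun k y) hlim hC
  have hymem := fracSpace_of_tendstoHs hk hyH hyT
  let y' : WSpace Ω s k := ⟨y, hymem⟩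
  have hy' : toLTwo y' = y := rfl
  refine ⟨y', ?_⟩
  rw [tendsto_iff_norm_sub_tendsto_zero]
  have hsq : Tendsto (fun n => ‖w n - y'‖ ^ 2) atTop (𝓝 0) := by
    have e : ∀ n, ‖w n - y'‖ ^ 2 = (eLpNorm (kindFun k (toLTwo (w n)) - kindFun k y) 2
        (kindMeasure Ω k)).toReal ^ 2 + cConst d s / 2 *
        (eLpNorm (diffQuot s (kindFun k (toLTwo (w n)) - kindFun k y)) 2
        ((kindMeasure Ω k).prod (kindMeasure Ω k))).toReal ^ 2 := by
      intro n
      rw [norm_sq_eq_kindFun hk, map_sub, hy', eLpNorm_congr_ae (diffQuot_congr s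
        (kindFun_sub k _ _)), ← eLpNorm_congr_ae (kindFun_sub k _ _), eLpNorm_kindFun,
        toReal_enorm]
    simp only [e]
    have t1 := (ENNReal.tendsto_toReal ENNReal.zero_ne_top).comp hyT.1
    have t2 := (ENNReal.tendsto_toReal ENNReal.zero_ne_top).comp hyT.2
    have := (t1.pow 2).add ((t2.pow 2).const_mul (cConst d s / 2))
    simpa using this
  have := hsq.sqrt
  simpa [Real.sqrt_sq (norm_nonneg _)] using this

/-- Every finite partial sum of the norm is continuous in `L²`, so the Cauchy bound passes to the
limit in each of them and then to the whole series. -/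
lemma completeSpace_spectral (hd : 0 < d) (hb : Bornology.IsBounded (Ω : Set (Sp d))) :
    CompleteSpace (WSpace Ω s Kind.spectral) := by
  refine Metric.complete_of_cauchySeq_tendsto fun w hw => ?_
  obtain ⟨C, hC0, hC⟩ := exists_norm_toLTwo_le hd hb s Kind.spectral
  have hL : CauchySeq fun n => toLTwo (w n) := by
    rw [Metric.cauchySeq_iff] at hw ⊢
    intro δ hδ
    obtain ⟨N, hN⟩ := hw (δ / C) (by positivity)
    refine ⟨N, fun m hm n hn => ?_⟩
    have h1 := hN m hm n hn
    rw [dist_eq_norm, lt_div_iff₀ hC0, mul_comm] at h1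
    refine lt_of_le_of_lt ?_ h1
    rw [dist_eq_norm, ← map_sub]
    exact hC _
  obtain ⟨y, hy⟩ := cauchySeq_tendsto_of_complete hL
  have hpos : ∀ (l : Ioi (0 : ℝ)) (v : LTwo Ω),
      0 ≤ (l : ℝ) ^ (s : ℝ) * ‖eigenComp (l : ℝ) v‖ ^ 2 := fun l v =>
    mul_nonneg (Real.rpow_nonneg (le_of_lt l.2) _) (sq_nonneg _)
  have key : ∀ δ : ℝ, 0 < δ → ∃ N, ∀ m ≥ N, ∀ F : Finset (Ioi (0 : ℝ)),
      ∑ l ∈ F, (l : ℝ) ^ (s : ℝ) * ‖eigenComp (l : ℝ) (toLTwo (w m) - y)‖ ^ 2 ≤ δ ^ 2 := by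
    intro δ hδ
    obtain ⟨N, hN⟩ := Metric.cauchySeq_iff.1 hw δ hδ
    refine ⟨N, fun m hm F => ?_⟩
    have hlim : Tendsto (fun n => ∑ l ∈ F, (l : ℝ) ^ (s : ℝ) *
        ‖eigenComp (l : ℝ) (toLTwo (w m) - toLTwo (w n))‖ ^ 2) atTop
        (𝓝 (∑ l ∈ F, (l : ℝ) ^ (s : ℝ) * ‖eigenComp (l : ℝ) (toLTwo (w m) - y)‖ ^ 2)) := by
      refine tendsto_finsetSum _ fun l _ => ?_
      have hc : Continuous fun v : LTwo Ω => eigenComp (l : ℝ) v :=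
        ContinuousLinearMap.continuous _
      exact (((hc.tendsto _).comp (tendsto_const_nhds.sub hy)).norm.pow 2).const_mul _
    refine le_of_tendsto hlim ?_
    filter_upwards [eventually_ge_atTop N] with n hn
    have h1 := (hN m hm n hn).le
    rw [dist_eq_norm] at h1
    rw [← map_sub]
    refine le_trans ?_ (pow_le_pow_left₀ (norm_nonneg _) h1 2)
    rw [norm_sq_eq_spectral]
    exact (toLTwo_mem (w m - w n)).2.sum_le_tsum _ fun l _ => hpos l _
  have hmem : ∀ δ : ℝ, 0 < δ → ∃ N, ∀ m ≥ N, toLTwo (w m) - y ∈ spectralSpace Ω (s : ℝ) := by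
    intro δ hδ
    obtain ⟨N, hN⟩ := key δ hδ
    refine ⟨N, fun m hm => ⟨?_, summable_of_sum_le (fun l => hpos l _) (hN m hm)⟩⟩
    refine Submodule.sub_mem _ (toLTwo_mem (w m)).1 ?_
    exact (Submodule.isClosed_topologicalClosure _).mem_of_tendsto hy
      (Eventually.of_forall fun n => (toLTwo_mem (w n)).1)
  obtain ⟨N, hN⟩ := hmem 1 one_pos
  have hymem : y ∈ fracSpace Ω (s : ℝ) Kind.spectral := by
    have := Submodule.sub_mem _ (toLTwo_mem (w N)) (hN N le_rfl)
    rwa [sub_sub_cancel] at this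
  let y' : WSpace Ω s Kind.spectral := ⟨y, hymem⟩
  have hy' : toLTwo y' = y := rfl
  refine ⟨y', Metric.tendsto_atTop.2 fun δ hδ => ?_⟩
  obtain ⟨M, hM⟩ := key (δ / 2) (by positivity)
  refine ⟨M, fun m hm => ?_⟩
  have h1 : ‖w m - y'‖ ^ 2 ≤ (δ / 2) ^ 2 := by
    rw [norm_sq_eq_spectral, map_sub, hy']
    refine Real.tsum_le_of_sum_le (fun l => hpos l _) (hM m hm)
  have h2 := (sq_le_sq₀ (norm_nonneg _) (by positivity)).1 h1
  rw [dist_eq_norm]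
  linarith

/-- The fractional Sobolev spaces are Hilbert spaces. -/
lemma completeSpace_WSpace (hd : 0 < d) (hb : Bornology.IsBounded (Ω : Set (Sp d)))
    (s : Ioo (0 : ℝ) 1) (k : Kind) : CompleteSpace (WSpace Ω s k) := by
  by_cases hk : k = Kind.spectral
  · subst hk
    exact completeSpace_spectral hd hb
  · exact completeSpace_of_ne_spectral hk

end WSpace

/-! ### Compactness of bounded sequences in the fractional Sobolev spaces -/

section Compactness

variable {d : ℕ} {Ω : Opens (Sp d)} {s : Ioo (0 : ℝ) 1} {k : Kind}

/-- For `H̃^s` the double integral over the whole space dominates the one over `Ω × Ω`. This lets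
the three Slobodeckij norms be treated at once. -/
lemma eLpNorm_diffQuot_le_kindFun (s : ℝ) (k : Kind) (w : LTwo Ω) :
    eLpNorm (diffQuot s w) 2 ((volOn Ω).prod (volOn Ω))
      ≤ eLpNorm (diffQuot s (kindFun k w)) 2 ((kindMeasure Ω k).prod (kindMeasure Ω k)) := by
  have htilde : eLpNorm (diffQuot s w) 2 ((volOn Ω).prod (volOn Ω))
      ≤ eLpNorm (diffQuot s (zeroExt w)) 2 ((volume : Measure (Sp d)).prod volume) := by
    have e : diffQuot s w =ᵐ[(volOn Ω).prod (volOn Ω)] diffQuot s (zeroExt w) := by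
      refine diffQuot_congr s ?_
      filter_upwards [ae_restrict_mem Ω.isOpen.measurableSet] with x hx
      simp only [zeroExt, indicator_of_mem hx]
    rw [eLpNorm_congr_ae e, Measure.prod_restrict]
    exact eLpNorm_mono_measure _ Measure.restrict_le_self
  cases k
  · exact le_rfl
  · exact le_rfl
  · exact htilde
  · exact le_rfl

lemma exists_small_radius {s : ℝ} (hs : 0 < s) {B η : ℝ≥0∞} (hB : B ≠ ⊤) (hη : 0 < η) :
    ∃ r₀ : ℝ, 0 < r₀ ∧ ∀ r, 0 < r → r ≤ r₀ → ENNReal.ofReal (r ^ s) * B ≤ η := by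
  have h1 : Tendsto (fun r : ℝ => ENNReal.ofReal (r ^ s) * B) (𝓝 0) (𝓝 0) := by
    have h2 : Tendsto (fun r : ℝ => r ^ s) (𝓝 0) (𝓝 0) := by
      have := (Real.continuousAt_rpow_const 0 s (Or.inr hs.le)).tendsto
      rwa [Real.zero_rpow hs.ne'] at this
    have h3 := ENNReal.Tendsto.mul_const (ENNReal.tendsto_ofReal h2) (b := B) (Or.inr hB)
    simpa using h3
  obtain ⟨ρ, hρ, h⟩ := Metric.eventually_nhds_iff.1 (ENNReal.tendsto_nhds_zero.1 h1 η hη)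
  refine ⟨ρ / 2, by positivity, fun r hr hrρ => h ?_⟩
  rw [Real.dist_eq, sub_zero, abs_of_pos hr]
  linarith

lemma oscAt_small_of_ne_spectral (hd : 0 < d) (hb : Bornology.IsBounded (Ω : Set (Sp d)))
    (hk : k ≠ Kind.spectral) (R : ℝ) {η : ℝ≥0∞} (hη : 0 < η) :
    ∃ r₀ : ℝ, 0 < r₀ ∧ ∀ r, 0 < r → r ≤ r₀ → ∀ w : WSpace Ω s k, ‖w‖ ≤ R →
      oscAt Ω r (toLTwo w) ≤ η * volume (Metric.ball (0 : Sp d) r) := by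
  have : Nonempty (Fin d) := ⟨⟨0, hd⟩⟩
  have hΩ : volume (Ω : Set (Sp d)) ≠ ⊤ := hb.measure_lt_top.ne
  set V₁ := volume (Metric.ball (0 : Sp d) 1)
  have hV0 : V₁ ≠ 0 := (Metric.measure_ball_pos volume _ one_pos).ne'
  have hVt : V₁ ≠ ⊤ := Metric.isBounded_ball.measure_lt_top.ne
  set D := ENNReal.ofReal (√(2 / cConst d s) * R)
  -- Since `|B_r| = r^d V₁`, the bound `r^(d/2+s) D (|B_r| |Ω|)^(1/2)` equals `r^s B |B_r|` for this
  -- `B`.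
  set B : ℝ≥0∞ := (V₁ ^ (1 / 2 : ℝ))⁻¹ * (D * volume (Ω : Set (Sp d)) ^ (1 / 2 : ℝ)) with hBdef
  have hV12 : V₁ ^ (1 / 2 : ℝ) ≠ 0 := by simp [hV0, hVt]
  have hV12t : V₁ ^ (1 / 2 : ℝ) ≠ ⊤ := ENNReal.rpow_ne_top_of_nonneg (by norm_num) hVt
  have hB : B ≠ ⊤ := ENNReal.mul_ne_top (ENNReal.inv_ne_top.2 hV12)
    (ENNReal.mul_ne_top ENNReal.ofReal_ne_top (ENNReal.rpow_ne_top_of_nonneg (by norm_num) hΩ))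
  obtain ⟨r₀, hr₀, h⟩ := exists_small_radius s.2.1 hB hη
  refine ⟨r₀, hr₀, fun r hr hrr w hw => ?_⟩
  have hDw : eLpNorm (diffQuot s (toLTwo w)) 2 ((volOn Ω).prod (volOn Ω)) ≤ D := by
    refine (eLpNorm_diffQuot_le_kindFun s k _).trans ((diffQuot_le_norm hk w).trans ?_)
    exact ENNReal.ofReal_le_ofReal (mul_le_mul_of_nonneg_left hw (Real.sqrt_nonneg _))
  refine (oscAt_le_diffQuot Ω s.2.1 r (Lp.stronglyMeasurable _).measurable).trans ?_
  refine le_trans ?_ (mul_le_mul_left (h r hr hrr) _)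
  have hV : volume (Metric.ball (0 : Sp d) r) = ENNReal.ofReal (r ^ d) * V₁ := by
    rw [Measure.addHaar_ball _ _ hr.le, finrank_euclideanSpace_fin]
  have hsq : ENNReal.ofReal (r ^ d) ^ (1 / 2 : ℝ) = ENNReal.ofReal (r ^ ((d : ℝ) / 2)) := by
    rw [ENNReal.ofReal_rpow_of_pos (by positivity), ← Real.rpow_natCast, ← Real.rpow_mul hr.le]
    congr 2
    ring
  have hsq2 : ENNReal.ofReal (r ^ d)
      = ENNReal.ofReal (r ^ ((d : ℝ) / 2)) * ENNReal.ofReal (r ^ ((d : ℝ) / 2)) := by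
    rw [← ENNReal.ofReal_mul (by positivity), ← Real.rpow_add hr, ← Real.rpow_natCast]
    congr 2
    ring
  have hV1 : V₁ = V₁ ^ (1 / 2 : ℝ) * V₁ ^ (1 / 2 : ℝ) := by
    rw [← ENNReal.rpow_add _ _ hV0 hVt]
    norm_num
  rw [hV, ENNReal.mul_rpow_of_nonneg _ _ (by norm_num), ENNReal.mul_rpow_of_nonneg _ _ (by norm_num),
    hsq, Real.rpow_add hr, ENNReal.ofReal_mul (by positivity), hsq2, hBdef]
  set x := ENNReal.ofReal (r ^ ((d : ℝ) / 2))
  set y := ENNReal.ofReal (r ^ (s : ℝ))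
  set z := volume (Ω : Set (Sp d)) ^ (1 / 2 : ℝ)
  set V := V₁ ^ (1 / 2 : ℝ)
  calc x * y * (eLpNorm (diffQuot s (toLTwo w)) 2 ((volOn Ω).prod (volOn Ω)) * (x * V * z))
      ≤ x * y * (D * (x * V * z)) := by gcongr
    _ = y * ((V⁻¹ * V) * (D * z)) * (x * x * V) := by
        rw [ENNReal.inv_mul_cancel hV12 hV12t]
        ring
    _ = y * (V⁻¹ * (D * z)) * (x * x * V₁) := by
        rw [show x * x * V₁ = x * x * (V * V) from congrArg (x * x * ·) hV1]
        ring

/-- The function splits into a test function with gradient bounded in terms of `Λ` and a remainder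
small in `L²`; no comparison of the spectral norm with a Slobodeckij norm is needed. -/
lemma oscAt_small_spectral (hd : 0 < d) (hb : Bornology.IsBounded (Ω : Set (Sp d)))
    (R : ℝ) {η : ℝ≥0∞} (hη : 0 < η) :
    ∃ r₀ : ℝ, 0 < r₀ ∧ ∀ r, 0 < r → r ≤ r₀ → ∀ w : WSpace Ω s Kind.spectral, ‖w‖ ≤ R →
      oscAt Ω r (toLTwo w) ≤ η * volume (Metric.ball (0 : Sp d) r) := by
  have hs0 : (0 : ℝ) < s := s.2.1
  obtain ⟨C, hC0, hC⟩ := exists_norm_toLTwo_le hd hb s Kind.spectral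
  set m := volume (Ω : Set (Sp d)) ^ (1 / 2 : ℝ) with hm
  have hmt : m ≠ ⊤ := ENNReal.rpow_ne_top_of_nonneg (by norm_num) hb.measure_lt_top.ne
  have hη2 : 0 < η / 2 := ENNReal.div_pos hη.ne' (by norm_num)
  have hlim : Tendsto (fun Λ : ℝ => 2 * (ENNReal.ofReal (√(R ^ 2 / Λ ^ (s : ℝ)) + 2 * Λ⁻¹) * m))
      atTop (𝓝 0) := by
    have h1 : Tendsto (fun Λ : ℝ => √(R ^ 2 / Λ ^ (s : ℝ)) + 2 * Λ⁻¹) atTop (𝓝 0) := by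
      have h2 := ((tendsto_rpow_atTop hs0).const_div_atTop (R ^ 2)).sqrt
      have h3 := (tendsto_inv_atTop_zero (𝕜 := ℝ)).const_mul 2
      simpa using h2.add h3
    have h4 := ENNReal.Tendsto.mul_const (ENNReal.tendsto_ofReal h1) (b := m) (Or.inr hmt)
    have h5 := ENNReal.Tendsto.const_mul h4 (a := 2) (Or.inr (by norm_num))
    simpa using h5
  -- The cut-off `Λ` is fixed before the radius: it makes the remainder contribute at most `η / 2`,
  -- and `r₀` then does the same for the test function. The approximation error `δ` is `Λ⁻¹`.
  obtain ⟨Λ, hΛ, hΛ0⟩ := ((ENNReal.tendsto_nhds_zero.1 hlim _ hη2).and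
    (eventually_gt_atTop 0)).exists
  set G := ENNReal.ofReal (√Λ * (C * R + Λ⁻¹) + Λ⁻¹)
  obtain ⟨r₀, hr₀, h⟩ := exists_small_radius one_pos
    (ENNReal.mul_ne_top ENNReal.ofReal_ne_top hmt : G * m ≠ ⊤) hη2
  refine ⟨r₀, hr₀, fun r hr hrr w hw => ?_⟩
  have hR : 0 ≤ R := (norm_nonneg w).trans hw
  have hM : ∑' l : Ioi (0 : ℝ), (l : ℝ) ^ (s : ℝ) * ‖eigenComp (l : ℝ) (toLTwo w)‖ ^ 2 ≤ R ^ 2 := by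
    rw [← norm_sq_eq_spectral]
    exact pow_le_pow_left₀ (norm_nonneg _) hw 2
  obtain ⟨q, ⟨φ, hφ, h1, h2⟩, hg, hv⟩ := exists_test_near_spectral hΛ0 hs0 (inv_pos.2 hΛ0)
    (toLTwo_mem w) hM
  have hφm : Measurable φ := hφ.smooth.continuous.measurable
  have hwm : Measurable (toLTwo w : Sp d → ℝ) := (Lp.stronglyMeasurable _).measurable
  have hdec : (toLTwo w : Sp d → ℝ) = φ + ((toLTwo w : Sp d → ℝ) - φ) := by abel
  set V := volume (Metric.ball (0 : Sp d) r)
  have hgrad : ∫⁻ x, ‖gradient φ x‖ₑ ∂(volOn Ω) ≤ G * m := by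
    refine (lintegral_congr_ae (h2.fun_comp (fun y => ‖y‖ₑ))).symm.le.trans ?_
    refine (lintegral_enorm_le_eLpNorm_two (Lp.aestronglyMeasurable q.2)).trans ?_
    rw [← Lp.enorm_def, ← ofReal_norm, Measure.restrict_apply_univ]
    refine mul_le_mul_left (ENNReal.ofReal_le_ofReal (hg.trans ?_)) _
    have := (hC w).trans (mul_le_mul_of_nonneg_left hw hC0.le)
    gcongr
  have hrest : ∫⁻ x, ‖((toLTwo w : Sp d → ℝ) - φ) x‖ₑ ∂(volOn Ω)
      ≤ ENNReal.ofReal (√(R ^ 2 / Λ ^ (s : ℝ)) + 2 * Λ⁻¹) * m := by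
    have hae : (toLTwo w : Sp d → ℝ) - φ =ᵐ[volOn Ω] (toLTwo w - q.1 : LTwo Ω) :=
      ((EventuallyEq.refl _ _).sub h1.symm).trans (Lp.coeFn_sub _ _).symm
    refine (lintegral_congr_ae (hae.fun_comp (fun y => ‖y‖ₑ))).le.trans ?_
    refine (lintegral_enorm_le_eLpNorm_two (Lp.aestronglyMeasurable _)).trans ?_
    rw [← Lp.enorm_def, ← ofReal_norm, Measure.restrict_apply_univ]
    exact mul_le_mul_left (ENNReal.ofReal_le_ofReal hv) _
  have h' := h r hr hrr
  rw [Real.rpow_one] at h'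
  rw [hdec]
  calc oscAt Ω r (φ + ((toLTwo w : Sp d → ℝ) - φ))
      ≤ oscAt Ω r φ + oscAt Ω r ((toLTwo w : Sp d → ℝ) - φ) := oscAt_add_le Ω r hφm
    _ ≤ V * (ENNReal.ofReal r * (G * m))
        + V * (2 * (ENNReal.ofReal (√(R ^ 2 / Λ ^ (s : ℝ)) + 2 * Λ⁻¹) * m)) := by
        refine add_le_add ((oscAt_le_gradient hφ r).trans ?_)
          ((oscAt_le_norm Ω r (hwm.sub hφm)).trans ?_)
        · gcongr
        · gcongr
    _ ≤ V * (η / 2) + V * (η / 2) := by gcongr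
    _ = η * V := by
        rw [← mul_add, ENNReal.add_halves, mul_comm]

lemma oscAt_small (hd : 0 < d) (hb : Bornology.IsBounded (Ω : Set (Sp d)))
    (s : Ioo (0 : ℝ) 1) (k : Kind) (R : ℝ) {η : ℝ≥0∞} (hη : 0 < η) :
    ∃ r₀ : ℝ, 0 < r₀ ∧ ∀ r, 0 < r → r ≤ r₀ → ∀ w : WSpace Ω s k, ‖w‖ ≤ R →
      oscAt Ω r (toLTwo w) ≤ η * volume (Metric.ball (0 : Sp d) r) := by
  by_cases hk : k = Kind.spectral
  · subst hk
    exact oscAt_small_spectral hd hb R hη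
  · exact oscAt_small_of_ne_spectral hd hb hk R hη

/-- The embedding `W → L²(Ω)` as a continuous linear map. -/
lemma exists_toLTwoL (hd : 0 < d) (hb : Bornology.IsBounded (Ω : Set (Sp d)))
    (s : Ioo (0 : ℝ) 1) (k : Kind) :
    ∃ ι : WSpace Ω s k →L[ℝ] LTwo Ω, ∀ w, ι w = toLTwo w := by
  obtain ⟨C, -, hC⟩ := exists_norm_toLTwo_le hd hb s k
  exact ⟨toLTwo.mkContinuous C hC, fun _ => rfl⟩

/-- Bounded weakly convergent sequences in `W` converge in measure. -/
lemma tendstoInMeasure_of_weakTendsto (hd : 0 < d) (hb : Bornology.IsBounded (Ω : Set (Sp d)))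
    {w : ℕ → WSpace Ω s k} {a : WSpace Ω s k} (hw : WeakTendsto w a) {R : ℝ}
    (hR : ∀ n, ‖w n‖ ≤ R) :
    TendstoInMeasure (volOn Ω) (fun n => (toLTwo (w n) : Sp d → ℝ)) atTop (toLTwo a) := by
  have : IsFiniteMeasure (volOn Ω) := ⟨by simpa using hb.measure_lt_top⟩
  obtain ⟨ι, hι⟩ := exists_toLTwoL hd hb s k
  have h := tendstoInMeasure_of_oscAt hb (v := fun n => (toLTwo (w n - a) : Sp d → ℝ))
    (fun n => Lp.stronglyMeasurable _) (fun n => (Lp.memLp _).integrable (by norm_num)) ?_ ?_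
  · rw [tendstoInMeasure_iff_norm] at h ⊢
    intro ε hε
    refine (h ε hε).congr fun n => measure_congr ?_
    have e : (toLTwo (w n - a) : Sp d → ℝ) =ᵐ[volOn Ω]
        (toLTwo (w n) : Sp d → ℝ) - (toLTwo a : Sp d → ℝ) := by
      rw [map_sub]
      exact Lp.coeFn_sub _ _
    filter_upwards [e] with x hx
    change (ε ≤ ‖_ - (0 : ℝ)‖) = (ε ≤ ‖_‖)
    rw [hx, sub_zero, Pi.sub_apply]
  -- Integration over a ball is a continuous functional on `W`, so weak convergence controls the
  -- averages.
  · intro x r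
    have hs : MeasurableSet (Metric.ball x r) := Metric.isOpen_ball.measurableSet
    let l : WSpace Ω s k →L[ℝ] ℝ :=
      (innerSL ℝ (indicatorConstLp 2 hs (measure_ne_top (volOn Ω) _) (1 : ℝ))).comp ι
    have h1 : ∀ v : WSpace Ω s k, ∫ y in Metric.ball x r, toLTwo v y ∂(volOn Ω) = l v := by
      intro v
      rw [← L2.inner_indicatorConstLp_one (𝕜 := ℝ) hs (measure_ne_top (volOn Ω) _), ← hι]
      rfl
    refine Tendsto.congr (fun n => (h1 (w n - a)).symm) ?_
    simp only [map_sub]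
    have := (hw l).sub_const (l a)
    rwa [sub_self] at this
  · intro η hη
    obtain ⟨r₀, hr₀, hr⟩ := oscAt_small hd hb s k (R + ‖a‖) hη
    refine ⟨r₀, hr₀, fun r h0 h1 n => hr r h0 h1 _ ?_⟩
    exact (norm_sub_le _ _).trans (add_le_add_left (hR n) _)

end Compactness

/-! ### The smoothing -/

section Psi

variable {p ε : ℝ}

lemma sq_rpow_half (hε : 0 < ε) (a : ℝ) : (ε ^ 2) ^ (a / 2) = ε ^ a := by
  rw [← Real.rpow_natCast ε 2, ← Real.rpow_mul hε.le]
  congr 1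
  push_cast
  ring

lemma psiDeriv_nonneg (hp : 0 < p) (hε : 0 < ε) (t : ℝ) : 0 ≤ psiDeriv p ε t := by
  unfold psiDeriv
  split_ifs with h
  · positivity
  · have : 0 ≤ t := (by positivity : (0 : ℝ) ≤ ε ^ 2).trans (not_lt.1 h)
    positivity

lemma psiDeriv_antitone (hp : 0 < p) (hp1 : p < 1) (hε : 0 < ε) : Antitone (psiDeriv p ε) := by
  intro t t' htt
  have he : (p - 2) / 2 ≤ 0 := by linarith
  unfold psiDeriv
  split_ifs with h h' h'
  · exact le_rfl
  · exact absurd (lt_of_le_of_lt htt h) h'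
  · rw [← sq_rpow_half hε]
    exact mul_le_mul_of_nonneg_left
      (Real.rpow_le_rpow_of_nonpos (by positivity) (not_lt.1 h) he) (by positivity)
  · have : 0 < t := (by positivity : (0 : ℝ) < ε ^ 2).trans_le (not_lt.1 h')
    exact mul_le_mul_of_nonneg_left (Real.rpow_le_rpow_of_nonpos this htt he) (by positivity)

lemma psiDeriv_le (hp : 0 < p) (hp1 : p < 1) (hε : 0 < ε) (t : ℝ) :
    psiDeriv p ε t ≤ p / 2 * ε ^ (p - 2) := by
  rcases lt_or_ge t (ε ^ 2) with h | h
  · rw [psiDeriv, if_pos h]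
  · refine (psiDeriv_antitone hp hp1 hε h).trans ?_
    rw [psiDeriv, if_neg (lt_irrefl _), sq_rpow_half hε]

lemma measurable_psiDeriv (p ε : ℝ) : Measurable (psiDeriv p ε) := by
  unfold psiDeriv
  refine Measurable.ite measurableSet_Iio measurable_const ?_
  fun_prop

lemma continuous_psi (hε : 0 < ε) : Continuous (psi p ε) :=
  continuous_iff_continuousAt.2 fun t => (hasDerivAt_psi hε t).continuousAt

/-- Concavity of `ψ_ε`, in the form of the tangent inequality. -/
lemma psi_le_tangent (hp : 0 < p) (hp1 : p < 1) (hε : 0 < ε) (a t : ℝ) :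
    psi p ε t ≤ psi p ε a + psiDeriv p ε a * (t - a) := by
  have hd : deriv (psi p ε) = psiDeriv p ε := funext fun t => (hasDerivAt_psi hε t).deriv
  have hc : ConcaveOn ℝ univ (psi p ε) := Antitone.concaveOn_univ_of_deriv
    (fun t => (hasDerivAt_psi hε t).differentiableAt) (by
      rw [hd]
      exact psiDeriv_antitone hp hp1 hε)
  rcases lt_trichotomy t a with h | h | h
  · have := hc.le_slope_of_hasDerivAt (mem_univ t) (mem_univ a) h (hasDerivAt_psi hε a)
    rw [slope_def_field, le_div_iff₀ (sub_pos.2 h)] at this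
    linarith
  · simp [h]
  · have := hc.slope_le_of_hasDerivAt (mem_univ a) (mem_univ t) h (hasDerivAt_psi hε a)
    rw [slope_def_field, div_le_iff₀ (sub_pos.2 h)] at this
    linarith

lemma psi_nonneg (hp : 0 < p) (hp1 : p < 1) (hε : 0 < ε) {t : ℝ} (ht : 0 ≤ t) :
    0 ≤ psi p ε t := by
  have : 0 ≤ 1 - p / 2 := by linarith
  unfold psi
  split_ifs <;> positivity

/-- For `t < ε²` the function `ψ_ε` is the tangent of `t^(p/2)` at `ε²`. As `δ ≤ ε`, this is also
the tangent of the concave function `ψ_δ` there. -/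
lemma psi_mono_eps (hp : 0 < p) (hp1 : p < 1) {δ : ℝ} (hδ : 0 < δ) (hδε : δ ≤ ε) (t : ℝ) :
    psi p δ t ≤ psi p ε t := by
  have hε := hδ.trans_le hδε
  have hsq : δ ^ 2 ≤ ε ^ 2 := by gcongr
  rcases lt_or_ge t (ε ^ 2) with h | h
  · refine (psi_le_tangent hp hp1 hδ (ε ^ 2) t).trans (le_of_eq ?_)
    have e1 : psi p ε t = p / 2 * (t / ε ^ (2 - p)) + (1 - p / 2) * ε ^ p := if_pos h
    have e2 : psi p δ (ε ^ 2) = (ε ^ 2) ^ (p / 2) := if_neg (not_lt.2 hsq)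
    have e3 : psiDeriv p δ (ε ^ 2) = p / 2 * (ε ^ 2) ^ ((p - 2) / 2) := if_neg (not_lt.2 hsq)
    rw [e1, e2, e3, sq_rpow_half hε, sq_rpow_half hε]
    have h1 : t / ε ^ (2 - p) = t * ε ^ (p - 2) := by
      rw [div_eq_mul_inv, ← Real.rpow_neg hε.le, neg_sub]
    have h2 : ε ^ (p - 2) * ε ^ 2 = ε ^ p := by
      rw [← Real.rpow_natCast ε 2, ← Real.rpow_add hε]
      congr 1
      push_cast
      ring
    rw [h1, ← h2]
    ring
  · rw [psi, if_neg (not_lt.2 (hsq.trans h)), psi, if_neg (not_lt.2 h)]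

end Psi

/-! ### Quadratic functionals on a product of Hilbert spaces -/

section Quadratic

/-- A continuous function that is uniformly midpoint convex and bounded below on a closed convex
set attains its minimum. -/
lemma exists_isMinOn_of_midpoint {X : Type*} [NormedAddCommGroup X] [NormedSpace ℝ X]
    [CompleteSpace X] {K : Set X} (hne : K.Nonempty) (hcl : IsClosed K) (hconv : Convex ℝ K)
    {F : X → ℝ} (hF : Continuous F) (hbdd : BddBelow (F '' K)) {c : ℝ} (hc : 0 < c)
    (hmid : ∀ x y, F (midpoint ℝ x y) + c * ‖x - y‖ ^ 2 ≤ (F x + F y) / 2) :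
    ∃ x ∈ K, ∀ y ∈ K, F x ≤ F y := by
  set m := sInf (F '' K)
  have hm : ∀ y ∈ K, m ≤ F y := fun y hy => csInf_le hbdd (mem_image_of_mem F hy)
  have hex : ∀ n : ℕ, ∃ x ∈ K, F x < m + 1 / ((n : ℝ) + 1) := by
    intro n
    obtain ⟨_, ⟨x, hx, rfl⟩, h⟩ := exists_lt_of_csInf_lt (hne.image F)
      (lt_add_of_pos_right m (by positivity : (0 : ℝ) < 1 / ((n : ℝ) + 1)))
    exact ⟨x, hx, h⟩
  choose x hxK hx using hex
  have hcau : CauchySeq x := by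
    rw [Metric.cauchySeq_iff]
    intro δ hδ
    obtain ⟨N, hN⟩ := exists_nat_one_div_lt (by positivity : 0 < c * δ ^ 2)
    refine ⟨N, fun i hi j hj => ?_⟩
    have hmono : ∀ i ≥ N, F (x i) < m + c * δ ^ 2 := fun i hi => by
      have : 1 / ((i : ℝ) + 1) ≤ 1 / ((N : ℝ) + 1) := by gcongr
      linarith [hx i]
    have h1 := hmid (x i) (x j)
    have h2 := hm _ (hconv.midpoint_mem (hxK i) (hxK j))
    -- The midpoint lies in `K`, so its value is at least the infimum; a minimizing sequence is
    -- therefore Cauchy.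
    have h3 : c * ‖x i - x j‖ ^ 2 < c * δ ^ 2 := by linarith [hmono i hi, hmono j hj]
    rw [dist_eq_norm]
    exact (sq_lt_sq₀ (norm_nonneg _) hδ.le).1 (lt_of_mul_lt_mul_left h3 hc.le)
  obtain ⟨a, ha⟩ := cauchySeq_tendsto_of_complete hcau
  refine ⟨a, hcl.mem_of_tendsto ha (Eventually.of_forall hxK), fun y hy => ?_⟩
  refine le_trans ?_ (hm y hy)
  have hlim : Tendsto (fun n : ℕ => m + 1 / ((n : ℝ) + 1)) atTop (𝓝 (m + 0)) :=
    tendsto_const_nhds.add tendsto_one_div_add_atTop_nhds_zero_nat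
  rw [add_zero] at hlim
  exact le_of_tendsto_of_tendsto ((hF.tendsto a).comp ha) hlim
    (Eventually.of_forall fun n => (hx n).le)

variable {X Y : Type*} [NormedAddCommGroup X] [InnerProductSpace ℝ X]
  [NormedAddCommGroup Y] [InnerProductSpace ℝ Y]

/-- The quadratic functional of the subproblem. -/
def quadObj (ℓ : X →L[ℝ] ℝ) (B : Y →L[ℝ] Y →L[ℝ] ℝ) (α β γ Λ c : ℝ) (u₀ : X) (q : X × Y) : ℝ :=
  ℓ (q.1 - u₀) + α / 2 * ‖q.1‖ ^ 2 + β / 2 * ‖q.2‖ ^ 2 + γ * (B q.2 q.2 - c)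
    + Λ / 2 * ‖q.1 - u₀‖ ^ 2

/-- The derivative of `quadObj` at `q` in direction `e`. -/
def quadDeriv (ℓ : X →L[ℝ] ℝ) (B : Y →L[ℝ] Y →L[ℝ] ℝ) (α β γ Λ : ℝ) (u₀ : X) (q e : X × Y) : ℝ :=
  ℓ e.1 + α * inner ℝ q.1 e.1 + β * inner ℝ q.2 e.2 + 2 * γ * B q.2 e.2
    + Λ * inner ℝ (q.1 - u₀) e.1

/-- Half of the second derivative of `quadObj` in direction `e`. -/
def quadHess (B : Y →L[ℝ] Y →L[ℝ] ℝ) (α β γ Λ : ℝ) (e : X × Y) : ℝ :=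
  α / 2 * ‖e.1‖ ^ 2 + β / 2 * ‖e.2‖ ^ 2 + γ * B e.2 e.2 + Λ / 2 * ‖e.1‖ ^ 2

variable {ℓ : X →L[ℝ] ℝ} {B : Y →L[ℝ] Y →L[ℝ] ℝ} {α β γ Λ c : ℝ} {u₀ : X}

/-- The expansion is exact, with no higher order terms; optimality, growth at the minimizer and
midpoint convexity are all read off from it. -/
lemma quadObj_add_smul (hB : ∀ y z, B y z = B z y) (q e : X × Y) (t : ℝ) :
    quadObj ℓ B α β γ Λ c u₀ (q + t • e) = quadObj ℓ B α β γ Λ c u₀ q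
      + t * quadDeriv ℓ B α β γ Λ u₀ q e + t ^ 2 * quadHess B α β γ Λ e := by
  have e1 : (q + t • e).1 - u₀ = (q.1 - u₀) + t • e.1 := by
    simp only [Prod.fst_add, Prod.smul_fst]
    abel
  unfold quadObj quadDeriv quadHess
  rw [e1]
  simp only [Prod.fst_add, Prod.smul_fst, Prod.snd_add, Prod.smul_snd, norm_add_sq_real,
    inner_smul_right, norm_smul, mul_pow, Real.norm_eq_abs, sq_abs, map_add, map_smul,
    add_apply, smul_apply, smul_eq_mul, hB e.2 q.2]
  ring

/-- The variational inequality at a minimizer. -/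
lemma quadDeriv_nonneg_of_min (hB : ∀ y z, B y z = B z y) {K : Set (X × Y)} (hK : Convex ℝ K)
    {q : X × Y} (hq : q ∈ K)
    (hmin : ∀ r ∈ K, quadObj ℓ B α β γ Λ c u₀ q ≤ quadObj ℓ B α β γ Λ c u₀ r) {r : X × Y}
    (hr : r ∈ K) : 0 ≤ quadDeriv ℓ B α β γ Λ u₀ q (r - q) := by
  by_contra hneg
  push Not at hneg
  set D := quadDeriv ℓ B α β γ Λ u₀ q (r - q)
  set A := quadHess B α β γ Λ (r - q)
  have h : ∀ t : ℝ, 0 < t → t ≤ 1 → 0 ≤ D + t * A := by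
    intro t h0 h1
    have hmem : q + t • (r - q) ∈ K := hK.add_smul_sub_mem hq hr ⟨h0.le, h1⟩
    have h2 := hmin _ hmem
    rw [quadObj_add_smul hB] at h2
    have h3 : 0 ≤ t * (D + t * A) := by linarith
    exact nonneg_of_mul_nonneg_right h3 h0
  have hlim : Tendsto (fun t : ℝ => D + t * A) (𝓝[>] 0) (𝓝 (D + 0 * A)) := by
    refine tendsto_nhdsWithin_of_tendsto_nhds ?_
    exact Continuous.tendsto (by fun_prop) 0
  have h0 : 0 ≤ D + 0 * A := by
    refine ge_of_tendsto hlim ?_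
    filter_upwards [Ioc_mem_nhdsGT (zero_lt_one (α := ℝ))] with t ht using h t ht.1 ht.2
  linarith

/-- Quadratic growth at a minimizer. -/
lemma quadObj_add_quadHess_le (hB : ∀ y z, B y z = B z y) {K : Set (X × Y)} (hK : Convex ℝ K)
    {q : X × Y} (hq : q ∈ K)
    (hmin : ∀ r ∈ K, quadObj ℓ B α β γ Λ c u₀ q ≤ quadObj ℓ B α β γ Λ c u₀ r) {r : X × Y}
    (hr : r ∈ K) : quadObj ℓ B α β γ Λ c u₀ q + quadHess B α β γ Λ (r - q)
      ≤ quadObj ℓ B α β γ Λ c u₀ r := by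
  have h1 := quadObj_add_smul (ℓ := ℓ) (α := α) (β := β) (γ := γ) (Λ := Λ) (c := c) (u₀ := u₀)
    hB q (r - q) 1
  rw [one_smul, add_sub_cancel] at h1
  have h2 := quadDeriv_nonneg_of_min hB hK hq hmin hr
  linarith

lemma exists_quadObj_min [CompleteSpace X] [CompleteSpace Y] (hB : ∀ y z, B y z = B z y)
    (hB0 : ∀ y, 0 ≤ B y y) (hα : 0 < α) (hβ : 0 < β) (hγ : 0 ≤ γ) (hΛ : 0 < Λ)
    {K : Set (X × Y)} (hne : K.Nonempty) (hcl : IsClosed K) (hK : Convex ℝ K) :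
    ∃ q ∈ K, ∀ r ∈ K, quadObj ℓ B α β γ Λ c u₀ q ≤ quadObj ℓ B α β γ Λ c u₀ r := by
  have hcont : Continuous (quadObj ℓ B α β γ Λ c u₀) := by
    unfold quadObj
    fun_prop
  -- The points are `m ± e` with `e = (x - y)/2`, and the convexity gap is the Hessian term at `e`,
  -- at least `min α β / 2 * ‖e‖²`. The maximum norm of the product satisfies `‖e‖² ≤ ‖e.1‖² +
  -- ‖e.2‖²`.
  refine exists_isMinOn_of_midpoint hne hcl hK hcont ?_ (c := min α β / 8)
    (by have := lt_min hα hβ; positivity) ?_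
  · refine ⟨-(‖ℓ‖ ^ 2 / (2 * Λ)) - γ * c, ?_⟩
    rintro _ ⟨q, -, rfl⟩
    have h1 : -(‖ℓ‖ * ‖q.1 - u₀‖) ≤ ℓ (q.1 - u₀) := by
      have := ℓ.le_opNorm (q.1 - u₀)
      rw [Real.norm_eq_abs] at this
      linarith [neg_abs_le (ℓ (q.1 - u₀))]
    -- Completing the square lets the proximal term absorb the linear one.
    have h2 : ‖ℓ‖ * ‖q.1 - u₀‖ ≤ ‖ℓ‖ ^ 2 / (2 * Λ) + Λ / 2 * ‖q.1 - u₀‖ ^ 2 := by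
      have e : ‖ℓ‖ ^ 2 / (2 * Λ) + Λ / 2 * ‖q.1 - u₀‖ ^ 2 - ‖ℓ‖ * ‖q.1 - u₀‖
          = (‖ℓ‖ - Λ * ‖q.1 - u₀‖) ^ 2 / (2 * Λ) := by
        field_simp
        ring
      have : 0 ≤ (‖ℓ‖ - Λ * ‖q.1 - u₀‖) ^ 2 / (2 * Λ) := by positivity
      linarith
    have h3 := mul_nonneg hγ (hB0 q.2)
    have h4 : 0 ≤ α / 2 * ‖q.1‖ ^ 2 := by positivity
    have h5 : 0 ≤ β / 2 * ‖q.2‖ ^ 2 := by positivity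
    unfold quadObj
    linarith
  · intro x y
    set m := midpoint ℝ x y
    set e : X × Y := (2⁻¹ : ℝ) • (x - y)
    have hx : x = m + (1 : ℝ) • e := by
      simp only [m, e, midpoint_eq_smul_add, invOf_eq_inv]
      module
    have hy : y = m + (-1 : ℝ) • e := by
      simp only [m, e, midpoint_eq_smul_add, invOf_eq_inv]
      module
    have h1 := quadObj_add_smul (ℓ := ℓ) (α := α) (β := β) (γ := γ) (Λ := Λ) (c := c) (u₀ := u₀)
      hB m e 1
    have h2 := quadObj_add_smul (ℓ := ℓ) (α := α) (β := β) (γ := γ) (Λ := Λ) (c := c) (u₀ := u₀)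
      hB m e (-1)
    rw [← hx] at h1
    rw [← hy] at h2
    have h3 : min α β / 8 * ‖x - y‖ ^ 2 ≤ quadHess B α β γ Λ e := by
      have hn : ‖x - y‖ = 2 * ‖e‖ := by
        simp only [e, norm_smul]
        norm_num
        ring
      have hmax : ‖e‖ ^ 2 ≤ ‖e.1‖ ^ 2 + ‖e.2‖ ^ 2 := by
        rcases max_choice ‖e.1‖ ‖e.2‖ with h | h <;> rw [Prod.norm_def, h]
        · exact le_add_of_nonneg_right (sq_nonneg _)
        · exact le_add_of_nonneg_left (sq_nonneg _)
      have h4 := mul_nonneg hγ (hB0 e.2)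
      have h5 : 0 ≤ Λ / 2 * ‖e.1‖ ^ 2 := by positivity
      have h6 : min α β * ‖e.1‖ ^ 2 ≤ α * ‖e.1‖ ^ 2 := by
        gcongr
        exact min_le_left _ _
      have h7 : min α β * ‖e.2‖ ^ 2 ≤ β * ‖e.2‖ ^ 2 := by
        gcongr
        exact min_le_right _ _
      have h8 := mul_le_mul_of_nonneg_left hmax (lt_min hα hβ).le
      rw [hn]
      unfold quadHess
      nlinarith
    linarith

end Quadratic

/-! ### The admissible set and multiplication operators -/

section Lattice

variable {X : Type*} [MeasurableSpace X] {μ : Measure X}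

lemma inner_eq_integral (a b : Lp ℝ 2 μ) : inner ℝ a b = ∫ x, a x * b x ∂μ := by
  rw [L2.inner_def]
  refine integral_congr_ae (Eventually.of_forall fun x => ?_)
  simp [mul_comm]

lemma integrable_mul_Lp (a b : Lp ℝ 2 μ) : Integrable (fun x => a x * b x) μ :=
  (Lp.memLp a).integrable_mul (Lp.memLp b)

lemma inner_nonneg_of_nonneg {a b : Lp ℝ 2 μ} (ha : 0 ≤ a) (hb : 0 ≤ b) :
    (0 : ℝ) ≤ inner ℝ a b := by
  rw [inner_eq_integral]
  refine integral_nonneg_of_ae ?_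
  filter_upwards [(Lp.coeFn_nonneg a).2 ha, (Lp.coeFn_nonneg b).2 hb] with x h1 h2
  exact mul_nonneg h1 h2

/-- The cone of nonnegative functions is self-dual. -/
lemma nonneg_of_forall_inner_nonneg {a : Lp ℝ 2 μ}
    (h : ∀ v : Lp ℝ 2 μ, 0 ≤ v → (0 : ℝ) ≤ inner ℝ v a) : 0 ≤ a := by
  -- The test function `a⁻` gives `(a⁻, a) = -‖a⁻‖²`, which forces `a⁻ = 0`.
  have h1 := h a⁻ (negPart_nonneg a)
  have h2 : inner ℝ a⁻ a = -(‖a⁻‖ ^ 2 : ℝ) := by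
    rw [← real_inner_self_eq_norm_sq, inner_eq_integral, inner_eq_integral, ← integral_neg]
    refine integral_congr_ae ?_
    have e : a⁻ = (-a) ⊔ 0 := rfl
    filter_upwards [Lp.coeFn_sup (-a) 0, Lp.coeFn_neg a, Lp.coeFn_zero ℝ 2 μ] with x hx1 hx2 hx3
    rw [e, hx1, Pi.sup_apply, hx2, hx3, Pi.neg_apply, Pi.zero_apply]
    rcases le_total 0 (a x) with h0 | h0
    · rw [sup_eq_right.2 (by linarith)]
      ring
    · rw [sup_eq_left.2 (by linarith)]
      ring
  have h3 : ‖a⁻‖ ^ 2 ≤ 0 := by linarith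
  have h4 : a⁻ = 0 := norm_eq_zero.1 (pow_eq_zero_iff two_ne_zero |>.1 (le_antisymm h3 (sq_nonneg _)))
  exact negPart_eq_zero.1 h4

/-- Multiplication by a bounded function is a bounded operator on `L²`. -/
lemma exists_mulL {m : X → ℝ} (hm : Measurable m) {M : ℝ} (hM : ∀ x, |m x| ≤ M) :
    ∃ N : Lp ℝ 2 μ →L[ℝ] Lp ℝ 2 μ, ∀ v z, inner ℝ (N v) z = ∫ x, m x * (v x * z x) ∂μ := by
  have hmem : ∀ v : Lp ℝ 2 μ, MemLp (fun x => m x * v x) 2 μ := fun v => by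
    refine MemLp.of_le_mul (c := M) (Lp.memLp v)
      (hm.aestronglyMeasurable.mul (Lp.aestronglyMeasurable v)) (Eventually.of_forall fun x => ?_)
    rw [norm_mul]
    exact mul_le_mul_of_nonneg_right (hM x) (norm_nonneg _)
  let N₀ : Lp ℝ 2 μ →ₗ[ℝ] Lp ℝ 2 μ :=
    { toFun := fun v => (hmem v).toLp _
      map_add' := fun v w => by
        rw [← MemLp.toLp_add]
        refine MemLp.toLp_congr _ _ ?_
        filter_upwards [Lp.coeFn_add v w] with x hx
        rw [hx, Pi.add_apply, Pi.add_apply, mul_add]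
      map_smul' := fun c v => by
        rw [RingHom.id_apply, ← MemLp.toLp_const_smul]
        refine MemLp.toLp_congr _ _ ?_
        filter_upwards [Lp.coeFn_smul c v] with x hx
        rw [hx, Pi.smul_apply, Pi.smul_apply, smul_eq_mul, smul_eq_mul, mul_left_comm] }
  refine ⟨N₀.mkContinuous M fun v => ?_, fun v z => ?_⟩
  · refine Lp.norm_le_mul_norm_of_ae_le_mul ?_
    filter_upwards [(hmem v).coeFn_toLp] with x hx
    change ‖(hmem v).toLp _ x‖ ≤ _
    rw [hx, norm_mul]
    exact mul_le_mul_of_nonneg_right (hM x) (norm_nonneg _)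
  · rw [inner_eq_integral]
    refine integral_congr_ae ?_
    filter_upwards [(hmem v).coeFn_toLp] with x hx
    change (hmem v).toLp _ x * z x = _
    rw [hx, mul_assoc]

end Lattice

/-! ### The admissible set as a closed convex cone. -/

section Admissible

variable {T : ℝ} {d : ℕ} {Ω : Opens (Sp d)} {s : Ioo (0 : ℝ) 1} {k : Kind}

lemma coeFn_cylExt (T : ℝ) (w : LTwo Ω) : cylExt T w =ᵐ[volCyl T Ω] fun q => w q.2 :=
  MemLp.coeFn_toLp _

lemma ae_volCyl_snd (T : ℝ) {P : Sp d → Prop} (h : ∀ᵐ x ∂(volOn Ω), P x) :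
    ∀ᵐ y ∂(volCyl T Ω), P y.2 :=
  Measure.quasiMeasurePreserving_snd.ae h

/-- By Tonelli, the constant is the square root of the length of the time interval. -/
lemma norm_cylExt_le (T : ℝ) (w : LTwo Ω) :
    ‖cylExt T w‖ ≤ ((volume.restrict (Ioo 0 T) univ : ℝ≥0∞) ^ (1 / 2 : ℝ)).toReal * ‖w‖ := by
  have e : ‖cylExt T w‖ₑ ^ 2 = (volume.restrict (Ioo 0 T) univ : ℝ≥0∞) * ‖w‖ₑ ^ 2 := by
    rw [Lp.enorm_def, Lp.enorm_def, eLpNorm_congr_ae (coeFn_cylExt T w), ← lintegral_enorm_sq,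
      ← lintegral_enorm_sq, lintegral_prod]
    · simp [mul_comm]
    · have := (Lp.stronglyMeasurable w).measurable
      exact Measurable.aemeasurable (by fun_prop)
  have h2 : ‖cylExt T w‖ₑ = (volume.restrict (Ioo 0 T) univ : ℝ≥0∞) ^ (1 / 2 : ℝ) * ‖w‖ₑ := by
    have := congrArg (fun t : ℝ≥0∞ => t ^ (1 / 2 : ℝ)) e
    simp only [ENNReal.mul_rpow_of_nonneg _ _ (by norm_num : (0 : ℝ) ≤ 1 / 2),
      ← ENNReal.rpow_natCast, ← ENNReal.rpow_mul] at this
    norm_num at this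
    norm_num
    exact this
  rw [← toReal_enorm, h2, ENNReal.toReal_mul, toReal_enorm]

/-- The constant extension as a continuous linear map. -/
lemma exists_cylExtL (T : ℝ) (Ω : Opens (Sp d)) :
    ∃ E : LTwo Ω →L[ℝ] USpace T Ω, ∀ w, E w = cylExt T w := by
  let E₀ : LTwo Ω →ₗ[ℝ] USpace T Ω :=
    { toFun := cylExt T
      map_add' := fun v w => by
        refine Lp.ext ?_
        filter_upwards [coeFn_cylExt T (v + w), coeFn_cylExt T v, coeFn_cylExt T w,
          Lp.coeFn_add (cylExt T v) (cylExt T w), ae_volCyl_snd T (Lp.coeFn_add v w)]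
          with y h1 h2 h3 h4 h5
        rw [h1, h4, h5, Pi.add_apply, Pi.add_apply, h2, h3]
      map_smul' := fun c w => by
        refine Lp.ext ?_
        filter_upwards [coeFn_cylExt T (c • w), coeFn_cylExt T w,
          Lp.coeFn_smul c (cylExt T w), ae_volCyl_snd T (Lp.coeFn_smul c w)]
          with y h1 h2 h3 h4
        rw [h1, RingHom.id_apply, h3, h4, Pi.smul_apply, Pi.smul_apply, h2] }
  exact ⟨E₀.mkContinuous _ fun w => norm_cylExt_le T w, fun _ => rfl⟩

lemma mem_admissible_iff {q : USpace T Ω × WSpace Ω s k} :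
    q ∈ admissible T Ω s k ↔
      q.1 ≤ cylExt T (toLTwo q.2) ∧ -q.1 ≤ cylExt T (toLTwo q.2) := by
  rw [← Lp.coeFn_le, ← Lp.coeFn_le]
  constructor
  · intro h
    have h' : ∀ᵐ y ∂(volCyl T Ω), |q.1 y| ≤ toLTwo q.2 y.2 := h
    constructor
    · filter_upwards [h', coeFn_cylExt T (toLTwo q.2)] with y h1 h2
      rw [h2]
      exact (abs_le'.1 h1).1
    · filter_upwards [h', coeFn_cylExt T (toLTwo q.2), Lp.coeFn_neg q.1] with y h1 h2 h3
      rw [h2, h3]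
      exact (abs_le'.1 h1).2
  · rintro ⟨ha, hb⟩
    change ∀ᵐ y ∂(volCyl T Ω), |q.1 y| ≤ toLTwo q.2 y.2
    filter_upwards [ha, hb, coeFn_cylExt T (toLTwo q.2), Lp.coeFn_neg q.1] with y h1 h2 h3 h4
    rw [h3] at h1 h2
    rw [h4] at h2
    exact abs_le'.2 ⟨h1, h2⟩

lemma smul_add_smul_mem_admissible {q r : USpace T Ω × WSpace Ω s k}
    (hq : q ∈ admissible T Ω s k) (hr : r ∈ admissible T Ω s k) {a b : ℝ} (ha : 0 ≤ a)
    (hb : 0 ≤ b) : a • q + b • r ∈ admissible T Ω s k := by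
  have hq' : ∀ᵐ y ∂(volCyl T Ω), |q.1 y| ≤ toLTwo q.2 y.2 := hq
  have hr' : ∀ᵐ y ∂(volCyl T Ω), |r.1 y| ≤ toLTwo r.2 y.2 := hr
  change ∀ᵐ y ∂(volCyl T Ω), |(a • q.1 + b • r.1 : USpace T Ω) y|
    ≤ toLTwo (a • q.2 + b • r.2) y.2
  rw [map_add, map_smul, map_smul]
  filter_upwards [hq', hr', Lp.coeFn_add (a • q.1) (b • r.1), Lp.coeFn_smul a q.1,
    Lp.coeFn_smul b r.1, ae_volCyl_snd T (Lp.coeFn_add (a • toLTwo q.2) (b • toLTwo r.2)),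
    ae_volCyl_snd T (Lp.coeFn_smul a (toLTwo q.2)), ae_volCyl_snd T (Lp.coeFn_smul b (toLTwo r.2))]
    with y h1 h2 h3 h4 h5 h6 h7 h8
  rw [h3, h6, Pi.add_apply, Pi.add_apply, h4, h5, h7, h8]
  simp only [Pi.smul_apply, smul_eq_mul]
  refine (abs_add_le _ _).trans ?_
  rw [abs_mul, abs_mul, abs_of_nonneg ha, abs_of_nonneg hb]
  gcongr

lemma convex_admissible : Convex ℝ (admissible T Ω s k) :=
  fun _ hq _ hr _ _ ha hb _ => smul_add_smul_mem_admissible hq hr ha hb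

lemma zero_mem_admissible : (0 : USpace T Ω × WSpace Ω s k) ∈ admissible T Ω s k := by
  have h : ∀ᵐ y ∂(volCyl T Ω), |(0 : USpace T Ω) y| ≤ toLTwo (0 : WSpace Ω s k) y.2 := by
    rw [map_zero]
    filter_upwards [Lp.coeFn_zero ℝ 2 (volCyl T Ω),
      ae_volCyl_snd T (Lp.coeFn_zero ℝ 2 (volOn Ω))] with y h1 h2
    rw [h1, h2]
    simp
  exact h

lemma isClosed_admissible (hd : 0 < d) (hb : Bornology.IsBounded (Ω : Set (Sp d))) :
    IsClosed (admissible T Ω s k) := by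
  obtain ⟨ι, hι⟩ := exists_toLTwoL hd hb s k
  obtain ⟨E, hE⟩ := exists_cylExtL T Ω
  have e : admissible T Ω s k = {q | q.1 ≤ E (ι q.2)} ∩ {q | -q.1 ≤ E (ι q.2)} := by
    ext q
    change _ ↔ q.1 ≤ E (ι q.2) ∧ -q.1 ≤ E (ι q.2)
    rw [mem_admissible_iff, hE, hι]
  rw [e]
  exact (isClosed_le (by fun_prop) (by fun_prop)).inter (isClosed_le (by fun_prop) (by fun_prop))

end Admissible

/-! ### The iterates of the algorithm -/

section Subproblem

variable {T : ℝ} {d : ℕ} {Ω : Opens (Sp d)} {s : Ioo (0 : ℝ) 1} {k : Kind}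
  {f : USpace T Ω → ℝ} {α β γ p ε Λ : ℝ} {u₀ : USpace T Ω} {w₀ : WSpace Ω s k}

lemma abs_psiDeriv_le (hp : p ∈ Ioo (0 : ℝ) 1) (hε : 0 < ε) (t : ℝ) :
    |psiDeriv p ε t| ≤ p / 2 * ε ^ (p - 2) := by
  rw [abs_of_nonneg (psiDeriv_nonneg hp.1 hε t)]
  exact psiDeriv_le hp.1 hp.2 hε t

lemma measurable_weight (p ε : ℝ) (w : LTwo Ω) : Measurable fun x => psiDeriv p ε (w x ^ 2) :=
  (measurable_psiDeriv p ε).comp ((Lp.stronglyMeasurable w).measurable.pow_const 2)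

lemma integrable_weight (hp : p ∈ Ioo (0 : ℝ) 1) (hε : 0 < ε) (w y z : LTwo Ω) :
    Integrable (fun x => psiDeriv p ε (w x ^ 2) * (y x * z x)) (volOn Ω) :=
  (integrable_mul_Lp y z).bdd_mul (measurable_weight p ε w).aestronglyMeasurable
    (Eventually.of_forall fun _ => abs_psiDeriv_le hp hε _)

/-- The weighted `L²` form as a bounded bilinear form on `W`. -/
lemma exists_weightForm (hd : 0 < d) (hb : Bornology.IsBounded (Ω : Set (Sp d)))
    (hp : p ∈ Ioo (0 : ℝ) 1) (hε : 0 < ε) (w₀ : WSpace Ω s k) :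
    ∃ B : WSpace Ω s k →L[ℝ] WSpace Ω s k →L[ℝ] ℝ, ∀ y z, B y z
      = ∫ x, psiDeriv p ε (toLTwo w₀ x ^ 2) * (toLTwo y x * toLTwo z x) ∂(volOn Ω) := by
  obtain ⟨ι, hι⟩ := exists_toLTwoL hd hb s k
  obtain ⟨N, hN⟩ := exists_mulL (μ := volOn Ω) (measurable_weight p ε (toLTwo w₀))
    (fun _ => abs_psiDeriv_le hp hε _)
  let B₀ : WSpace Ω s k →ₗ[ℝ] WSpace Ω s k →ₗ[ℝ] ℝ :=
    LinearMap.mk₂ ℝ (fun y z => inner ℝ (N (ι y)) (ι z))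
      (fun y y' z => by rw [map_add, map_add, inner_add_left])
      (fun c y z => by rw [map_smul, map_smul, real_inner_smul_left, smul_eq_mul])
      (fun y z z' => by rw [map_add, inner_add_right])
      (fun c y z => by rw [map_smul, real_inner_smul_right, smul_eq_mul])
  refine ⟨B₀.mkContinuous₂ (‖N‖ * ‖ι‖ * ‖ι‖) fun y z => ?_, fun y z => ?_⟩
  · change ‖(inner ℝ (N (ι y)) (ι z) : ℝ)‖ ≤ _
    refine (norm_inner_le_norm _ _).trans ?_
    calc ‖N (ι y)‖ * ‖ι z‖ ≤ (‖N‖ * (‖ι‖ * ‖y‖)) * (‖ι‖ * ‖z‖) := by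
          gcongr
          · refine (N.le_opNorm _).trans ?_
            gcongr
            exact ι.le_opNorm y
          · exact ι.le_opNorm z
      _ = _ := by ring
  · change (inner ℝ (N (ι y)) (ι z) : ℝ) = _
    rw [hN, hι, hι]

/-- The weight is frozen at `w₀`, so the smoothed term is quadratic in the unknown, with the
constant `B w₀ w₀` subtracted. -/
lemma subObjective_eq_quadObj (hp : p ∈ Ioo (0 : ℝ) 1) (hε : 0 < ε)
    {B : WSpace Ω s k →L[ℝ] WSpace Ω s k →L[ℝ] ℝ} (hB : ∀ y z, B y z
      = ∫ x, psiDeriv p ε (toLTwo w₀ x ^ 2) * (toLTwo y x * toLTwo z x) ∂(volOn Ω))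
    (q : USpace T Ω × WSpace Ω s k) :
    subObjective f α β γ p ε u₀ w₀ Λ q
      = quadObj (fderiv ℝ f u₀) B α β γ Λ (B w₀ w₀) u₀ q := by
  unfold subObjective quadObj
  congr 3
  rw [hB, hB, ← integral_sub (integrable_weight hp hε _ _ _) (integrable_weight hp hε _ _ _)]
  refine integral_congr_ae (Eventually.of_forall fun x => ?_)
  simp only
  ring

lemma weightForm_symm {B : WSpace Ω s k →L[ℝ] WSpace Ω s k →L[ℝ] ℝ} (hB : ∀ y z, B y z
      = ∫ x, psiDeriv p ε (toLTwo w₀ x ^ 2) * (toLTwo y x * toLTwo z x) ∂(volOn Ω))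
    (y z : WSpace Ω s k) : B y z = B z y := by
  simp only [hB, mul_comm (toLTwo y _)]

lemma weight_integral_nonneg (hp : 0 < p) (hε : 0 < ε) (w y : LTwo Ω) :
    0 ≤ ∫ x, psiDeriv p ε (w x ^ 2) * (y x * y x) ∂(volOn Ω) :=
  integral_nonneg fun _ => mul_nonneg (psiDeriv_nonneg hp hε _) (mul_self_nonneg _)

/-- The variational inequality for the solution of the subproblem. -/
lemma SolvesSub.variational (hd : 0 < d) (hb : Bornology.IsBounded (Ω : Set (Sp d)))
    (hp : p ∈ Ioo (0 : ℝ) 1) (hε : 0 < ε) {q r : USpace T Ω × WSpace Ω s k}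
    (hq : SolvesSub f α β γ p ε u₀ w₀ Λ q) (hr : r ∈ admissible T Ω s k) :
    0 ≤ fderiv ℝ f u₀ (r.1 - q.1) + α * inner ℝ q.1 (r.1 - q.1) + β * inner ℝ q.2 (r.2 - q.2)
      + 2 * γ * (∫ x, psiDeriv p ε (toLTwo w₀ x ^ 2) *
          (toLTwo q.2 x * toLTwo (r.2 - q.2) x) ∂(volOn Ω))
      + Λ * inner ℝ (q.1 - u₀) (r.1 - q.1) := by
  obtain ⟨B, hB⟩ := exists_weightForm hd hb hp hε w₀
  rw [← hB]
  refine quadDeriv_nonneg_of_min (ℓ := fderiv ℝ f u₀) (c := B w₀ w₀) (weightForm_symm hB)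
    convex_admissible hq.1 (fun r hr => ?_) hr
  rw [← subObjective_eq_quadObj hp hε hB, ← subObjective_eq_quadObj hp hε hB]
  exact hq.2 r hr

/-- Used twice: compared with the previous iterate it produces the energy decrease, and compared
with another solution it gives uniqueness. -/
lemma SolvesSub.growth (hd : 0 < d) (hb : Bornology.IsBounded (Ω : Set (Sp d)))
    (hp : p ∈ Ioo (0 : ℝ) 1) (hε : 0 < ε) (hγ : 0 ≤ γ) {q r : USpace T Ω × WSpace Ω s k}
    (hq : SolvesSub f α β γ p ε u₀ w₀ Λ q) (hr : r ∈ admissible T Ω s k) :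
    subObjective f α β γ p ε u₀ w₀ Λ q + (α / 2 * ‖r.1 - q.1‖ ^ 2 + β / 2 * ‖r.2 - q.2‖ ^ 2
      + Λ / 2 * ‖r.1 - q.1‖ ^ 2) ≤ subObjective f α β γ p ε u₀ w₀ Λ r := by
  obtain ⟨B, hB⟩ := exists_weightForm hd hb hp hε w₀
  have h := quadObj_add_quadHess_le (ℓ := fderiv ℝ f u₀) (α := α) (β := β) (γ := γ) (Λ := Λ)
    (u₀ := u₀) (c := B w₀ w₀) (weightForm_symm hB)
    convex_admissible hq.1 (fun r hr => ?_) hr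
  · rw [← subObjective_eq_quadObj hp hε hB, ← subObjective_eq_quadObj hp hε hB] at h
    have h1 : 0 ≤ γ * B (r.2 - q.2) (r.2 - q.2) := by
      rw [hB]
      exact mul_nonneg hγ (weight_integral_nonneg hp.1 hε _ _)
    unfold quadHess at h
    simp only [Prod.fst_sub, Prod.snd_sub] at h
    linarith
  · rw [← subObjective_eq_quadObj hp hε hB, ← subObjective_eq_quadObj hp hε hB]
    exact hq.2 r hr

lemma exists_solvesSub (hd : 0 < d) (hb : Bornology.IsBounded (Ω : Set (Sp d)))
    (hp : p ∈ Ioo (0 : ℝ) 1) (hε : 0 < ε) (hα : 0 < α) (hβ : 0 < β) (hγ : 0 ≤ γ) (hΛ : 0 < Λ)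
    (f : USpace T Ω → ℝ) (u₀ : USpace T Ω) (w₀ : WSpace Ω s k) :
    ∃ q, SolvesSub f α β γ p ε u₀ w₀ Λ q := by
  have := completeSpace_WSpace hd hb s k
  obtain ⟨B, hB⟩ := exists_weightForm hd hb hp hε w₀
  obtain ⟨q, hq, hmin⟩ := exists_quadObj_min (ℓ := fderiv ℝ f u₀) (u₀ := u₀) (c := B w₀ w₀)
    (weightForm_symm hB) (fun y => by rw [hB]; exact weight_integral_nonneg hp.1 hε _ _)
    hα hβ hγ hΛ ⟨0, zero_mem_admissible⟩ (isClosed_admissible (T := T) hd hb) convex_admissible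
  refine ⟨q, hq, fun r hr => ?_⟩
  rw [subObjective_eq_quadObj hp hε hB, subObjective_eq_quadObj hp hε hB]
  exact hmin r hr

lemma SolvesSub.test_zero (hd : 0 < d) (hb : Bornology.IsBounded (Ω : Set (Sp d)))
    (hp : p ∈ Ioo (0 : ℝ) 1) (hε : 0 < ε) {q : USpace T Ω × WSpace Ω s k}
    (hq : SolvesSub f α β γ p ε u₀ w₀ Λ q) :
    fderiv ℝ f u₀ q.1 + α * ‖q.1‖ ^ 2 + β * ‖q.2‖ ^ 2
      + 2 * γ * (∫ x, psiDeriv p ε (toLTwo w₀ x ^ 2) *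
          (toLTwo q.2 x * toLTwo q.2 x) ∂(volOn Ω))
      + Λ * inner ℝ (q.1 - u₀) q.1 ≤ 0 := by
  have h := hq.variational hd hb hp hε zero_mem_admissible
  obtain ⟨B, hB⟩ := exists_weightForm hd hb hp hε w₀
  rw [← hB] at h ⊢
  simp only [Prod.fst_zero, Prod.snd_zero, zero_sub, map_neg, inner_neg_right,
    real_inner_self_eq_norm_sq] at h
  linarith

/-- The point of this bound is that it does not depend on `Λ`, so every trial solution of the step
size search lies in one fixed ball. -/
lemma SolvesSub.norm_le (hd : 0 < d) (hb : Bornology.IsBounded (Ω : Set (Sp d)))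
    (hp : p ∈ Ioo (0 : ℝ) 1) (hε : 0 < ε) (hα : 0 < α) (hβ : 0 ≤ β) (hγ : 0 ≤ γ) (hΛ : 0 ≤ Λ)
    {q : USpace T Ω × WSpace Ω s k} (hq : SolvesSub f α β γ p ε u₀ w₀ Λ q) :
    ‖q.1‖ ≤ ‖fderiv ℝ f u₀‖ / α + ‖u₀‖ := by
  have h := hq.test_zero hd hb hp hε
  have h1 := mul_nonneg hγ (weight_integral_nonneg hp.1 hε (toLTwo w₀) (toLTwo q.2))
  have h2 : 0 ≤ β * ‖q.2‖ ^ 2 := by positivity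
  have h3 : -(‖fderiv ℝ f u₀‖ * ‖q.1‖) ≤ fderiv ℝ f u₀ q.1 := by
    have := (fderiv ℝ f u₀).le_opNorm q.1
    rw [Real.norm_eq_abs] at this
    linarith [neg_abs_le (fderiv ℝ f u₀ q.1)]
  have h4 : ‖q.1‖ ^ 2 - ‖u₀‖ * ‖q.1‖ ≤ inner ℝ (q.1 - u₀) q.1 := by
    rw [inner_sub_left, real_inner_self_eq_norm_sq]
    linarith [real_inner_le_norm u₀ q.1]
  have h5 := mul_le_mul_of_nonneg_left h4 hΛ
  have h6 : ((α + Λ) * ‖q.1‖) * ‖q.1‖ ≤ (‖fderiv ℝ f u₀‖ + Λ * ‖u₀‖) * ‖q.1‖ := by nlinarith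
  rcases eq_or_lt_of_le (norm_nonneg q.1) with h0 | h0
  · rw [← h0]
    positivity
  have h7 := le_of_mul_le_mul_right h6 h0
  have h8 : ‖fderiv ℝ f u₀‖ + Λ * ‖u₀‖ ≤ (α + Λ) * (‖fderiv ℝ f u₀‖ / α + ‖u₀‖) := by
    have e : (α + Λ) * (‖fderiv ℝ f u₀‖ / α + ‖u₀‖) = ‖fderiv ℝ f u₀‖ + Λ * ‖u₀‖
        + (Λ * (‖fderiv ℝ f u₀‖ / α) + α * ‖u₀‖) := by
      field_simp
      ring
    rw [e]
    exact le_add_of_nonneg_right (by positivity)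
  exact le_of_mul_le_mul_left (h7.trans h8) (by positivity)

end Subproblem

/-- The descent condition holds for all large step parameters. -/
lemma descent_of_lipschitz {H : Type*} [NormedAddCommGroup H] [InnerProductSpace ℝ H] {f : H → ℝ}
    (hf : Differentiable ℝ f) {B : Set H} (hB : Convex ℝ B) {M : ℝ≥0}
    (hM : LipschitzOnWith M (fderiv ℝ f) B) {u v : H} (hu : u ∈ B) (hv : v ∈ B) {Λ : ℝ}
    (hΛ : M ≤ Λ) : Descent f u Λ v := by
  have hseg : segment ℝ u v ⊆ B := hB.segment_subset hu hv
  -- The mean value inequality for `f - f'(u)` on the segment, where the derivative is at most `M ‖v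
  -- - u‖`. The descent condition carries `Λ` without a factor one half, so `M ≤ Λ` is enough.
  have h := Convex.norm_image_sub_le_of_norm_fderiv_le' (f := f) (s := segment ℝ u v)
    (φ := fderiv ℝ f u) (C := M * ‖v - u‖) (x := u) (y := v) (fun x _ => hf x) (fun x hx => ?_)
    (convex_segment u v) (left_mem_segment ℝ u v) (right_mem_segment ℝ u v)
  · unfold Descent
    have h1 := (Real.le_norm_self _).trans h
    have h2 : (M : ℝ) * ‖v - u‖ * ‖v - u‖ ≤ Λ * ‖v - u‖ ^ 2 := by
      rw [mul_assoc, ← pow_two]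
      gcongr
    linarith
  · have h1 := hM.dist_le_mul x (hseg hx) u hu
    rw [dist_eq_norm, dist_eq_norm] at h1
    refine h1.trans ?_
    gcongr
    obtain ⟨a, b, ha, hb, hab, rfl⟩ := hx
    have e : a • u + b • v - u = b • (v - u) := by
      rw [eq_sub_of_add_eq hab]
      module
    rw [e, norm_smul, Real.norm_of_nonneg hb]
    exact mul_le_of_le_one_left (norm_nonneg _) (by linarith)

/-! ### Energy decrease, bounds on the iterates and on the step parameters. -/

section Algorithm

variable {T : ℝ} {d : ℕ} {Ω : Opens (Sp d)} {s : Ioo (0 : ℝ) 1} {k : Kind}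
  {f : USpace T Ω → ℝ} {α β γ p b L : ℝ} {ε : ℕ → ℝ} {u : ℕ → USpace T Ω}
  {w : ℕ → WSpace Ω s k} {Ls : ℕ → ℝ}

/-- The tangent at zero bounds `ψ_δ(v²)` by a constant plus a multiple of `v²`. -/
lemma integrable_psi [IsFiniteMeasure (volOn Ω)] (hp : p ∈ Ioo (0 : ℝ) 1) {δ : ℝ} (hδ : 0 < δ)
    (v : LTwo Ω) : Integrable (fun x => psi p δ (v x ^ 2)) (volOn Ω) := by
  have hv := (Lp.stronglyMeasurable v).measurable
  refine Integrable.mono' ((integrable_const (psi p δ 0)).add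
    ((integrable_mul_Lp v v).const_mul (psiDeriv p δ 0))) (((continuous_psi hδ).measurable.comp (hv.pow_const 2)).aestronglyMeasurable)
    (Eventually.of_forall fun x => ?_)
  rw [Real.norm_of_nonneg (psi_nonneg hp.1 hp.2 hδ (sq_nonneg _))]
  have := psi_le_tangent hp.1 hp.2 hδ 0 (v x ^ 2)
  rw [sub_zero] at this
  change _ ≤ psi p δ 0 + psiDeriv p δ 0 * (v x * v x)
  rwa [← pow_two]

/-- The energy of the `j`-th iterate. -/
def energy (f : USpace T Ω → ℝ) (α β γ p : ℝ) (ε : ℕ → ℝ) (u : ℕ → USpace T Ω)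
    (w : ℕ → WSpace Ω s k) (j : ℕ) : ℝ :=
  f (u j) + α / 2 * ‖u j‖ ^ 2 + β / 2 * ‖w j‖ ^ 2
    + γ * ∫ x, psi p (ε j) (toLTwo (w j) x ^ 2) ∂(volOn Ω)

lemma IsGenerated.mem_admissible (hgen : IsGenerated f α β γ p b L ε u w Ls) (j : ℕ) :
    (u (j + 1), w (j + 1)) ∈ admissible T Ω s k := (hgen.next_iterate j).1

/-- The step size rule grants the descent condition to some solution of the subproblem; the growth
estimate shows that the next iterate has the same first component. -/
lemma IsGenerated.descent (hd : 0 < d) (hb : Bornology.IsBounded (Ω : Set (Sp d)))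
    (hp : p ∈ Ioo (0 : ℝ) 1) (hα : 0 < α) (hβ : 0 < β)
    (hγ : 0 ≤ γ) (hgen : IsGenerated f α β γ p b L ε u w Ls) (j : ℕ) :
    Descent f (u j) (Ls j) (u (j + 1)) := by
  obtain ⟨⟨l, hl⟩, q, hq, hdesc⟩ := (hgen.step_size j).1
  have hL : 0 < Ls j := by
    rw [hl]
    exact mul_pos hgen.L_pos (pow_pos (one_pos.trans hgen.one_lt_b) l)
  have hn := hgen.next_iterate j
  have h1 := hq.growth hd hb hp (hgen.ε_pos j) hγ hn.1
  have h2 := hn.2 q hq.1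
  have h3 : α / 2 * ‖u (j + 1) - q.1‖ ^ 2 ≤ 0 := by
    have : 0 ≤ β / 2 * ‖w (j + 1) - q.2‖ ^ 2 := by positivity
    have : 0 ≤ Ls j / 2 * ‖u (j + 1) - q.1‖ ^ 2 := by positivity
    simp only at h1
    linarith
  have h4 : ‖u (j + 1) - q.1‖ ^ 2 ≤ 0 := by
    by_contra hcon
    push Not at hcon
    have : 0 < α / 2 * ‖u (j + 1) - q.1‖ ^ 2 := by positivity
    linarith
  have h5 : u (j + 1) = q.1 := by
    have := pow_eq_zero_iff two_ne_zero |>.1 (le_antisymm h4 (sq_nonneg _))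
    exact sub_eq_zero.1 (norm_eq_zero.1 this)
  rw [h5]
  exact hdesc

/-- The growth estimate and the proximal term of the objective each give `L_k / 2` times the squared
step, which together cancel the `L_k` term of the descent condition. Indices start at 1, since the
starting point may be inadmissible and is then no competitor. -/
lemma IsGenerated.energy_step (hd : 0 < d) (hb : Bornology.IsBounded (Ω : Set (Sp d)))
    (hp : p ∈ Ioo (0 : ℝ) 1) (hα : 0 < α) (hβ : 0 < β) (hγ : 0 < γ)
    (hgen : IsGenerated f α β γ p b L ε u w Ls) (j : ℕ) :
    energy f α β γ p ε u w (j + 2) + α / 2 * ‖u (j + 2) - u (j + 1)‖ ^ 2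
      + β / 2 * ‖w (j + 2) - w (j + 1)‖ ^ 2 ≤ energy f α β γ p ε u w (j + 1) := by
  have : IsFiniteMeasure (volOn Ω) := ⟨by simpa using hb.measure_lt_top⟩
  have hεj := hgen.ε_pos (j + 1)
  have h1 := (hgen.next_iterate (j + 1)).growth hd hb hp hεj hγ.le (hgen.mem_admissible j)
  have h2 := hgen.descent hd hb hp hα hβ hγ.le (j + 1)
  -- First enlarge the smoothing parameter to `ε (j + 1)`, then bound by the tangent at the old
  -- iterate.
  have h3 : ∫ x, psi p (ε (j + 2)) (toLTwo (w (j + 2)) x ^ 2) ∂(volOn Ω)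
      ≤ (∫ x, psi p (ε (j + 1)) (toLTwo (w (j + 1)) x ^ 2) ∂(volOn Ω))
        + ∫ x, psiDeriv p (ε (j + 1)) (toLTwo (w (j + 1)) x ^ 2) *
          (toLTwo (w (j + 2)) x ^ 2 - toLTwo (w (j + 1)) x ^ 2) ∂(volOn Ω) := by
    have hi : Integrable (fun x => psiDeriv p (ε (j + 1)) (toLTwo (w (j + 1)) x ^ 2) *
        (toLTwo (w (j + 2)) x ^ 2 - toLTwo (w (j + 1)) x ^ 2)) (volOn Ω) := by
      refine ((integrable_weight hp hεj (toLTwo (w (j + 1))) (toLTwo (w (j + 2)))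
        (toLTwo (w (j + 2)))).sub (integrable_weight hp hεj (toLTwo (w (j + 1)))
        (toLTwo (w (j + 1))) (toLTwo (w (j + 1))))).congr (Eventually.of_forall fun x => ?_)
      simp only [Pi.sub_apply]
      ring
    rw [← integral_add (integrable_psi hp hεj _) hi]
    refine integral_mono (integrable_psi hp (hgen.ε_pos _) _) ((integrable_psi hp hεj _).add hi)
      fun x => ?_
    refine (psi_mono_eps hp.1 hp.2 (hgen.ε_pos (j + 2)) (hgen.ε_antitone (Nat.le_succ _)) _).trans ?_
    exact psi_le_tangent hp.1 hp.2 hεj _ _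
  have h4 := mul_le_mul_of_nonneg_left h3 hγ.le
  unfold Descent at h2
  unfold subObjective at h1
  unfold energy
  simp only [sub_self, map_zero, mul_zero, integral_zero, norm_zero, ne_eq, OfNat.ofNat_ne_zero,
    not_false_eq_true, zero_pow, add_zero, zero_add, add_assoc, Nat.reduceAdd] at h1 h2 h4 ⊢
  rw [norm_sub_rev (u (j + 1)), norm_sub_rev (w (j + 1))] at h1
  linarith

/-- Half of the term `α/2 ‖u‖²` is spent on absorbing the affine lower bound of `f`. -/
lemma energy_lower (hf : StandingAssumption f) (hp : p ∈ Ioo (0 : ℝ) 1) (hα : 0 < α)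
    (hγ : 0 < γ) (hgen : IsGenerated f α β γ p b L ε u w Ls) :
    ∃ c : ℝ, ∀ j, α / 4 * ‖u j‖ ^ 2 + β / 2 * ‖w j‖ ^ 2 ≤ energy f α β γ p ε u w j + c := by
  obtain ⟨g, c, hg⟩ := hf.affineBound
  refine ⟨‖g‖ ^ 2 / α - c, fun j => ?_⟩
  have h1 := hg (u j)
  have h2 : -(‖g‖ * ‖u j‖) ≤ g (u j) := by
    have := g.le_opNorm (u j)
    rw [Real.norm_eq_abs] at this
    linarith [neg_abs_le (g (u j))]
  have h3 : ‖g‖ * ‖u j‖ ≤ ‖g‖ ^ 2 / α + α / 4 * ‖u j‖ ^ 2 := by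
    have e : ‖g‖ ^ 2 / α + α / 4 * ‖u j‖ ^ 2 - ‖g‖ * ‖u j‖
        = (‖g‖ - α / 2 * ‖u j‖) ^ 2 / α := by
      field_simp
      ring
    have : 0 ≤ (‖g‖ - α / 2 * ‖u j‖) ^ 2 / α := by positivity
    linarith
  have h4 : 0 ≤ γ * ∫ x, psi p (ε j) (toLTwo (w j) x ^ 2) ∂(volOn Ω) :=
    mul_nonneg hγ.le (integral_nonneg fun x => psi_nonneg hp.1 hp.2 (hgen.ε_pos j) (sq_nonneg _))
  unfold energy
  linarith

lemma IsGenerated.energy_antitone (hd : 0 < d) (hb : Bornology.IsBounded (Ω : Set (Sp d)))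
    (hp : p ∈ Ioo (0 : ℝ) 1) (hα : 0 < α) (hβ : 0 < β) (hγ : 0 < γ)
    (hgen : IsGenerated f α β γ p b L ε u w Ls) :
    Antitone fun j => energy f α β γ p ε u w (j + 1) := by
  refine antitone_nat_of_succ_le fun j => ?_
  have h := hgen.energy_step hd hb hp hα hβ hγ j
  have h1 : 0 ≤ α / 2 * ‖u (j + 2) - u (j + 1)‖ ^ 2 := by positivity
  have h2 : 0 ≤ β / 2 * ‖w (j + 2) - w (j + 1)‖ ^ 2 := by positivity
  linarith

lemma IsGenerated.exists_bound (hd : 0 < d) (hb : Bornology.IsBounded (Ω : Set (Sp d)))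
    (hf : StandingAssumption f) (hp : p ∈ Ioo (0 : ℝ) 1) (hα : 0 < α) (hβ : 0 < β) (hγ : 0 < γ)
    (hgen : IsGenerated f α β γ p b L ε u w Ls) : ∃ R, ∀ j, ‖u j‖ ≤ R ∧ ‖w j‖ ≤ R := by
  obtain ⟨c, hc⟩ := energy_lower hf hp hα hγ hgen
  have hanti := hgen.energy_antitone hd hb hp hα hβ hγ
  set E := energy f α β γ p ε u w
  -- Monotonicity holds only from index 1 on, so the starting point enters separately.
  set M := max (E 1 + c) (E 0 + c)
  have hM : ∀ j, α / 4 * ‖u j‖ ^ 2 + β / 2 * ‖w j‖ ^ 2 ≤ M := by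
    intro j
    cases j with
    | zero => exact (hc 0).trans (le_max_right _ _)
    | succ j =>
      refine (hc _).trans (le_trans ?_ (le_max_left _ _))
      exact add_le_add_left (hanti (Nat.zero_le j)) c
  refine ⟨√(4 / α * M) + √(2 / β * M), fun j => ⟨?_, ?_⟩⟩
  · refine le_add_of_le_of_nonneg (Real.le_sqrt_of_sq_le ?_) (Real.sqrt_nonneg _)
    have h1 : α / 4 * ‖u j‖ ^ 2 ≤ M := le_trans (le_add_of_nonneg_right (by positivity)) (hM j)
    have h2 := mul_le_mul_of_nonneg_left h1 (by positivity : 0 ≤ 4 / α)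
    have e : 4 / α * (α / 4 * ‖u j‖ ^ 2) = ‖u j‖ ^ 2 := by field_simp
    linarith
  · refine le_add_of_nonneg_of_le (Real.sqrt_nonneg _) (Real.le_sqrt_of_sq_le ?_)
    have h1 : β / 2 * ‖w j‖ ^ 2 ≤ M := le_trans (le_add_of_nonneg_left (by positivity)) (hM j)
    have h2 := mul_le_mul_of_nonneg_left h1 (by positivity : 0 ≤ 2 / β)
    have e : 2 / β * (β / 2 * ‖w j‖ ^ 2) = ‖w j‖ ^ 2 := by field_simp
    linarith

lemma tendsto_of_mul_sq_le {H : Type*} [NormedAddCommGroup H] {x : ℕ → H} {c : ℝ} (hc : 0 < c)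
    {D : ℕ → ℝ} (hD : Tendsto D atTop (𝓝 0)) (h : ∀ j, c * ‖x j‖ ^ 2 ≤ D j) :
    Tendsto x atTop (𝓝 0) := by
  have h1 : Tendsto (fun j => ‖x j‖ ^ 2) atTop (𝓝 0) := by
    refine squeeze_zero (fun _ => sq_nonneg _) (fun j => ?_) (by simpa using hD.const_mul c⁻¹)
    have := mul_le_mul_of_nonneg_left (h j) (inv_pos.2 hc).le
    rwa [inv_mul_cancel_left₀ hc.ne'] at this
  have h2 := h1.sqrt
  simp only [Real.sqrt_sq (norm_nonneg _), Real.sqrt_zero] at h2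
  exact tendsto_zero_iff_norm_tendsto_zero.2 h2

/-- The decreasing energy is bounded below, so its increments, which dominate the squared steps,
tend to zero. -/
lemma IsGenerated.tendsto_sub (hd : 0 < d) (hb : Bornology.IsBounded (Ω : Set (Sp d)))
    (hf : StandingAssumption f) (hp : p ∈ Ioo (0 : ℝ) 1) (hα : 0 < α) (hβ : 0 < β) (hγ : 0 < γ)
    (hgen : IsGenerated f α β γ p b L ε u w Ls) :
    Tendsto (fun j => u (j + 1) - u j) atTop (𝓝 0) ∧
      Tendsto (fun j => w (j + 1) - w j) atTop (𝓝 0) := by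
  obtain ⟨c, hc⟩ := energy_lower hf hp hα hγ hgen
  have hanti := hgen.energy_antitone hd hb hp hα hβ hγ
  have hstep := hgen.energy_step hd hb hp hα hβ hγ
  set E := energy f α β γ p ε u w
  have hbdd : BddBelow (range fun j => E (j + 1)) := by
    refine ⟨-c, ?_⟩
    rintro _ ⟨j, rfl⟩
    have h1 := hc (j + 1)
    have : 0 ≤ α / 4 * ‖u (j + 1)‖ ^ 2 + β / 2 * ‖w (j + 1)‖ ^ 2 := by positivity
    change -c ≤ E (j + 1)
    linarith
  have hlim := tendsto_atTop_ciInf hanti hbdd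
  have hD : Tendsto (fun j => E (j + 1) - E (j + 2)) atTop (𝓝 0) := by
    have := hlim.sub ((tendsto_add_atTop_iff_nat 1).2 hlim)
    rwa [sub_self] at this
  constructor
  · refine (tendsto_add_atTop_iff_nat 1).1 (tendsto_of_mul_sq_le (half_pos hα) hD fun j => ?_)
    have h := hstep j
    have h2 : 0 ≤ β / 2 * ‖w (j + 2) - w (j + 1)‖ ^ 2 := by positivity
    change α / 2 * ‖u (j + 2) - u (j + 1)‖ ^ 2 ≤ _
    linarith
  · refine (tendsto_add_atTop_iff_nat 1).1 (tendsto_of_mul_sq_le (half_pos hβ) hD fun j => ?_)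
    have h := hstep j
    have h2 : 0 ≤ α / 2 * ‖u (j + 2) - u (j + 1)‖ ^ 2 := by positivity
    change β / 2 * ‖w (j + 2) - w (j + 1)‖ ^ 2 ≤ _
    linarith

/-- The step parameters are bounded. -/
lemma IsGenerated.exists_step_bound (hd : 0 < d) (hb : Bornology.IsBounded (Ω : Set (Sp d)))
    (hf : StandingAssumption f) (hf' : DerivAssumption f) (hp : p ∈ Ioo (0 : ℝ) 1) (hα : 0 < α)
    (hβ : 0 < β) (hγ : 0 < γ) (hgen : IsGenerated f α β γ p b L ε u w Ls) :
    ∃ C, ∀ j, |Ls j| ≤ C := by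
  obtain ⟨R, hR⟩ := hgen.exists_bound hd hb hf hp hα hβ hγ
  have hR0 : 0 ≤ R := (norm_nonneg _).trans (hR 0).1
  obtain ⟨M₀, hM₀⟩ := hf'.lipschitz (Metric.closedBall 0 R) Metric.isBounded_closedBall
  set G := M₀ * R + ‖fderiv ℝ f 0‖
  have hG : ∀ j, ‖fderiv ℝ f (u j)‖ ≤ G := by
    intro j
    have h1 := hM₀.dist_le_mul (u j) (mem_closedBall_zero_iff.2 (hR j).1) 0
      (Metric.mem_closedBall_self hR0)
    rw [dist_eq_norm, dist_zero_right] at h1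
    have h2 := norm_sub_norm_le (fderiv ℝ f (u j)) (fderiv ℝ f 0)
    have h3 : (M₀ : ℝ) * ‖u j‖ ≤ M₀ * R := mul_le_mul_of_nonneg_left (hR j).1 M₀.2
    linarith
  -- This radius contains the iterates and all solutions of the subproblems, whatever the step
  -- parameter.
  set R' := G / α + R
  obtain ⟨M, hM⟩ := hf'.lipschitz (Metric.closedBall 0 R') Metric.isBounded_closedBall
  obtain ⟨l, hl⟩ := pow_unbounded_of_one_lt ((M : ℝ) / L) hgen.one_lt_b
  have hΛ : (M : ℝ) ≤ L * b ^ l := by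
    rw [div_lt_iff₀ hgen.L_pos] at hl
    linarith
  have hpos : ∀ l : ℕ, 0 < L * b ^ l := fun l =>
    mul_pos hgen.L_pos (pow_pos (one_pos.trans hgen.one_lt_b) l)
  have hG0 : 0 ≤ G := (norm_nonneg _).trans (hG 0)
  refine ⟨L * b ^ l, fun j => ?_⟩
  obtain ⟨l', hl'⟩ := (hgen.step_size j).1.1
  rw [abs_of_pos (by rw [hl']; exact hpos l')]
  -- `L_j` is the least successful candidate, so it suffices that `L * b ^ l` succeeds for every
  -- `j`.
  refine (hgen.step_size j).2 ⟨⟨l, rfl⟩, ?_⟩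
  obtain ⟨q, hq⟩ := exists_solvesSub hd hb hp (hgen.ε_pos j) hα hβ hγ.le (hpos l) f (u j) (w j)
  refine ⟨q, hq, descent_of_lipschitz (hf.contDiff.differentiable (by norm_num))
    (convex_closedBall 0 R') hM ?_ ?_ hΛ⟩
  · rw [mem_closedBall_zero_iff]
    have : 0 ≤ G / α := by positivity
    linarith [(hR j).1]
  · rw [mem_closedBall_zero_iff]
    refine (hq.norm_le hd hb hp (hgen.ε_pos j) hα hβ.le hγ.le (hpos l).le).trans ?_
    have : ‖fderiv ℝ f (u j)‖ / α ≤ G / α := by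
      gcongr
      exact hG j
    linarith [(hR j).1]

end Algorithm

/-! ### Passage to the limit -/

section LatticeLimit

variable {X : Type*} [MeasurableSpace X] {μ : Measure X}

lemma coeFn_posPart_Lp (g : Lp ℝ 2 μ) : (g⁺ : Lp ℝ 2 μ) =ᵐ[μ] fun x => max (g x) 0 := by
  have e : g⁺ = g ⊔ 0 := rfl
  rw [e]
  filter_upwards [Lp.coeFn_sup g 0, Lp.coeFn_zero ℝ 2 μ] with x h1 h2
  rw [h1, Pi.sup_apply, h2, Pi.zero_apply]

/-- Complementarity of the positive part. -/
lemma inner_posPart_eq_zero {a g : Lp ℝ 2 μ} (ha : 0 ≤ a)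
    (h : ∀ v : Lp ℝ 2 μ, 0 ≤ v → v ≤ a → (inner ℝ g v : ℝ) ≤ 0) :
    (inner ℝ g⁺ a : ℝ) = 0 := by
  refine le_antisymm ?_ (inner_nonneg_of_nonneg (posPart_nonneg g) ha)
  have hS : MeasurableSet {x | 0 < g x} :=
    measurableSet_lt measurable_const (Lp.stronglyMeasurable g).measurable
  -- The test function is `a` restricted to `{g > 0}`; its pairing with `g` is `(g⁺, a)`.
  have hm := (Lp.memLp a).indicator hS
  have hv := hm.coeFn_toLp
  have ha' := (Lp.coeFn_nonneg a).2 ha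
  have h1 := h (hm.toLp _) ?_ ?_
  · refine le_trans (le_of_eq ?_) h1
    rw [inner_eq_integral, inner_eq_integral]
    refine integral_congr_ae ?_
    filter_upwards [hv, coeFn_posPart_Lp g] with x h1 h2
    rw [h1, h2]
    by_cases hx : 0 < g x
    · rw [indicator_of_mem (by exact hx), max_eq_left hx.le]
    · rw [indicator_of_notMem (by exact hx), max_eq_right (not_lt.1 hx), zero_mul, mul_zero]
  · rw [← Lp.coeFn_nonneg]
    filter_upwards [hv, ha'] with x h1 h2
    rw [h1]
    by_cases hx : x ∈ {x | 0 < g x}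
    · rw [indicator_of_mem hx]
      exact h2
    · rw [indicator_of_notMem hx]
      rfl
  · rw [← Lp.coeFn_le]
    filter_upwards [hv, ha'] with x h1 h2
    rw [h1]
    by_cases hx : x ∈ {x | 0 < g x}
    · rw [indicator_of_mem hx]
    · rw [indicator_of_notMem hx]
      exact h2

/-- This is the majorant for the dominated convergence of the truncations. -/
lemma abs_clamp_sub_le {v y : ℝ} (hy : 0 ≤ y) : |(v ⊓ y) ⊔ (-y) - v| ≤ |v| := by
  rcases le_total v y with h | h
  · rw [inf_eq_left.2 h]
    rcases le_total v (-y) with h' | h'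
    · rw [sup_eq_right.2 h', abs_of_nonneg (by linarith), abs_of_nonpos (by linarith)]
      linarith
    · rw [sup_eq_left.2 h']
      simp
  · rw [inf_eq_right.2 h, sup_eq_left.2 (by linarith), abs_of_nonpos (by linarith),
      abs_of_nonneg (by linarith)]
    linarith

/-- Truncations converge if the truncation levels converge almost everywhere. -/
lemma tendsto_clamp {v : Lp ℝ 2 μ} {Y : ℕ → Lp ℝ 2 μ} {Z : Lp ℝ 2 μ} (hY : ∀ j, 0 ≤ Y j)
    (hYZ : ∀ᵐ x ∂μ, Tendsto (fun j => Y j x) atTop (𝓝 (Z x))) (h1 : v ≤ Z) (h2 : -v ≤ Z) :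
    Tendsto (fun j => (v ⊓ Y j) ⊔ (-Y j)) atTop (𝓝 v) := by
  rw [tendsto_iff_edist_tendsto_0]
  have hcoe : ∀ j, ((v ⊓ Y j) ⊔ (-Y j) - v : Lp ℝ 2 μ)
      =ᵐ[μ] fun x => (v x ⊓ Y j x) ⊔ (-Y j x) - v x := by
    intro j
    filter_upwards [Lp.coeFn_sub ((v ⊓ Y j) ⊔ (-Y j)) v, Lp.coeFn_sup (v ⊓ Y j) (-Y j),
      Lp.coeFn_inf v (Y j), Lp.coeFn_neg (Y j)] with x e1 e2 e3 e4
    rw [e1, Pi.sub_apply, e2, Pi.sup_apply, e3, e4, Pi.inf_apply, Pi.neg_apply]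
  have hsq : Tendsto (fun j => edist ((v ⊓ Y j) ⊔ (-Y j)) v ^ 2) atTop (𝓝 0) := by
    have e : ∀ j, edist ((v ⊓ Y j) ⊔ (-Y j)) v ^ 2
        = ∫⁻ x, ‖(v x ⊓ Y j x) ⊔ (-Y j x) - v x‖ₑ * ‖(v x ⊓ Y j x) ⊔ (-Y j x) - v x‖ₑ ∂μ := by
      intro j
      rw [edist_eq_enorm_sub, Lp.enorm_def, eLpNorm_congr_ae (hcoe j), ← lintegral_enorm_sq]
    simp only [e]
    have hvm := (Lp.stronglyMeasurable v).measurable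
    have hYm := fun j => (Lp.stronglyMeasurable (Y j)).measurable
    have hlim := tendsto_lintegral_of_dominated_convergence (μ := μ)
      (F := fun j x => ‖(v x ⊓ Y j x) ⊔ (-Y j x) - v x‖ₑ * ‖(v x ⊓ Y j x) ⊔ (-Y j x) - v x‖ₑ)
      (f := fun _ => 0) (fun x => ‖v x‖ₑ * ‖v x‖ₑ) ?_ ?_ ?_ ?_
    · simpa using hlim
    · intro j
      have := hYm j
      fun_prop
    · intro j
      filter_upwards [(Lp.coeFn_nonneg (Y j)).2 (hY j)] with x hx
      have hle : ‖(v x ⊓ Y j x) ⊔ (-Y j x) - v x‖ₑ ≤ ‖v x‖ₑ := by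
        rw [enorm_le_iff_norm_le]
        exact abs_clamp_sub_le hx
      gcongr
    · rw [lintegral_enorm_sq]
      exact ENNReal.pow_ne_top (Lp.memLp v).2.ne
    · filter_upwards [hYZ, (Lp.coeFn_le _ _).2 h1, (Lp.coeFn_le _ _).2 h2, Lp.coeFn_neg v]
        with x hx hx1 hx2 hx3
      rw [hx3, Pi.neg_apply] at hx2
      have ht : Tendsto (fun j => (v x ⊓ Y j x) ⊔ (-Y j x) - v x) atTop
          (𝓝 ((v x ⊓ Z x) ⊔ (-Z x) - v x)) :=
        ((tendsto_const_nhds.inf_nhds hx).sup_nhds hx.neg).sub tendsto_const_nhds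
      rw [inf_eq_left.2 hx1, sup_eq_left.2 (by linarith), sub_self] at ht
      have ht2 := (continuous_enorm.tendsto (0 : ℝ)).comp ht
      rw [enorm_zero] at ht2
      simpa using ENNReal.Tendsto.mul ht2 (Or.inr (by simp)) ht2 (Or.inr (by simp))
  have hr : Tendsto (fun j => (edist ((v ⊓ Y j) ⊔ (-Y j)) v ^ 2) ^ (1 / 2 : ℝ)) atTop
      (𝓝 (0 ^ (1 / 2 : ℝ))) := (ENNReal.continuous_rpow_const.tendsto 0).comp hsq
  rw [ENNReal.zero_rpow_of_pos (by norm_num)] at hr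
  refine hr.congr fun j => ?_
  rw [← ENNReal.rpow_natCast, ← ENNReal.rpow_mul]
  norm_num

end LatticeLimit

/-! ### Weak convergence and limits of pairings. -/

section WeakLimits

variable {H : Type*} [NormedAddCommGroup H] [InnerProductSpace ℝ H]

lemma WeakTendsto.comp {x : ℕ → H} {a : H} (h : WeakTendsto x a) {φ : ℕ → ℕ}
    (hφ : StrictMono φ) : WeakTendsto (fun j => x (φ j)) a :=
  fun l => (h l).comp hφ.tendsto_atTop

lemma WeakTendsto.add_tendsto_zero {x y : ℕ → H} {a : H} (h : WeakTendsto x a)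
    (hy : Tendsto (fun j => y j - x j) atTop (𝓝 0)) : WeakTendsto y a := by
  intro l
  have h1 := (h l).add ((l.continuous.tendsto 0).comp hy)
  rw [map_zero, add_zero] at h1
  refine h1.congr fun j => ?_
  simp

lemma WeakTendsto.inner_left {x : ℕ → H} {a : H} (h : WeakTendsto x a) (z : H) :
    Tendsto (fun j => (inner ℝ z (x j) : ℝ)) atTop (𝓝 (inner ℝ z a)) := h (innerSL ℝ z)

/-- Pairing of strongly convergent functionals with bounded weakly convergent sequences. -/
lemma WeakTendsto.apply_tendsto {x : ℕ → H} {a : H} (h : WeakTendsto x a) {R : ℝ}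
    (hR : ∀ j, ‖x j‖ ≤ R) {l : ℕ → H →L[ℝ] ℝ} {l₀ : H →L[ℝ] ℝ} (hl : Tendsto l atTop (𝓝 l₀)) :
    Tendsto (fun j => l j (x j)) atTop (𝓝 (l₀ a)) := by
  have h1 : Tendsto (fun j => (l j - l₀) (x j)) atTop (𝓝 0) := by
    have h2 := (tendsto_iff_norm_sub_tendsto_zero.1 hl).mul_const R
    rw [zero_mul] at h2
    refine squeeze_zero_norm (fun j => ?_) h2
    exact ((l j - l₀).le_opNorm _).trans (mul_le_mul_of_nonneg_left (hR j) (norm_nonneg _))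
  have h3 := h1.add (h l₀)
  rw [zero_add] at h3
  refine h3.congr fun j => ?_
  simp

/-- The affine minorant of `‖x‖²`, with equality at `x = a`, passes to weak limits and replaces weak
lower semicontinuity of the norm. -/
lemma two_inner_sub_le_norm_sq (x a : H) : 2 * inner ℝ a x - ‖a‖ ^ 2 ≤ ‖x‖ ^ 2 := by
  have h := norm_sub_sq_real x a
  rw [real_inner_comm] at h
  linarith [sq_nonneg ‖x - a‖]

end WeakLimits

/-! ### Fatou's lemma for the smoothed nonsmooth term. -/

section Fatou

/-- Away from zero, `a_j²` eventually exceeds `ε_j²`, so the power branch of `ψ'` applies and the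
limit is `p/2 |c|^(p-2) c²`. -/
lemma tendsto_psiDeriv_mul {p : ℝ} {ε a b : ℕ → ℝ} {c : ℝ}
    (hε0 : Tendsto ε atTop (𝓝 0)) (ha : Tendsto a atTop (𝓝 c)) (hb : Tendsto b atTop (𝓝 c))
    (hc : c ≠ 0) :
    Tendsto (fun j => psiDeriv p (ε j) (a j ^ 2) * (b j * b j)) atTop (𝓝 (p / 2 * |c| ^ p)) := by
  have hc2 : 0 < c ^ 2 := by positivity
  have h1 : ∀ᶠ j in atTop, psiDeriv p (ε j) (a j ^ 2) = p / 2 * (a j ^ 2) ^ ((p - 2) / 2) := by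
    have h2 : Tendsto (fun j => a j ^ 2 - ε j ^ 2) atTop (𝓝 (c ^ 2 - 0 ^ 2)) :=
      (ha.pow 2).sub (hε0.pow 2)
    have h3 : 0 < c ^ 2 - 0 ^ 2 := by simpa using hc2
    filter_upwards [h2.eventually (lt_mem_nhds h3)] with j hj
    rw [psiDeriv, if_neg (by linarith)]
  have hlim : Tendsto (fun j => p / 2 * (a j ^ 2) ^ ((p - 2) / 2) * (b j * b j)) atTop
      (𝓝 (p / 2 * (c ^ 2) ^ ((p - 2) / 2) * (c * c))) :=
    (((ha.pow 2).rpow_const (Or.inl hc2.ne')).const_mul _).mul (hb.mul hb)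
  have e : p / 2 * (c ^ 2) ^ ((p - 2) / 2) * (c * c) = p / 2 * |c| ^ p := by
    have hc' : 0 < |c| := abs_pos.2 hc
    rw [← sq_abs c, sq_rpow_half hc', ← abs_mul_abs_self c, mul_assoc, ← pow_two,
      ← Real.rpow_natCast |c| 2, ← Real.rpow_add hc']
    congr 2
    push_cast
    ring
  rw [e] at hlim
  refine hlim.congr' ?_
  filter_upwards [h1] with j hj
  rw [hj]

/-- Lower semicontinuity of the smoothed terms along almost everywhere convergent sequences. -/
lemma integral_rpow_le_of_tendsto {X : Type*} [MeasurableSpace X] {μ : Measure X} {p : ℝ}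
    (hp : p ∈ Ioo (0 : ℝ) 1) {ε : ℕ → ℝ} (hε : ∀ j, 0 < ε j) (hε0 : Tendsto ε atTop (𝓝 0))
    {a b : ℕ → X → ℝ} {c : X → ℝ} (ham : ∀ j, Measurable (a j)) (hbm : ∀ j, Measurable (b j))
    (hcm : Measurable c)
    (hint : ∀ j, Integrable (fun x => psiDeriv p (ε j) (a j x ^ 2) * (b j x * b j x)) μ)
    (ha : ∀ᵐ x ∂μ, Tendsto (fun j => a j x) atTop (𝓝 (c x)))
    (hb : ∀ᵐ x ∂μ, Tendsto (fun j => b j x) atTop (𝓝 (c x))) {D : ℕ → ℝ} {D₀ : ℝ}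
    (hD : Tendsto D atTop (𝓝 D₀))
    (hle : ∀ j, ∫ x, psiDeriv p (ε j) (a j x ^ 2) * (b j x * b j x) ∂μ ≤ D j) :
    p / 2 * ∫ x, |c x| ^ p ∂μ ≤ D₀ := by
  have hnn : ∀ j x, 0 ≤ psiDeriv p (ε j) (a j x ^ 2) * (b j x * b j x) := fun j x =>
    mul_nonneg (psiDeriv_nonneg hp.1 (hε j) _) (mul_self_nonneg _)
  have hD0 : 0 ≤ D₀ := ge_of_tendsto' hD fun j => (integral_nonneg (hnn j)).trans (hle j)
  have hp2 : 0 ≤ p / 2 := by linarith [hp.1]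
  rw [← integral_const_mul, integral_eq_lintegral_of_nonneg_ae
    (Eventually.of_forall fun x => by positivity) (by
      refine Measurable.aestronglyMeasurable ?_
      fun_prop)]
  refine ENNReal.toReal_le_of_le_ofReal hD0 ?_
  calc ∫⁻ x, ENNReal.ofReal (p / 2 * |c x| ^ p) ∂μ
      ≤ ∫⁻ x, liminf (fun j => ENNReal.ofReal
          (psiDeriv p (ε j) (a j x ^ 2) * (b j x * b j x))) atTop ∂μ := by
        refine lintegral_mono_ae ?_
        filter_upwards [ha, hb] with x hx1 hx2
        -- Where `c` vanishes the smoothed terms may fail to converge, but the target integrand is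
        -- zero because `p > 0`.
        by_cases hc : c x = 0
        · rw [hc, abs_zero, Real.zero_rpow hp.1.ne', mul_zero, ENNReal.ofReal_zero]
          exact zero_le
        · exact (ENNReal.tendsto_ofReal
            (tendsto_psiDeriv_mul hε0 hx1 hx2 hc)).liminf_eq.ge
    _ ≤ liminf (fun j => ∫⁻ x, ENNReal.ofReal
          (psiDeriv p (ε j) (a j x ^ 2) * (b j x * b j x)) ∂μ) atTop :=
        lintegral_liminf_le fun j => ENNReal.measurable_ofReal.comp
          (((measurable_psiDeriv p (ε j)).comp ((ham j).pow_const 2)).mul ((hbm j).mul (hbm j)))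
    _ ≤ liminf (fun j => ENNReal.ofReal (D j)) atTop := by
        refine liminf_le_liminf (Eventually.of_forall fun j => ?_)
        rw [← ofReal_integral_eq_lintegral_ofReal (hint j) (Eventually.of_forall (hnn j))]
        exact ENNReal.ofReal_le_ofReal (hle j)
    _ = ENNReal.ofReal D₀ := (ENNReal.tendsto_ofReal hD).liminf_eq

end Fatou

/-! ### The normal cone of the nonnegative functions. -/

section Subdifferential

variable {T : ℝ} {d : ℕ} {Ω : Opens (Sp d)}

lemma mem_nonnegCone_iff {v : USpace T Ω} : v ∈ nonnegCone T Ω ↔ 0 ≤ v :=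
  Lp.coeFn_nonneg v

/-- By complementarity `(-g, v - a) = -(g, v)`, which is at most zero for nonnegative `v`. -/
lemma neg_mem_subdifferential {a g : USpace T Ω} (ha : 0 ≤ a) (hg : 0 ≤ g)
    (hag : (inner ℝ g a : ℝ) = 0) :
    -g ∈ subdifferential (indicatorFun (nonnegCone T Ω)) a := by
  have hF : indicatorFun (nonnegCone T Ω) a = 0 := if_pos (mem_nonnegCone_iff.2 ha)
  refine ⟨by rw [hF]; exact EReal.zero_ne_top, fun v => ?_⟩
  rw [hF, zero_add]
  by_cases hv : v ∈ nonnegCone T Ω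
  · rw [indicatorFun, if_pos hv]
    have := inner_nonneg_of_nonneg hg (mem_nonnegCone_iff.1 hv)
    rw [inner_neg_left, inner_sub_right, hag]
    exact_mod_cast (by linarith : -((inner ℝ g v : ℝ) - 0) ≤ 0)
  · rw [indicatorFun, if_neg hv]
    exact le_top

end Subdifferential

/-! ### Feasibility, variational inequality and nonsmooth estimate at the weak limit. -/

section MainProof

variable {T : ℝ} {d : ℕ} {Ω : Opens (Sp d)} {s : Ioo (0 : ℝ) 1} {k : Kind}
  {f : USpace T Ω → ℝ} {α β γ p b L : ℝ} {ε : ℕ → ℝ} {u : ℕ → USpace T Ω}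
  {w : ℕ → WSpace Ω s k} {Ls : ℕ → ℝ}

/-- A subsequence along which the iterates and their successors converge almost everywhere. -/
lemma exists_subseq_ae (hd : 0 < d) (hb : Bornology.IsBounded (Ω : Set (Sp d)))
    {y z : ℕ → WSpace Ω s k} {a : WSpace Ω s k} {R : ℝ} (hy : WeakTendsto y a)
    (hz : WeakTendsto z a) (hyR : ∀ j, ‖y j‖ ≤ R) (hzR : ∀ j, ‖z j‖ ≤ R) :
    ∃ φ : ℕ → ℕ, StrictMono φ ∧
      (∀ᵐ x ∂(volOn Ω), Tendsto (fun j => toLTwo (y (φ j)) x) atTop (𝓝 (toLTwo a x))) ∧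
      ∀ᵐ x ∂(volOn Ω), Tendsto (fun j => toLTwo (z (φ j)) x) atTop (𝓝 (toLTwo a x)) := by
  obtain ⟨φ, hφ, h1⟩ :=
    (tendstoInMeasure_of_weakTendsto hd hb hy hyR).exists_seq_tendsto_ae
  obtain ⟨χ, hχ, h2⟩ := (tendstoInMeasure_of_weakTendsto hd hb (hz.comp hφ)
    fun j => hzR (φ j)).exists_seq_tendsto_ae
  refine ⟨φ ∘ χ, hφ.comp hχ, ?_, h2⟩
  filter_upwards [h1] with x hx
  exact hx.comp hχ.tendsto_atTop

/-- The properties of a weak limit from which the multipliers are constructed: feasibility, the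
variational inequality for the control, and the estimate of the nonsmooth term. -/
lemma limit_properties (hd : 0 < d) (hb : Bornology.IsBounded (Ω : Set (Sp d)))
    (hf : StandingAssumption f) (hf' : DerivAssumption f) (hα : 0 < α) (hβ : 0 < β) (hγ : 0 < γ)
    (hp : p ∈ Ioo (0 : ℝ) 1) (hgen : IsGenerated f α β γ p b L ε u w Ls)
    {ubar : USpace T Ω} {wbar : WSpace Ω s k} {n : ℕ → ℕ} (hn : StrictMono n)
    (hu : WeakTendsto (fun j => u (n j)) ubar) (hw : WeakTendsto (fun j => w (n j)) wbar) :
    (ubar ≤ cylExt T (toLTwo wbar) ∧ -ubar ≤ cylExt T (toLTwo wbar)) ∧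
    (∀ v : USpace T Ω, v ≤ cylExt T (toLTwo wbar) → -v ≤ cylExt T (toLTwo wbar) →
      0 ≤ fderiv ℝ f ubar (v - ubar) + α * inner ℝ ubar (v - ubar)) ∧
    γ * (p * ∫ x, |toLTwo wbar x| ^ p ∂(volOn Ω))
      ≤ -(fderiv ℝ f ubar ubar + α * ‖ubar‖ ^ 2) - β * ‖wbar‖ ^ 2 := by
  obtain ⟨R, hR⟩ := hgen.exists_bound hd hb hf hp hα hβ hγ
  obtain ⟨C, hC⟩ := hgen.exists_step_bound hd hb hf hf' hp hα hβ hγ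
  obtain ⟨hdu, hdw⟩ := hgen.tendsto_sub hd hb hf hp hα hβ hγ
  obtain ⟨ι, hι⟩ := exists_toLTwoL hd hb s k
  obtain ⟨E, hE⟩ := exists_cylExtL T Ω
  -- pass to a subsequence
  obtain ⟨φ, hφ, hae0, hae1⟩ := exists_subseq_ae hd hb hw
    (hw.add_tendsto_zero (hdw.comp hn.tendsto_atTop)) (fun j => (hR _).2) (fun j => (hR _).2)
  set m : ℕ → ℕ := n ∘ φ
  have hm : Tendsto m atTop atTop := (hn.comp hφ).tendsto_atTop
  have hx : WeakTendsto (fun j => u (m j + 1)) ubar :=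
    (hu.comp hφ).add_tendsto_zero (hdu.comp hm)
  have hy : WeakTendsto (fun j => w (m j + 1)) wbar :=
    (hw.comp hφ).add_tendsto_zero (hdw.comp hm)
  -- The linearization and the proximal term in one functional. It converges in norm: `f'` is
  -- completely continuous, and a bounded `L_k` multiplies steps tending to zero.
  let ψ : ℕ → USpace T Ω →L[ℝ] ℝ := fun j =>
    fderiv ℝ f (u (m j)) + innerSL ℝ (Ls (m j) • (u (m j + 1) - u (m j)))
  have hψ : Tendsto ψ atTop (𝓝 (fderiv ℝ f ubar)) := by
    have h1 := hf'.completelyContinuous _ _ (hu.comp hφ)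
    have h2 : Tendsto (fun j => Ls (m j) • (u (m j + 1) - u (m j))) atTop (𝓝 0) := by
      have h3 := (tendsto_zero_iff_norm_tendsto_zero.1 (hdu.comp hm)).const_mul C
      rw [mul_zero] at h3
      refine squeeze_zero_norm (fun j => ?_) h3
      rw [norm_smul]
      exact mul_le_mul_of_nonneg_right (hC _) (norm_nonneg _)
    have h4 := h1.add (((innerSL ℝ).continuous.tendsto (0 : USpace T Ω)).comp h2)
    rw [map_zero, add_zero] at h4
    exact h4
  have hψx : Tendsto (fun j => ψ j (u (m j + 1))) atTop (𝓝 (fderiv ℝ f ubar ubar)) :=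
    hx.apply_tendsto (fun j => (hR _).1) hψ
  have hadm : ∀ j, u (m j + 1) ≤ cylExt T (toLTwo (w (m j + 1))) ∧
      -u (m j + 1) ≤ cylExt T (toLTwo (w (m j + 1))) := fun j =>
    mem_admissible_iff.1 (hgen.mem_admissible (m j))
  -- feasibility
  have hEy : ∀ v : USpace T Ω, Tendsto (fun j => (inner ℝ v (cylExt T (toLTwo (w (m j + 1)))) : ℝ))
      atTop (𝓝 (inner ℝ v (cylExt T (toLTwo wbar)))) := by
    intro v
    have := hy ((innerSL ℝ v).comp (E.comp ι))
    simpa [hE, hι] using this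
  have hfeas : ubar ≤ cylExt T (toLTwo wbar) ∧ -ubar ≤ cylExt T (toLTwo wbar) := by
    constructor
    · rw [← sub_nonneg]
      refine nonneg_of_forall_inner_nonneg fun v hv => ?_
      rw [inner_sub_right]
      refine ge_of_tendsto' ((hEy v).sub (hx.inner_left v)) fun j => ?_
      rw [← inner_sub_right]
      exact inner_nonneg_of_nonneg hv (sub_nonneg.2 (hadm j).1)
    · rw [← sub_nonneg, sub_neg_eq_add]
      refine nonneg_of_forall_inner_nonneg fun v hv => ?_
      rw [inner_add_right]
      refine ge_of_tendsto' ((hEy v).add (hx.inner_left v)) fun j => ?_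
      rw [← inner_add_right, ← sub_neg_eq_add]
      exact inner_nonneg_of_nonneg hv (sub_nonneg.2 (hadm j).2)
  refine ⟨hfeas, fun v hv1 hv2 => ?_, ?_⟩
  · -- the variational inequality
    let Y : ℕ → USpace T Ω := fun j => cylExt T (toLTwo (w (m j + 1)))
    have hY0 : ∀ j, 0 ≤ Y j := fun j => by
      have h := add_le_add (hadm j).1 (hadm j).2
      rw [add_neg_cancel] at h
      rw [← Lp.coeFn_nonneg]
      filter_upwards [(Lp.coeFn_nonneg _).2 h, Lp.coeFn_add (Y j) (Y j)] with y h1 h2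
      have h3 : (0 : ℝ) ≤ (Y j + Y j : USpace T Ω) y := h1
      rw [h2, Pi.add_apply] at h3
      change 0 ≤ Y j y
      linarith
    have hYae : ∀ᵐ q ∂(volCyl T Ω),
        Tendsto (fun j => Y j q) atTop (𝓝 (cylExt T (toLTwo wbar) q)) := by
      have h1 : ∀ᵐ q ∂(volCyl T Ω), ∀ j, Y j q = toLTwo (w (m j + 1)) q.2 :=
        ae_all_iff.2 fun j => coeFn_cylExt T _
      filter_upwards [ae_volCyl_snd T hae1, h1, coeFn_cylExt T (toLTwo wbar)] with q h2 h3 h4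
      rw [h4]
      exact h2.congr fun j => (h3 j).symm
    -- Truncation makes `v` admissible together with `w_{k+1}`. Keeping this second component
    -- removes the `β` and `γ` terms from the variational inequality.
    let v' : ℕ → USpace T Ω := fun j => (v ⊓ Y j) ⊔ (-Y j)
    have hv' : Tendsto v' atTop (𝓝 v) := tendsto_clamp hY0 hYae hv1 hv2
    have hv'adm : ∀ j, (v' j, w (m j + 1)) ∈ admissible T Ω s k := fun j => by
      rw [mem_admissible_iff]
      refine ⟨sup_le inf_le_right ((neg_nonpos.2 (hY0 j)).trans (hY0 j)), ?_⟩
      exact neg_le.1 le_sup_right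
    -- The quadratic term `-α ‖u_{k+1}‖²` is replaced by its affine majorant, so only linear
    -- expressions in the weakly convergent iterates remain.
    have hvi : ∀ j, 0 ≤ ψ j (v' j) - ψ j (u (m j + 1)) + α * inner ℝ (u (m j + 1)) (v' j)
        - α * (2 * inner ℝ ubar (u (m j + 1)) - ‖ubar‖ ^ 2) := by
      intro j
      have h := (hgen.next_iterate (m j)).variational hd hb hp (hgen.ε_pos _) (hv'adm j)
      obtain ⟨B, hB⟩ := exists_weightForm hd hb hp (hgen.ε_pos (m j)) (w (m j))
      rw [← hB] at h
      simp only [sub_self, map_zero, inner_zero_right, mul_zero, add_zero] at h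
      have h2 := mul_le_mul_of_nonneg_left (two_inner_sub_le_norm_sq (u (m j + 1)) ubar) hα.le
      rw [inner_sub_right (u (m j + 1)), real_inner_self_eq_norm_sq, map_sub,
        inner_sub_right] at h
      simp only [ψ, add_apply, innerSL_apply_apply, real_inner_smul_left]
      linarith
    have hlim1 : Tendsto (fun j => ψ j (v' j)) atTop (𝓝 (fderiv ℝ f ubar v)) := by
      have hc : Continuous fun q : (USpace T Ω →L[ℝ] ℝ) × USpace T Ω => q.1 q.2 :=
        isBoundedBilinearMap_apply.continuous
      exact (hc.tendsto (fderiv ℝ f ubar, v)).comp (hψ.prodMk_nhds hv')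
    have hlim2 : Tendsto (fun j => (inner ℝ (u (m j + 1)) (v' j) : ℝ)) atTop
        (𝓝 (inner ℝ ubar v)) := by
      have h1 : Tendsto (fun j => (inner ℝ (v' j) (u (m j + 1)) : ℝ)) atTop
          (𝓝 (inner ℝ v ubar)) := hx.apply_tendsto (fun j => (hR _).1)
        (((innerSL ℝ).continuous.tendsto v).comp hv')
      rw [real_inner_comm]
      exact h1.congr fun j => real_inner_comm _ _
    have hlim := (((hlim1.sub hψx).add (hlim2.const_mul α)).sub
      ((((hx.inner_left ubar).const_mul 2).sub_const (‖ubar‖ ^ 2)).const_mul α))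
    have h0 := ge_of_tendsto' hlim hvi
    rw [inner_sub_right, map_sub, real_inner_self_eq_norm_sq]
    rw [real_inner_self_eq_norm_sq] at h0
    linarith
  · -- the nonsmooth term
    have hle : ∀ j, ∫ x, psiDeriv p (ε (m j)) (toLTwo (w (m j)) x ^ 2) *
        (toLTwo (w (m j + 1)) x * toLTwo (w (m j + 1)) x) ∂(volOn Ω)
        ≤ (2 * γ)⁻¹ * (-ψ j (u (m j + 1)) - α * (2 * inner ℝ ubar (u (m j + 1)) - ‖ubar‖ ^ 2)
          - β * (2 * inner ℝ wbar (w (m j + 1)) - ‖wbar‖ ^ 2)) := by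
      intro j
      have h := (hgen.next_iterate (m j)).test_zero hd hb hp (hgen.ε_pos _)
      have h1 := mul_le_mul_of_nonneg_left (two_inner_sub_le_norm_sq (u (m j + 1)) ubar) hα.le
      have h2 := mul_le_mul_of_nonneg_left (two_inner_sub_le_norm_sq (w (m j + 1)) wbar) hβ.le
      rw [le_inv_mul_iff₀ (by positivity)]
      simp only [ψ, add_apply, innerSL_apply_apply, real_inner_smul_left] at h ⊢
      linarith
    have hlim := ((hψx.neg.sub
      ((((hx.inner_left ubar).const_mul 2).sub_const (‖ubar‖ ^ 2)).const_mul α)).sub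
      ((((hy.inner_left wbar).const_mul 2).sub_const (‖wbar‖ ^ 2)).const_mul β)).const_mul
        (2 * γ)⁻¹
    -- The weight sits at the old iterate and the square at the new one; both converge almost
    -- everywhere to `w̄`.
    have h := integral_rpow_le_of_tendsto hp (fun j => hgen.ε_pos (m j))
      (hgen.ε_tendsto.comp hm) (fun j => (Lp.stronglyMeasurable (toLTwo (w (m j)))).measurable)
      (fun j => (Lp.stronglyMeasurable (toLTwo (w (m j + 1)))).measurable)
      (Lp.stronglyMeasurable (toLTwo wbar)).measurable
      (fun j => integrable_weight hp (hgen.ε_pos _) _ _ _) hae0 hae1 hlim hle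
    rw [le_inv_mul_iff₀ (by positivity), real_inner_self_eq_norm_sq,
      real_inner_self_eq_norm_sq] at h
    linarith

end MainProof

end FracSparse

end

/-! ### Explicit construction of the multipliers. -/

theorem mainTheorem7 {d : ℕ} (hd : 0 < d) (Ω : Opens (Sp d)) (hΩ : IsBoundedLipschitzDomain Ω)
    {T : ℝ} (hT : 0 < T) (s : Ioo (0 : ℝ) 1) (k : Kind)
    (f : USpace T Ω → ℝ) (hf : StandingAssumption f) (hf' : DerivAssumption f)
    {α β γ p : ℝ} (hα : 0 < α) (hβ : 0 < β) (hγ : 0 < γ) (hp : p ∈ Ioo (0 : ℝ) 1)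
    (b L : ℝ) (ε : ℕ → ℝ) (u : ℕ → USpace T Ω) (w : ℕ → WSpace Ω s k) (Ls : ℕ → ℝ)
    (hgen : IsGenerated f α β γ p b L ε u w Ls)
    (ubar : USpace T Ω) (wbar : WSpace Ω s k) (n : ℕ → ℕ) (hn : StrictMono n)
    (hu : WeakTendsto (fun j => u (n j)) ubar) (hw : WeakTendsto (fun j => w (n j)) wbar) :
    ∃ (lbar : WSpace Ω s k →L[ℝ] ℝ) (μ₁ μ₂ : USpace T Ω),
      (∀ (v : USpace T Ω) (z : WSpace Ω s k),
        fderiv ℝ f ubar v + α * inner ℝ ubar v + β * inner ℝ wbar z + γ * lbar z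
          + inner ℝ μ₁ (cylExt T (toLTwo z) - v) + inner ℝ μ₂ (cylExt T (toLTwo z) + v) = 0) ∧
      p * (∫ x, |toLTwo wbar x| ^ p ∂(volOn Ω)) ≤ lbar wbar ∧
      μ₁ ∈ subdifferential (indicatorFun (nonnegCone T Ω)) (cylExt T (toLTwo wbar) - ubar) ∧
      μ₂ ∈ subdifferential (indicatorFun (nonnegCone T Ω)) (cylExt T (toLTwo wbar) + ubar) := by
  have hb := hΩ.bounded
  obtain ⟨ι, hι⟩ := exists_toLTwoL hd hb s k
  obtain ⟨E, hE⟩ := exists_cylExtL T Ω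
  obtain ⟨⟨hle1, hle2⟩, hVI, hlam⟩ := limit_properties hd hb hf hf' hα hβ hγ hp hgen hn hu hw
  set y : USpace T Ω := cylExt T (toLTwo wbar)
  set g : USpace T Ω := (InnerProductSpace.toDual ℝ _).symm (fderiv ℝ f ubar) + α • ubar
  have hg : ∀ v, inner ℝ g v = fderiv ℝ f ubar v + α * inner ℝ ubar v := fun v => by
    rw [inner_add_left, InnerProductSpace.toDual_symm_apply, real_inner_smul_left]
  have hVI' : ∀ v : USpace T Ω, v ≤ y → -v ≤ y → 0 ≤ (inner ℝ g (v - ubar) : ℝ) := fun v h1 h2 => by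
    rw [hg]
    exact hVI v h1 h2
  have ha1 : 0 ≤ y - ubar := sub_nonneg.2 hle1
  have ha2 : 0 ≤ y + ubar := neg_le_iff_add_nonneg'.1 hle2 |>.trans_eq (add_comm _ _)
  have hc1 : (inner ℝ g⁻ (y - ubar) : ℝ) = 0 := by
    rw [← posPart_neg]
    -- Since `g⁻ = (-g)⁺`, it suffices to test with `ū + v`, which stays between the bounds for `0 ≤
    -- v ≤ w̄ - ū`. The case of `g⁺` uses `ū - v`.
    refine inner_posPart_eq_zero ha1 fun v h0 hv => ?_
    have h := hVI' (ubar + v) (by rwa [← le_sub_iff_add_le'])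
      (by rw [neg_add]; exact (add_le_of_nonpos_right (neg_nonpos.2 h0)).trans hle2)
    rw [add_sub_cancel_left] at h
    rw [inner_neg_left]
    linarith
  have hc2 : (inner ℝ g⁺ (y + ubar) : ℝ) = 0 := by
    refine inner_posPart_eq_zero ha2 fun v h0 hv => ?_
    have h := hVI' (ubar - v) ((sub_le_self _ h0).trans hle1)
      (by rw [neg_sub]; exact sub_le_iff_le_add.2 hv)
    rw [sub_sub_cancel_left, inner_neg_right] at h
    linarith
  have hgd : ∀ v, (inner ℝ g v : ℝ) = inner ℝ g⁺ v - inner ℝ g⁻ v := fun v => by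
    rw [← inner_sub_left, posPart_sub_negPart]
  -- The `v` part of the equation requires `μ₂ - μ₁ = -g`, which these signs satisfy; its `z` part
  -- then determines `λ`, with `g⁺ + g⁻ = |g|`.
  refine ⟨γ⁻¹ • (-(β • innerSL ℝ wbar) + (innerSL ℝ (g⁺ + g⁻)).comp (E.comp ι)), -g⁻, -g⁺,
    fun v z => ?_, ?_, neg_mem_subdifferential ha1 (negPart_nonneg g) hc1,
    neg_mem_subdifferential ha2 (posPart_nonneg g) hc2⟩
  · have h := hg v
    rw [hgd] at h
    simp only [smul_apply, add_apply,
      neg_apply, ContinuousLinearMap.comp_apply, innerSL_apply_apply, hE, hι,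
      smul_eq_mul, mul_inv_cancel_left₀ hγ.ne', inner_neg_left, inner_add_left, inner_sub_right,
      inner_add_right]
    linarith
  · have h := hg ubar
    rw [hgd, real_inner_self_eq_norm_sq] at h
    rw [inner_sub_right] at hc1
    rw [inner_add_right] at hc2
    -- Complementarity turns `(g⁺ + g⁻, w̄)` into `-(g, ū)`, so the right-hand side of `hlam` equals
    -- `γ ⟨λ, w̄⟩`.
    refine le_of_mul_le_mul_left (hlam.trans (le_of_eq ?_)) hγ
    simp only [smul_apply, add_apply,
      neg_apply, ContinuousLinearMap.comp_apply, innerSL_apply_apply, hE, hι,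
      smul_eq_mul, mul_inv_cancel_left₀ hγ.ne', inner_add_left, real_inner_self_eq_norm_sq]
    change _ = -(β * ‖wbar‖ ^ 2) + (inner ℝ g⁺ y + inner ℝ g⁻ y)
    linarith
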